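/- **Setting.** Let $\mathcal U$ be a nonempty finite set, $n=|\mathcal U|$, and let $f:2^{\mathcal U}\to\mathbb R_{\ge 0}$ be submodular (not necessarily monotone), i.e. $f(S\cup\{x\})-f(S)\ge f(T\cup\{x\})-f(T)$ for $S\subseteq T$, $x\notin T$. Write $\Delta(x\mid S)=f(S\cup\{x\})-f(S)$. Let $k\ge 1$, $0<\varepsilon<1$, $O\in\arg\max_{|S|\le k}f(S)$, and $M=\max_{x\in\mathcal U}f(\{x\})$. The function $f$ is accessed through a value oracle; an adaptive round is a batch of queries made simultaneously, and parallel branches share their rounds. **Algorithm** ParallelInterlaceGreedy (PIG) with input $(f,m,\ell,\tau_{\min},\varepsilon)$. Initialize $I=\{1,\dots,\ell\}$, $m_0=m$ and, for all $j$, $A_j=A_j'=\emptyset$, $V_j=\mathcal U$, $\tau_j=\max_x\Delta(x\mid\emptyset)$ (computed with one round of queries). Let $R=\mathcal U\setminus\bigcup_l A_l$ denote the current set of elements outside all solutions. The subroutine Update$(j)$ replaces $V_j$ by $\{x\in V_j\cap R:\Delta(x\mid A_j)\ge\tau_j\}$ and then, while $V_j=\emptyset$ and $\tau_j\ge\tau_{\min}$,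 replaces $\tau_j$ by $(1-\varepsilon)\tau_j$ and $V_j$ by $\{x\in R:\Delta(x\mid A_j)\ge\tau_j\}$, each time querying the marginal gains anew. While $I\ne\emptyset$ and $m_0>0$: 1. For $j\in I$ in parallel, run Update$(j)$; remove $j$ from $I$ if $\tau_j<\tau_{\min}$. If now $I=\emptyset$, stop. 2. If $|V_i|<2\ell$ for some $i\in I$: for $j\in I$ in increasing order, run Update$(j)$ if $V_j=\emptyset$; if $\tau_j<\tau_{\min}$ remove $j$ from $I$, otherwise pick a uniformly random $x\in V_j$, add it to $A_j$ and $A_j'$, and delete it from all $V_l$. Then decrease $m_0$ by $1$. 3. Otherwise: going through $j\in I$ by nondecreasing $|V_j|$, choose for $\mathcal V_j$ a uniformly random set of $\lfloor |V_j|/|I|\rfloor$ elements of $V_j$ not yet chosen. Put $s=\min\{m_0,\min_{j\in I}|\mathcal V_j|\}$. For $j\in I$ in parallel, order $\mathcal V_j$ uniformly at random as $v_1,v_2,\dots$; for $i\le s$ let $B_j[i]$ be **true** if $\Delta(v_i\mid A_j\cup\{v_1,\dots,v_{i-1}\})\ge\tau_j$, **false** if this gain is negative, **none** otherwise (one round for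 all $i$ and $j$); let $i_j^*$ be the largest $i\le s$ such that at least $(1-\varepsilon)i$ of $B_j[1],\dots,B_j[i]$ are **true**. Put $i^*=\min_{j\in I} i_j^*$. For $j\in I$, let $S_j$ be the first $i^*$ elements of $v_1,\dots,v_{i_j^*}$ when these are rearranged with the **true** ones first, then the **none** ones, then the **false** ones (keeping the order within each class); add $S_j$ to $A_j$ and the elements of $S_j$ not marked **false** to $A_j'$. Decrease $m_0$ by $i^*$. At the end PIG returns $A_1',\dots,A_\ell'$. **Theorem.** There is an absolute constant $C>0$ such that, for all $\mathcal U,f,k,\varepsilon,O$ as above, PIG with input $(f,k,2,\varepsilon M/k,\varepsilon)$ has the following properties. (a) Whenever it returns sets $A_1',A_2'$, these satisfy $|A_1'|,|A_2'|\le k$ and $$\max\{f(A_1'),f(A_2')\}\ \ge\ \left(\tfrac14-\varepsilon\right)f(O).$$ (b) If $f$ is not identically zero, then it terminates for all outcomes of its random choices (each of its loops makes at most a number of iterations that does not depend on the random choices), and if moreover $k\ge 2$, then with probability at least $1-1/n$ it uses at most $C\,\varepsilon^{-4}\log(n)\log(k)$ adaptive rounds and at most $C\,\varepsilon^{-5}\,n\log(n)\log(k)$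 queries. -/

import Mathlib

universe u v

/-- The diminishing-returns form of submodularity of a set function on a finite ground set. -/
def IsSubmodular {U : Type u} [DecidableEq U] (f : Finset U → ℝ) : Prop :=
  ∀ ⦃S T : Finset U⦄, S ⊆ T → ∀ x ∉ T, f (insert x T) - f T ≤ f (insert x S) - f S

/-- `O` maximizes `f` among the sets of size at most `k`. -/
def IsOptimal {U : Type u} (f : Finset U → ℝ) (k : ℕ) (O : Finset U) : Prop :=
  O.card ≤ k ∧ ∀ S : Finset U, S.card ≤ k → f S ≤ f O

/-- The largest value of `f` on a singleton. -/
noncomputable def maxSingleton {U : Type u} [Fintype U] [Nonempty U] (f : Finset U → ℝ) : ℝ :=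
  Finset.univ.sup' Finset.univ_nonempty fun x => f {x}

/-! ### Randomized algorithms with a value oracle

A program never sees the set function itself. It submits a batch of sets (one adaptive round, with
as many queries as the batch has members, counted with multiplicity) and continues with the
answers, or it draws a random object. -/

inductive Prog (U : Type u) (α : Type v) : Type (max (u + 1) v)
  /-- Halt with a result. -/
  | ret (a : α) : Prog U α
  /-- Give up: the bound on the number of iterations of some while loop has been reached. -/
  | cutoff : Prog U α
  /-- One adaptive round: query all the sets of the batch `Q` simultaneously. -/
  | ask (Q : Multiset (Finset U)) (next : (Finset U → ℝ) → Prog U α) : Prog U α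
  /-- Draw a sample, independently of everything before. -/
  | rand (γ : Type u) (p : PMF γ) (next : γ → Prog U α) : Prog U α

/-- What is observed of one run. The result is `none` for a run that was cut off. -/
structure Outcome (α : Type v) where
  result : Option α
  rounds : ℕ
  queries : ℕ

namespace Prog

/-- Sequential composition. -/
def bind {U : Type u} {α β : Type v} : Prog U α → (α → Prog U β) → Prog U β
  | ret a, g => g a
  | cutoff, _ => cutoff
  | ask Q next, g => ask Q fun ans => (next ans).bind g
  | rand γ p next, g => rand γ p fun c => (next c).bind g

/-- The law of the outcome when the oracle is `f`. The program is told the values of `f` on the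
members of the batch, and nothing (the value `0`) about other sets. -/
noncomputable def run {U : Type u} [DecidableEq U] {α : Type v} (f : Finset U → ℝ) :
    Prog U α → PMF (Outcome α)
  | ret a => PMF.pure ⟨some a, 0, 0⟩
  | cutoff => PMF.pure ⟨none, 0, 0⟩
  | ask Q next =>
      (run f (next fun S => if S ∈ Q then f S else 0)).map
        fun o => ⟨o.result, o.rounds + 1, o.queries + Multiset.card Q⟩
  | rand _ p next => p.bind fun c => run f (next c)

end Prog

/-- The uniform distribution on a nonempty finite set (a point mass if the set is empty). -/
noncomputable def uniformOn {γ : Type u} [Nonempty γ] (s : Finset γ) : PMF γ :=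
  open Classical in
  if h : s.Nonempty then PMF.uniformOfFinset s h else PMF.pure (Classical.arbitrary γ)

/-! ### ParallelInterlaceGreedy

Loops "in parallel" share their adaptive rounds: the queries that the branches make at the same
time form one batch. All while loops are cut off after `N` iterations. -/

namespace PIG

/-- The variables of the main loop; the solutions are indexed by `Fin ℓ`. -/
structure State (U : Type u) (ℓ : ℕ) where
  /-- the active indices -/
  I : Finset (Fin ℓ)
  /-- the remaining budget -/
  m₀ : ℕ
  A : Fin ℓ → Finset U
  A' : Fin ℓ → Finset U
  /-- the candidate sets -/
  V : Fin ℓ → Finset U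
  /-- the thresholds -/
  τ : Fin ℓ → ℝ

section

variable {U : Type u} [Fintype U] [DecidableEq U] {ℓ : ℕ}

/-- The elements outside all the solutions. -/
def State.rest (s : State U ℓ) : Finset U :=
  Finset.univ \ Finset.univ.biUnion s.A

/-- The queries that determine the marginal gains over `A` of all the elements of `W`. -/
def gainBatch (A W : Finset U) : Multiset (Finset U) :=
  A ::ₘ W.val.map fun x => insert x A

/-- The marginal gain of `x` over `A`, computed from the answers of the oracle. -/
def gain (ans : Finset U → ℝ) (A : Finset U) (x : U) : ℝ :=
  ans (insert x A) - ans A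

open Classical in
/-- The while loop of `Update`, run in parallel for the indices in `J`: as long as the candidate set
of `j` is empty and its threshold is at least `τmin`, the threshold is multiplied by `1 - ε` and the
candidate set is recomputed from the elements outside all the solutions. -/
noncomputable def updateLoop (ε τmin : ℝ) (J : Finset (Fin ℓ)) :
    ℕ → State U ℓ → Prog U (State U ℓ)
  | 0, _ => .cutoff
  | N + 1, s =>
      let E := J.filter fun j => s.V j = ∅ ∧ τmin ≤ s.τ j
      if E = ∅ then .ret s
      else
        .ask (∑ j ∈ E, gainBatch (s.A j) s.rest) fun ans =>
          updateLoop ε τmin J N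
            { s with
              τ := fun j => if j ∈ E then (1 - ε) * s.τ j else s.τ j
              V := fun j =>
                if j ∈ E then s.rest.filter fun x => (1 - ε) * s.τ j ≤ gain ans (s.A j) x
                else s.V j }

open Classical in
/-- `Update`, run in parallel for the indices in `J`: first filter the candidates by the current
threshold, then lower the threshold if no candidate is left. -/
noncomputable def update (ε τmin : ℝ) (N : ℕ) (J : Finset (Fin ℓ)) (s : State U ℓ) :
    Prog U (State U ℓ) :=
  .ask (∑ j ∈ J, gainBatch (s.A j) (s.V j ∩ s.rest)) fun ans =>
    updateLoop ε τmin J N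
      { s with
        V := fun j =>
          if j ∈ J then (s.V j ∩ s.rest).filter fun x => s.τ j ≤ gain ans (s.A j) x
          else s.V j }

open Classical in
/-- Add one element to each active solution in turn, for the indices in the given list. -/
noncomputable def addOneEach [Nonempty U] (ε τmin : ℝ) (N : ℕ) :
    List (Fin ℓ) → State U ℓ → Prog U (State U ℓ)
  | [], s => .ret s
  | j :: js, s =>
      if j ∈ s.I then
        (if s.V j = ∅ then update ε τmin N {j} s else .ret s).bind fun s =>
          if s.τ j < τmin then addOneEach ε τmin N js { s with I := s.I.erase j }
          else
            .rand U (uniformOn (s.V j)) fun x =>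
              addOneEach ε τmin N js
                { s with
                  A := Function.update s.A j (insert x (s.A j))
                  A' := Function.update s.A' j (insert x (s.A' j))
                  V := fun l => (s.V l).erase x }
      else addOneEach ε τmin N js s

/-- The loop of `Distribute` for `r` input sets: for the indices in the list, in this order, select
uniformly at random `⌊|V j| / r⌋` elements of `V j` that have not been selected before. -/
noncomputable def distributeLoop (r : ℕ) (V : Fin ℓ → Finset U) :
    List (Fin ℓ) → (Fin ℓ → Finset U) → Prog U (Fin ℓ → Finset U)
  | [], W => .ret W
  | j :: js, W =>
      .rand (Finset U)
        (uniformOn ((V j \ Finset.univ.biUnion W).powersetCard ((V j).card / r))) fun S =>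
          distributeLoop r V js (Function.update W j S)

/-- `Distribute` applied to the sets `V j` with `j ∈ I`, which are processed from the smallest to
the largest. -/
noncomputable def distribute (I : Finset (Fin ℓ)) (V : Fin ℓ → Finset U) :
    Prog U (Fin ℓ → Finset U) :=
  distributeLoop I.card V
    (((List.finRange ℓ).filter fun j => j ∈ I).insertionSort fun i j => (V i).card ≤ (V j).card)
    fun _ => ∅

/-- Put each of the sets `W j`, for `j` in the list, into a uniformly random order. -/
noncomputable def permute (W : Fin ℓ → Finset U) :
    List (Fin ℓ) → (Fin ℓ → List U) → Prog U (Fin ℓ → List U)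
  | [], v => .ret v
  | j :: js, v =>
      .rand (List U) (uniformOn (W j).val.lists.toFinset) fun w => permute W js (Function.update v j w)

/-- The queries of `Prefix-Selection` over the solution `A`: the sets `A ∪ {v₁, …, vᵢ}`, `i ≤ s`. -/
def prefixBatch (A : Finset U) (v : List U) (s : ℕ) : Multiset (Finset U) :=
  (Multiset.range (s + 1)).map fun i => A ∪ (v.take i).toFinset

open Classical in
/-- The mark of the `i`-th element (counted from `0`) of the random order `v`: `some true` if its
gain over `A` and its predecessors is at least `τ`, `some false` if the gain is negative, and `none`
otherwise. -/
noncomputable def mark (ans : Finset U → ℝ) (A : Finset U) (v : List U) (τ : ℝ) (i : ℕ) :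
    Option Bool :=
  let g := ans (A ∪ (v.take (i + 1)).toFinset) - ans (A ∪ (v.take i).toFinset)
  if τ ≤ g then some true else if g < 0 then some false else none

/-- The array `B[1 : s]` of marks. -/
noncomputable def marks (ans : Finset U → ℝ) (A : Finset U) (v : List U) (τ : ℝ) (s : ℕ) :
    List (Option Bool) :=
  (List.range s).map (mark ans A v τ)

open Classical in
/-- The largest `i ≤ |B|` such that at least `(1 - ε) i` of the first `i` marks are true. -/
noncomputable def goodPrefix (ε : ℝ) (B : List (Option Bool)) : ℕ :=
  Nat.findGreatest (fun i => (1 - ε) * i ≤ ((B.take i).count (some true) : ℝ)) B.length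

/-- The first `p` elements of `v`, each with its mark, in the order of the three passes. -/
def threePasses (v : List U) (B : List (Option Bool)) (p : ℕ) : List (U × Option Bool) :=
  let P := (v.zip B).take p
  P.filter (fun y => y.2 = some true) ++ P.filter (fun y => y.2 = none) ++
    P.filter (fun y => y.2 = some false)

/-- Add an equal number of elements to each active solution. -/
noncomputable def addBlocks (ε : ℝ) (s : State U ℓ) (hI : s.I.Nonempty) : Prog U (State U ℓ) :=
  (distribute s.I s.V).bind fun W =>
    let size := min s.m₀ (s.I.inf' hI fun j => (W j).card)
    (permute W ((List.finRange ℓ).filter fun j => j ∈ s.I) fun _ => []).bind fun v =>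
      .ask (∑ j ∈ s.I, prefixBatch (s.A j) (v j) size) fun ans =>
        let B := fun j => marks ans (s.A j) (v j) (s.τ j) size
        let istar := s.I.inf' hI fun j => goodPrefix ε (B j)
        let sel := fun j => (threePasses (v j) (B j) (goodPrefix ε (B j))).take istar
        .ret
          { s with
            A := fun j =>
              if j ∈ s.I then s.A j ∪ ((sel j).map Prod.fst).toFinset else s.A j
            A' := fun j =>
              if j ∈ s.I then
                s.A' j ∪ (((sel j).filter fun y => y.2 ≠ some false).map Prod.fst).toFinset
              else s.A' j
            m₀ := s.m₀ - istar }

open Classical in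
/-- The main while loop, with at most the given number of iterations. -/
noncomputable def mainLoop [Nonempty U] (ε τmin : ℝ) (N : ℕ) :
    ℕ → State U ℓ → Prog U (State U ℓ)
  | 0, _ => .cutoff
  | n + 1, s =>
      if s.I = ∅ ∨ s.m₀ = 0 then .ret s
      else
        (update ε τmin N s.I s).bind fun s =>
          let s : State U ℓ := { s with I := s.I.filter fun j => ¬ s.τ j < τmin }
          if hI : s.I.Nonempty then
            if ∃ i ∈ s.I, (s.V i).card < 2 * ℓ then
              (addOneEach ε τmin N (List.finRange ℓ) s).bind fun s =>
                mainLoop ε τmin N n { s with m₀ := s.m₀ - 1 }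
            else (addBlocks ε s hI).bind fun s => mainLoop ε τmin N n s
          else .ret s

end

end PIG

/-- `ParallelInterlaceGreedy` with size constraint `m`, number `ℓ` of solutions, minimum threshold
`τmin` and error `ε`; every while loop is cut off after `N` iterations. The result is the family of
the sets `A'₁, …, A'_ℓ`. -/
noncomputable def parallelInterlaceGreedy (U : Type u) [Fintype U] [DecidableEq U] [Nonempty U]
    (m ℓ : ℕ) (τmin ε : ℝ) (N : ℕ) : Prog U (Fin ℓ → Finset U) :=
  .ask (PIG.gainBatch ∅ Finset.univ) fun ans =>
    (PIG.mainLoop ε τmin N N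
      { I := Finset.univ
        m₀ := m
        A := fun _ => ∅
        A' := fun _ => ∅
        V := fun _ => Finset.univ
        τ := fun _ => Finset.univ.sup' Finset.univ_nonempty fun x => PIG.gain ans ∅ x }).bind
      fun s => .ret s.A'

/-! Approximation. Two disjoint solutions give f(O) ≤ f(O ∪ A₀) + f(O ∪ A₁), so it suffices to bound
what O adds to each A j. An element outside the solutions gains at most (1 - ε)⁻¹ max(τ j, τmin)
over A j, because a threshold is lowered only when no candidate is left (`GainBound`). Every element
put into A j earns about τ j and opens a slot at that price, into which an element of O that joins
the other solution can be charged. `Ledger` does this bookkeeping: `Ledger.add` updates it,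
`Ledger.lower` keeps it valid when thresholds fall, and `Ledger.final` turns it into the bound on
f(O). An index that has become inactive charges at price τmin, which costs at most k τmin ≤ ε f(O)
up to the factor (1 - ε)⁻¹.

Lowering a threshold is harmless only if no slot count is negative, and an element of O given to
solution 0 before solution 1 has a slot would violate this. The remedy is `LedgerInv`. While both
solutions lie inside O, subadditivity alone pays for everything (`Ledger.of_subset`). The first
iteration that leaves O creates a spare slot for solution 1, and interlacing preserves it from then
on. The delicate case is a block that stays in O for solution 0 but not for solution 1;
`HasLedger.block_of_subset` treats the first element of that block separately.

Elements marked false may enter A but not A'. They come last in the three passes, so one of them is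
added only together with all its predecessors. Its recorded negative gain is then its true gain
(`Marked.union_sub_le`), whence f(A j) ≤ f(A' j). A fraction 1 - ε of the added elements is marked
true, which pays for the ledger with factor (1 - ε)⁻².

Complexity. The potential `State.pot` counts possible threshold reductions, possible losses of a
fraction ε/64 of the candidates, and halvings of the budget; it is O(ε⁻³ log n log k) initially.
Threshold reductions pay for their own rounds. An iteration that adds single elements always lowers
the potential, and a block lowers it with probability at least 1/2 (`pot_block_succ_le`). Indeed, if
few candidates have low gain, a supermartingale keeps the number of bad elements in a random order
below ε times its length (`four_mul_card_not_goodOrder_le`), so half of the examined elements are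
added; otherwise the low-gain candidates disappear. Hence the expectation of (9/8)^rounds is
O(2^pot) (`wexp_mainLoop_le`), and Markov's inequality bounds the rounds. Each batch has at most 4n
members, which bounds the queries.

The two halves use two logics of programs: `Prog.Sat`, a Hoare-style predicate over all runs that
counts rounds, and `Prog.wexp`, an exponential moment of the rounds. -/

/-! ### Reasoning about programs -/

namespace Prog

section

variable {U : Type u} [DecidableEq U] {α β : Type v}

/-- Every run with oracle `f` that returns `a`, having used `r'` rounds (counted from `r`),
satisfies `φ a r'`, and a run is cut off only if `c` holds. -/
def Sat (f : Finset U → ℝ) (φ : α → ℕ → Prop) (c : Prop) : ℕ → Prog U α → Prop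
  | r, ret a => φ a r
  | _, cutoff => c
  | r, ask Q next => Sat f φ c (r + 1) (next fun S => if S ∈ Q then f S else 0)
  | r, rand _ p next => ∀ x ∈ p.support, Sat f φ c r (next x)

theorem Sat.mono {f : Finset U → ℝ} {φ ψ : α → ℕ → Prop} {c d : Prop}
    (hφ : ∀ a r, φ a r → ψ a r) (hc : c → d) :
    ∀ {P : Prog U α} {r : ℕ}, Sat f φ c r P → Sat f ψ d r P
  | ret a, r, h => hφ a r h
  | cutoff, _, h => hc h
  | ask _ next, _, h => Sat.mono (P := next _) hφ hc h
  | rand _ _ next, _, h => fun x hx => Sat.mono (P := next x) hφ hc (h x hx)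

theorem Sat.bind {f : Finset U → ℝ} {φ : α → ℕ → Prop} {ψ : β → ℕ → Prop} {c : Prop}
    {g : α → Prog U β} (hg : ∀ a r, φ a r → Sat f ψ c r (g a)) :
    ∀ {P : Prog U α} {r : ℕ}, Sat f φ c r P → Sat f ψ c r (P.bind g)
  | ret a, r, h => hg a r h
  | cutoff, _, h => h
  | ask _ next, _, h => Sat.bind (P := next _) hg h
  | rand _ _ next, _, h => fun x hx => Sat.bind (P := next x) hg (h x hx)

theorem Sat.of_mem_support_run {f : Finset U → ℝ} {φ : α → ℕ → Prop} {c : Prop} :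
    ∀ {P : Prog U α} {r : ℕ}, Sat f φ c r P → ∀ o ∈ (P.run f).support,
      (∃ a, o.result = some a ∧ φ a (r + o.rounds)) ∨ (o.result = none ∧ c)
  | ret a, r, h, o, ho => by
      simp only [run, PMF.support_pure, Set.mem_singleton_iff] at ho
      subst ho
      exact Or.inl ⟨a, rfl, h⟩
  | cutoff, r, h, o, ho => by
      simp only [run, PMF.support_pure, Set.mem_singleton_iff] at ho
      subst ho
      exact Or.inr ⟨rfl, h⟩
  | ask Q next, r, h, o, ho => by
      simp only [run, PMF.support_map, Set.mem_image] at ho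
      obtain ⟨o', ho', rfl⟩ := ho
      rcases Sat.of_mem_support_run (P := next _) h o' ho' with ⟨a, ha, hφ⟩ | h'
      · refine Or.inl ⟨a, ha, ?_⟩
        have : r + (o'.rounds + 1) = r + 1 + o'.rounds := by omega
        simpa only [this] using hφ
      · exact Or.inr h'
  | rand _ p next, r, h, o, ho => by
      simp only [run, PMF.mem_support_bind_iff] at ho
      obtain ⟨x, hx, ho⟩ := ho
      exact Sat.of_mem_support_run (P := next x) (h x hx) o ho

end

/-! ### From rounds to queries through the batch size -/

section

variable {U : Type u} {α β : Type v}

/-- All batches have at most `B` members. -/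
def MaxBatch (B : ℕ) : Prog U α → Prop
  | ret _ => True
  | cutoff => True
  | ask Q next => Multiset.card Q ≤ B ∧ ∀ ans, MaxBatch B (next ans)
  | rand _ _ next => ∀ x, MaxBatch B (next x)

theorem MaxBatch.bind {B : ℕ} {g : α → Prog U β} (hg : ∀ a, MaxBatch B (g a)) :
    ∀ {P : Prog U α}, MaxBatch B P → MaxBatch B (P.bind g)
  | ret a, _ => hg a
  | cutoff, _ => trivial
  | ask _ next, h => ⟨h.1, fun ans => MaxBatch.bind (P := next ans) hg (h.2 ans)⟩
  | rand _ _ next, h => fun x => MaxBatch.bind (P := next x) hg (h x)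

theorem MaxBatch.queries_le [DecidableEq U] {B : ℕ} {f : Finset U → ℝ} :
    ∀ {P : Prog U α}, MaxBatch B P → ∀ o ∈ (P.run f).support, o.queries ≤ B * o.rounds
  | ret a, _, o, ho => by
      simp only [run, PMF.support_pure, Set.mem_singleton_iff] at ho
      subst ho
      simp
  | cutoff, _, o, ho => by
      simp only [run, PMF.support_pure, Set.mem_singleton_iff] at ho
      subst ho
      simp
  | ask Q next, h, o, ho => by
      simp only [run, PMF.support_map, Set.mem_image] at ho
      obtain ⟨o', ho', rfl⟩ := ho
      have := MaxBatch.queries_le (P := next _) (h.2 _) o' ho'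
      have h1 := h.1
      simp only [mul_add, mul_one]
      omega
  | rand _ p next, h, o, ho => by
      simp only [run, PMF.mem_support_bind_iff] at ho
      obtain ⟨x, hx, ho⟩ := ho
      exact MaxBatch.queries_le (P := next x) (h x) o ho

end

/-! ### Exponential moments of the number of rounds -/

section

variable {U : Type u} [DecidableEq U] {α β : Type v}

open scoped ENNReal

/-- The expectation of `q ^ rounds * g result` over the runs with oracle `f` that are not cut
off. -/
noncomputable def wexp (q : ℝ≥0∞) (f : Finset U → ℝ) (g : α → ℝ≥0∞) : Prog U α → ℝ≥0∞
  | ret a => g a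
  | cutoff => 0
  | ask Q next => q * wexp q f g (next fun S => if S ∈ Q then f S else 0)
  | rand _ p next => ∑' x, p x * wexp q f g (next x)

/-- The weight q ^ rounds is multiplicative under sequential composition, so moments of the main
loop can be bounded by recursion on its body. -/
theorem wexp_bind (q : ℝ≥0∞) (f : Finset U → ℝ) (g : β → ℝ≥0∞) (h : α → Prog U β) :
    ∀ P : Prog U α, wexp q f g (P.bind h) = wexp q f (fun a => wexp q f g (h a)) P
  | ret _ => rfl
  | cutoff => rfl
  | ask _ next => congrArg (q * ·) (wexp_bind q f g h (next _))
  | rand _ p next => tsum_congr fun x => congrArg (p x * ·) (wexp_bind q f g h (next x))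

theorem wexp_add (q : ℝ≥0∞) (f : Finset U → ℝ) (g g' : α → ℝ≥0∞) :
    ∀ P : Prog U α, wexp q f (fun a => g a + g' a) P = wexp q f g P + wexp q f g' P
  | ret _ => rfl
  | cutoff => (add_zero 0).symm
  | ask _ next => by
      simp only [wexp]
      rw [wexp_add q f g g' (next _), mul_add]
  | rand _ p next => by
      simp only [wexp]
      rw [← ENNReal.tsum_add]
      exact tsum_congr fun x => by rw [wexp_add q f g g' (next x), mul_add]

theorem wexp_const_mul (q b : ℝ≥0∞) (f : Finset U → ℝ) (g : α → ℝ≥0∞) :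
    ∀ P : Prog U α, wexp q f (fun a => b * g a) P = b * wexp q f g P
  | ret _ => rfl
  | cutoff => (mul_zero b).symm
  | ask _ next => by
      simp only [wexp]
      rw [wexp_const_mul q b f g (next _), mul_left_comm]
  | rand _ p next => by
      simp only [wexp]
      rw [← ENNReal.tsum_mul_left]
      exact tsum_congr fun x => by rw [wexp_const_mul q b f g (next x), mul_left_comm]

theorem wexp_zero (q : ℝ≥0∞) (f : Finset U → ℝ) (P : Prog U α) :
    wexp q f (fun _ => 0) P = 0 := by
  simpa using wexp_const_mul q 0 f (fun _ => (0 : ℝ≥0∞)) P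

theorem wexp_sum {ι : Type*} (q : ℝ≥0∞) (f : Finset U → ℝ) (s : Finset ι) (g : ι → α → ℝ≥0∞)
    (P : Prog U α) : wexp q f (fun a => ∑ i ∈ s, g i a) P = ∑ i ∈ s, wexp q f (g i) P := by
  classical
  induction s using Finset.induction_on with
  | empty => simpa using wexp_zero q f P
  | insert i s hi ih =>
      simp only [Finset.sum_insert hi]
      rw [wexp_add, ih]

/-- Only results that can occur matter, and `Sat` restricts them. Runs that are cut off contribute 0
to both sides, so `c` is arbitrary. -/
theorem wexp_mono {q : ℝ≥0∞} {f : Finset U → ℝ} {φ : α → ℕ → Prop} {c : Prop}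
    {g g' : α → ℝ≥0∞} (hg : ∀ a r, φ a r → g a ≤ g' a) :
    ∀ {P : Prog U α} {r : ℕ}, Sat f φ c r P → wexp q f g P ≤ wexp q f g' P
  | ret a, r, h => hg a r h
  | cutoff, _, _ => le_rfl
  | ask _ next, r, h => mul_le_mul_right (wexp_mono (P := next _) hg h) q
  | rand _ p next, r, h => ENNReal.tsum_le_tsum fun x => by
      by_cases hx : x ∈ p.support
      · exact mul_le_mul_right (wexp_mono (P := next x) hg (h x hx)) _
      · simp [(PMF.apply_eq_zero_iff p x).2 hx]

theorem tsum_mul_le_of_forall_support {γ : Type*} (p : PMF γ) (g : γ → ℝ≥0∞) (b : ℝ≥0∞)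
    (h : ∀ x ∈ p.support, g x ≤ b) : ∑' x, p x * g x ≤ b := by
  calc ∑' x, p x * g x ≤ ∑' x, p x * b := ENNReal.tsum_le_tsum fun x => by
        by_cases hx : x ∈ p.support
        · exact mul_le_mul_right (h x hx) _
        · simp [(PMF.apply_eq_zero_iff p x).2 hx]
    _ = b := by rw [ENNReal.tsum_mul_right, p.tsum_coe, one_mul]

/-- The weighted expectation of a program is at most the largest value that can occur. -/
theorem wexp_le_of_sat {q : ℝ≥0∞} {f : Finset U → ℝ} {φ : α → ℕ → Prop} {c : Prop}
    {g : α → ℝ≥0∞} {b : ℝ≥0∞} (hg : ∀ a r, φ a r → q ^ r * g a ≤ b) :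
    ∀ {P : Prog U α} {r : ℕ}, Sat f φ c r P → q ^ r * wexp q f g P ≤ b
  | ret a, r, h => hg a r h
  | cutoff, _, _ => by simp [wexp]
  | ask _ next, r, h => by
      have := wexp_le_of_sat (P := next _) hg h
      rwa [pow_succ, mul_assoc] at this
  | rand _ p next, r, h => by
      simp only [wexp]
      rw [← ENNReal.tsum_mul_left]
      simp only [mul_left_comm (q ^ r)]
      exact tsum_mul_le_of_forall_support p _ b fun x hx =>
        wexp_le_of_sat (P := next x) hg (h x hx)

theorem tsum_pure_mul {γ : Type*} (a : γ) (h : γ → ℝ≥0∞) :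
    ∑' x, (PMF.pure a) x * h x = h a := by
  classical
  rw [tsum_eq_single a]
  · simp
  · intro b hb
    simp [PMF.pure_apply, hb]

theorem tsum_bind_mul {γ δ : Type*} (p : PMF γ) (k : γ → PMF δ) (h : δ → ℝ≥0∞) :
    ∑' y, (p.bind k) y * h y = ∑' x, p x * ∑' y, k x y * h y := by
  simp only [PMF.bind_apply, ← ENNReal.tsum_mul_right, ← ENNReal.tsum_mul_left]
  rw [ENNReal.tsum_comm]
  simp only [mul_assoc]

/-- Ties the recursively defined moment to the law of the observed outcome, where the actual
probability statement lives. -/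
theorem tsum_run_eq_wexp (q : ℝ≥0∞) (f : Finset U → ℝ) (g : α → ℝ≥0∞) :
    ∀ P : Prog U α,
      ∑' o, P.run f o * (q ^ o.rounds * o.result.elim 0 g) = wexp q f g P
  | ret a => by simp only [run, wexp, tsum_pure_mul]; simp
  | cutoff => by simp only [run, wexp, tsum_pure_mul]; simp
  | ask Q next => by
      simp only [run, wexp, PMF.map, tsum_bind_mul, Function.comp_apply, tsum_pure_mul]
      rw [← tsum_run_eq_wexp q f g (next _), ← ENNReal.tsum_mul_left]
      refine tsum_congr fun o => ?_
      rw [pow_succ]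
      ring
  | rand _ p next => by
      simp only [run, wexp, tsum_bind_mul]
      exact tsum_congr fun x => congrArg (p x * ·) (tsum_run_eq_wexp q f g (next x))

/-- Markov's inequality for the number of rounds of a program that is never cut off. -/
theorem toOuterMeasure_rounds_le {q : ℝ≥0∞} (hq : 1 ≤ q) (hq' : q ≠ ⊤) {f : Finset U → ℝ}
    {P : Prog U α} (hP : ∀ o ∈ (P.run f).support, o.result ≠ none) (R : ℕ) {δ : ℝ≥0∞}
    (h : wexp q f (fun _ => 1) P ≤ δ * q ^ R) {S : Set (Outcome α)}
    (hS : ∀ o ∈ (P.run f).support, o.rounds < R → o ∈ S) :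
    1 - δ ≤ (P.run f).toOuterMeasure S := by
  classical
  rw [tsub_le_iff_right, PMF.toOuterMeasure_apply, ← (P.run f).tsum_coe]
  have hR : q ^ R ≠ 0 := (zero_lt_one.trans_le (one_le_pow₀ hq)).ne'
  -- Markov: on runs with at least R rounds, q ^ R ≤ q ^ rounds. Absence of cutoffs is essential,
  -- because such runs are invisible to `wexp`.
  have key : ∑' o, P.run f o * (if R ≤ o.rounds then 1 else 0) ≤ δ := by
    have : q ^ R * ∑' o, P.run f o * (if R ≤ o.rounds then 1 else 0) ≤ δ * q ^ R := by
      refine le_trans ?_ h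
      rw [← tsum_run_eq_wexp, ← ENNReal.tsum_mul_left]
      refine ENNReal.tsum_le_tsum fun o => ?_
      by_cases ho : o ∈ (P.run f).support
      · rw [mul_left_comm]
        refine mul_le_mul_right ?_ _
        obtain ⟨a, ha⟩ := Option.ne_none_iff_exists'.1 (hP o ho)
        split_ifs with hR
        · simpa [ha] using pow_le_pow_right₀ hq hR
        · simp
      · simp [(PMF.apply_eq_zero_iff _ o).2 ho]
    rw [mul_comm] at this
    exact (ENNReal.mul_le_mul_iff_left hR (ENNReal.pow_ne_top hq')).1 this
  refine le_trans ?_ (add_le_add_right key _)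
  rw [← ENNReal.tsum_add]
  refine ENNReal.tsum_le_tsum fun o => ?_
  by_cases ho : o ∈ (P.run f).support
  · by_cases hR : R ≤ o.rounds
    · simp [hR]
    · simp [hS o ho (not_le.1 hR)]
  · simp [(PMF.apply_eq_zero_iff _ o).2 ho]

end

end Prog

/-! ### The uniform distribution -/

section

open scoped ENNReal

variable {γ : Type u} [Nonempty γ]

theorem mem_of_mem_support_uniformOn {s : Finset γ} (hs : s.Nonempty) {x : γ}
    (hx : x ∈ (uniformOn s).support) : x ∈ s := by
  rw [uniformOn, dif_pos hs] at hx
  simpa using hx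

theorem tsum_uniformOn_mul {s : Finset γ} (hs : s.Nonempty) (g : γ → ℝ≥0∞) :
    ∑' x, uniformOn s x * g x = (s.card : ℝ≥0∞)⁻¹ * ∑ x ∈ s, g x := by
  rw [uniformOn, dif_pos hs, tsum_eq_sum (s := s), Finset.mul_sum]
  · exact Finset.sum_congr rfl fun x hx => by rw [PMF.uniformOfFinset_apply_of_mem hs hx]
  · intro x hx
    rw [PMF.uniformOfFinset_apply_of_notMem hs hx, zero_mul]

end

/-! ### Submodular functions -/

section

open PIG

variable {U : Type u} [DecidableEq U] {f : Finset U → ℝ}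

theorem IsSubmodular.gain_anti (hf : IsSubmodular f) {S T : Finset U} (hST : S ⊆ T) {x : U}
    (hx : x ∉ T) : gain f T x ≤ gain f S x :=
  hf hST x hx

theorem IsSubmodular.union_sub_le (hf : IsSubmodular f) {S T X : Finset U} (hST : S ⊆ T)
    (hX : Disjoint X T) : f (T ∪ X) - f T ≤ f (S ∪ X) - f S := by
  induction X using Finset.induction_on with
  | empty => simp
  | insert x X hx ih =>
      rw [Finset.disjoint_insert_left] at hX
      have h := hf (Finset.union_subset_union_left (t := X) hST) x
        (by simp [hX.1, hx])
      rw [Finset.union_insert, Finset.union_insert]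
      linarith [ih hX.2]

theorem IsSubmodular.union_sub_le_card_mul (hf : IsSubmodular f) {S T X : Finset U} (hST : S ⊆ T)
    (hX : Disjoint X T) {b : ℝ} (hb : ∀ x ∈ X, gain f S x ≤ b) :
    f (T ∪ X) - f T ≤ X.card * b := by
  induction X using Finset.induction_on with
  | empty => simp
  | insert x X hx ih =>
      rw [Finset.disjoint_insert_left] at hX
      have h := hf (hST.trans Finset.subset_union_left : S ⊆ T ∪ X) x (by simp [hX.1, hx])
      have h' := hb x (Finset.mem_insert_self x X)
      have ih' := ih hX.2 fun y hy => hb y (Finset.mem_insert_of_mem hy)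
      rw [Finset.union_insert, Finset.card_insert_of_notMem hx]
      simp only [gain] at h'
      push_cast
      linarith

/-- B \ O adds no more to O ∪ A than to O, and f(O ∪ A ∪ B) ≥ 0. This is the reason for growing two
disjoint solutions: without monotonicity one union may lose everything, but not both. -/
theorem IsSubmodular.le_union_add_union (hf : IsSubmodular f) (h0 : ∀ S, 0 ≤ f S)
    {O A B : Finset U} (hAB : Disjoint A B) : f O ≤ f (O ∪ A) + f (O ∪ B) := by
  have h := hf.union_sub_le (S := O) (T := O ∪ A) (X := B \ O) Finset.subset_union_left
    (by
      rw [Finset.disjoint_left]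
      intro x hx hx'
      rw [Finset.mem_sdiff] at hx
      rcases Finset.mem_union.1 hx' with h | h
      · exact hx.2 h
      · exact Finset.disjoint_left.1 hAB h hx.1)
  rw [Finset.union_sdiff_self_eq_union] at h
  linarith [h0 (O ∪ A ∪ B \ O)]

end

/-! ### Charging the optimal elements to the slots of two disjoint solutions -/

section

open PIG

variable {U : Type u} [DecidableEq U]

theorem biUnion_update_union {ι : Type*} [Fintype ι] [DecidableEq ι] (A : ι → Finset U) (j : ι)
    (S : Finset U) :
    Finset.univ.biUnion (Function.update A j (A j ∪ S)) = Finset.univ.biUnion A ∪ S := by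
  ext x
  simp only [Finset.mem_biUnion, Finset.mem_univ, true_and, Finset.mem_union]
  constructor
  · rintro ⟨i, hi⟩
    by_cases h : i = j
    · subst h
      rw [Function.update_self, Finset.mem_union] at hi
      exact hi.imp_left fun h => ⟨i, h⟩
    · rw [Function.update_of_ne h] at hi
      exact Or.inl ⟨i, hi⟩
  · rintro (⟨i, hi⟩ | hx)
    · refine ⟨i, ?_⟩
      by_cases h : i = j
      · subst h
        simp [hi]
      · rwa [Function.update_of_ne h]
    · exact ⟨j, by simp [hx]⟩

theorem sum_fin_two_of_ne {i j : Fin 2} (hij : i ≠ j) (g : Fin 2 → ℝ) :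
    ∑ l, g l = g i + g j := by
  rw [Fin.sum_univ_two]
  fin_cases i <;> fin_cases j <;> simp_all [add_comm]

/-- The elements of `O` in the solutions have been paid for. In addition `c j` unused slots of value
`τ j` are left for an active index `j`, and every element of `O` outside the solutions can be
charged at the price `τmin` to an inactive index. -/
structure Ledger (f : Finset U → ℝ) (O : Finset U) (k : ℕ) (lam τmin : ℝ)
    (A : Fin 2 → Finset U) (τ c : Fin 2 → ℝ) (Γ : ℝ) : Prop where
  charge : ∑ j, (f (A j ∪ (O ∩ Finset.univ.biUnion A)) - f (A j)) +
    ∑ j, (if τmin ≤ τ j then lam * τ j * c j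
      else lam * τmin * ((O \ Finset.univ.biUnion A).card - k)) ≤ Γ
  slots : ∀ j, ((A j).card : ℝ) - (O ∩ Finset.univ.biUnion A).card ≤ c j

/-- No element outside the solutions has a gain much larger than the thresholds. -/
def GainBound (f : Finset U → ℝ) (lam τmin : ℝ) (A : Fin 2 → Finset U) (τ : Fin 2 → ℝ) : Prop :=
  ∀ j, ∀ x ∉ Finset.univ.biUnion A, gain f (A j) x ≤ lam * max (τ j) τmin

variable {f : Finset U → ℝ} {O : Finset U} {k : ℕ} {lam τmin Γ : ℝ} {A : Fin 2 → Finset U}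
  {τ c : Fin 2 → ℝ}

theorem subset_biUnion_self (A : Fin 2 → Finset U) (j : Fin 2) :
    A j ⊆ Finset.univ.biUnion A :=
  Finset.subset_biUnion_of_mem A (Finset.mem_univ j)

theorem GainBound.mono (hf : IsSubmodular f) (h : GainBound f lam τmin A τ)
    {B : Fin 2 → Finset U} (hAB : ∀ j, A j ⊆ B j) : GainBound f lam τmin B τ := by
  intro i x hx
  refine le_trans (hf.gain_anti (hAB i) fun hx' => hx (subset_biUnion_self B i hx')) (h i x ?_)
  intro hx'
  obtain ⟨l, hl, hxl⟩ := Finset.mem_biUnion.1 hx'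
  exact hx (Finset.mem_biUnion.2 ⟨l, hl, hAB l hxl⟩)

/-- For index j, submodularity says that S ⊆ A j only decreases what O ∩ C adds, and its |S| new
slots account for the increase of Γ. For the other index i, each element of O ∩ S adds at most lam ·
max(τ i, τmin). This uses up one slot if i is active, and otherwise one unit of |O \ C|. -/
theorem Ledger.add (hf : IsSubmodular f)
    (h : Ledger f O k lam τmin A τ c Γ) (hb : GainBound f lam τmin A τ) {i j : Fin 2}
    (hij : i ≠ j) {S : Finset U} (hS : Disjoint S (Finset.univ.biUnion A)) (hj : τmin ≤ τ j) :
    Ledger f O k lam τmin (Function.update A j (A j ∪ S)) τ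
      (fun l => if l = j then c l + S.card else c l - (O ∩ S).card)
      (Γ + lam * τ j * S.card) := by
  have hc := biUnion_update_union A j S
  set C := Finset.univ.biUnion A with hC
  have hOS : Disjoint (O ∩ S) (O ∩ C) :=
    (hS.mono_left Finset.inter_subset_right).mono_right Finset.inter_subset_right
  have hcard : ((O ∩ (C ∪ S)).card : ℝ) = (O ∩ C).card + (O ∩ S).card := by
    rw [Finset.inter_union_distrib_left, Finset.card_union_of_disjoint hOS.symm]
    push_cast
    ring
  have hcard' : ((O \ (C ∪ S)).card : ℝ) = (O \ C).card - (O ∩ S).card := by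
    have h1 := Finset.card_sdiff_add_card_inter O (C ∪ S)
    have h2 := Finset.card_sdiff_add_card_inter O C
    have h1' : ((O \ (C ∪ S)).card : ℝ) + (O ∩ (C ∪ S)).card = O.card := by exact_mod_cast h1
    have h2' : ((O \ C).card : ℝ) + (O ∩ C).card = O.card := by exact_mod_cast h2
    linarith
  have hAj : A j ∪ S ∪ (O ∩ (C ∪ S)) = A j ∪ (O ∩ C) ∪ S := by
    ext x
    simp only [Finset.mem_union, Finset.mem_inter]
    tauto
  have hAi : A i ∪ (O ∩ (C ∪ S)) = A i ∪ (O ∩ C) ∪ (O ∩ S) := by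
    ext x
    simp only [Finset.mem_union, Finset.mem_inter]
    tauto
  have hsub : ∀ l, A l ∪ (O ∩ C) ⊆ C := fun l =>
    Finset.union_subset (subset_biUnion_self A l) Finset.inter_subset_right
  have h1 := hf.union_sub_le (Finset.subset_union_left : A j ⊆ A j ∪ (O ∩ C))
    (hS.mono_right (hsub j))
  have h2 := hf.union_sub_le_card_mul (X := O ∩ S)
    (Finset.subset_union_left : A i ⊆ A i ∪ (O ∩ C))
    ((hS.mono_left Finset.inter_subset_right).mono_right (hsub i)) (b := lam * max (τ i) τmin)
    (fun x hx => hb i x (Finset.disjoint_left.1 hS (Finset.mem_inter.1 hx).2))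
  have h3 := h.charge
  constructor
  · rw [hc]
    rw [sum_fin_two_of_ne hij, sum_fin_two_of_ne hij] at h3 ⊢
    simp only [Function.update_self, Function.update_of_ne hij, hij, if_false, if_true, hj, hcard',
      hAj, hAi, ← hC] at h3 ⊢
    split_ifs at h3 ⊢ with hi
    · rw [max_eq_left hi] at h2
      linarith
    · rw [max_eq_right (not_le.1 hi).le] at h2
      linarith
  · intro l
    have := h.slots l
    rw [hc, hcard]
    by_cases hl : l = j
    · subst hl
      rw [Function.update_self, if_pos rfl, Finset.card_union_of_disjoint
        (hS.mono_right (subset_biUnion_self A l)).symm]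
      push_cast
      have : (0 : ℝ) ≤ (O ∩ S).card := Nat.cast_nonneg _
      linarith
    · rw [Function.update_of_ne hl, if_neg hl]
      linarith

/-- With nonnegative slots, a smaller threshold makes lam · τ j · c j smaller; an index that drops
out replaces a nonnegative term by a nonpositive one. The condition `hc` is what the interlacing of
the two solutions has to secure. -/
theorem Ledger.lower (hlam : 0 ≤ lam) (hτ : 0 ≤ τmin) (hO : O.card ≤ k)
    (h : Ledger f O k lam τmin A τ c Γ) (hc : ∀ j, 0 ≤ c j) {τ' : Fin 2 → ℝ}
    (hττ : ∀ j, τ' j ≤ τ j) : Ledger f O k lam τmin A τ' c Γ := by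
  refine ⟨le_trans (add_le_add_right (Finset.sum_le_sum fun j _ => ?_) _) h.charge, h.slots⟩
  have h1 : ((O \ Finset.univ.biUnion A).card : ℝ) - k ≤ 0 := by
    rw [sub_nonpos]
    exact_mod_cast (Finset.card_le_card Finset.sdiff_subset).trans hO
  have h2 := hττ j
  have h3 := hc j
  split_ifs with h4 h5 h5
  · gcongr
  · linarith
  · have : 0 ≤ lam * τ j * c j := mul_nonneg (mul_nonneg hlam (hτ.trans h5)) h3
    exact le_trans (mul_nonpos_of_nonneg_of_nonpos (mul_nonneg hlam hτ) h1) this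
  · exact le_rfl

/-- The slot counter of an inactive index does not enter the charge, so it may be increased freely.
-/
theorem Ledger.raise (h : Ledger f O k lam τmin A τ c Γ) {c' : Fin 2 → ℝ}
    (hc : ∀ j, c j ≤ c' j) (hc' : ∀ j, τmin ≤ τ j → c' j = c j) :
    Ledger f O k lam τmin A τ c' Γ := by
  refine ⟨le_trans (le_of_eq ?_) h.charge, fun j => (h.slots j).trans (hc j)⟩
  congr 1
  refine Finset.sum_congr rfl fun j _ => ?_
  split_ifs with hj
  · rw [hc' j hj]
  · rfl

/-- Inside O, what is charged to A 0 is the gain of A 1 over it, at most f (A 1) - f ∅, and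
symmetrically. So the current values pay for everything with no slots left over. This is the
starting point of the bookkeeping. -/
theorem Ledger.of_subset (hf : IsSubmodular f) (h0 : ∀ S, 0 ≤ f S) (hlam : 0 ≤ lam)
    (hτ : 0 ≤ τmin) (hO : O.card ≤ k) (hA : Disjoint (A 0) (A 1))
    (hAO : Finset.univ.biUnion A ⊆ O) :
    Ledger f O k lam τmin A τ (fun _ => 0) (f (A 0) + f (A 1)) := by
  have hU : Finset.univ.biUnion A = A 0 ∪ A 1 := by
    ext x
    simp [Fin.exists_fin_two]
  have h1 : ((O \ Finset.univ.biUnion A).card : ℝ) - k ≤ 0 := by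
    rw [sub_nonpos]
    exact_mod_cast (Finset.card_le_card Finset.sdiff_subset).trans hO
  constructor
  · have e1 := hf.union_sub_le (Finset.empty_subset (A 0)) hA.symm
    have e2 := hf.union_sub_le (Finset.empty_subset (A 1)) hA
    rw [Finset.empty_union] at e1 e2
    have e3 : ∑ j, (if τmin ≤ τ j then lam * τ j * 0
      else lam * τmin * ((O \ Finset.univ.biUnion A).card - k)) ≤ 0 := by
      refine Finset.sum_nonpos fun j _ => ?_
      split_ifs
      · simp
      · exact mul_nonpos_of_nonneg_of_nonpos (mul_nonneg hlam hτ) h1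
    have e4 : A 1 ∪ (A 0 ∪ A 1) = A 1 ∪ A 0 := by
      ext x
      simp only [Finset.mem_union]
      tauto
    rw [Finset.inter_eq_right.2 hAO, Fin.sum_univ_two, hU, ← Finset.union_assoc, Finset.union_self,
      e4]
    rw [hU] at e3
    linarith [h0 ∅]
  · intro j
    rw [Finset.inter_eq_right.2 hAO, sub_nonpos]
    exact_mod_cast Finset.card_le_card (subset_biUnion_self A j)

/-- The elements of O \ C remain to be charged. If j is active then A j is full, so |O \ C| ≤ |A j|
- |O ∩ C| ≤ c j and the unused slots suffice. If j is inactive they cost τmin each, and the -k in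
the ledger is compensated by the extra k · lam · τmin. -/
theorem Ledger.final (hf : IsSubmodular f) (h0 : ∀ S, 0 ≤ f S) (hlam : 0 ≤ lam) (hτ : 0 ≤ τmin)
    (hO : O.card ≤ k) (hA : Disjoint (A 0) (A 1)) (h : Ledger f O k lam τmin A τ c Γ)
    (hb : GainBound f lam τmin A τ) (hk : ∀ j, τmin ≤ τ j → k ≤ (A j).card) :
    f O ≤ f (A 0) + f (A 1) + Γ + 2 * (k * lam * τmin) := by
  set C := Finset.univ.biUnion A with hC
  have key : ∀ j, f (O ∪ A j) - f (A j) ≤ f (A j ∪ (O ∩ C)) - f (A j) +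
      (if τmin ≤ τ j then lam * τ j * c j else lam * τmin * ((O \ C).card - k)) +
      k * lam * τmin := by
    intro j
    have h1 := hf.union_sub_le_card_mul (X := O \ C)
      (Finset.subset_union_left : A j ⊆ A j ∪ (O ∩ C))
      (Finset.disjoint_left.2 fun x hx hx' => (Finset.mem_sdiff.1 hx).2
        (Finset.union_subset (subset_biUnion_self A j) Finset.inter_subset_right hx'))
      (b := lam * max (τ j) τmin) (fun x hx => hb j x (Finset.mem_sdiff.1 hx).2)
    have h2 : A j ∪ (O ∩ C) ∪ (O \ C) = O ∪ A j := by
      ext x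
      simp only [Finset.mem_union, Finset.mem_inter, Finset.mem_sdiff]
      tauto
    rw [h2] at h1
    have h3 : 0 ≤ k * lam * τmin := by positivity
    split_ifs with hj
    · rw [max_eq_left hj] at h1
      have h4 := h.slots j
      have h5 : ((O \ C).card : ℝ) + (O ∩ C).card = O.card := by
        exact_mod_cast Finset.card_sdiff_add_card_inter O C
      have h6 : (O.card : ℝ) ≤ k := by exact_mod_cast hO
      have h7 : (k : ℝ) ≤ (A j).card := by exact_mod_cast hk j hj
      have h8 : ((O \ C).card : ℝ) * (lam * τ j) ≤ c j * (lam * τ j) :=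
        mul_le_mul_of_nonneg_right (by rw [← hC] at h4; linarith)
          (mul_nonneg hlam (hτ.trans hj))
      linarith
    · rw [max_eq_right (not_le.1 hj).le] at h1
      linarith
  have h1 := hf.le_union_add_union h0 (O := O) hA
  have h2 := h.charge
  rw [Fin.sum_univ_two, Fin.sum_univ_two] at h2
  linarith [key 0, key 1]

end

/-! ### The marks of a random order -/

section

open PIG

variable {U : Type u} [DecidableEq U] {f : Finset U → ℝ}

theorem union_take_succ_cons (A : Finset U) (x : U) (w : List U) (i : ℕ) :
    A ∪ ((x :: w).take (i + 1)).toFinset = insert x A ∪ (w.take i).toFinset := by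
  ext y
  simp only [List.take_succ_cons, List.toFinset_cons, Finset.mem_union, Finset.mem_insert]
  tauto

theorem marks_cons (A : Finset U) (x : U) (w : List U) (τ : ℝ) (s : ℕ) :
    marks f A (x :: w) τ (s + 1) = mark f A [x] τ 0 :: marks f (insert x A) w τ s := by
  simp only [marks, List.range_succ_eq_map, List.map_cons, List.map_map]
  congr 1
  refine List.map_congr_left fun i _ => ?_
  simp only [Function.comp_apply, mark, Nat.succ_eq_add_one, union_take_succ_cons]

theorem mark_singleton_eq_true (A : Finset U) (x : U) (τ : ℝ) :
    mark f A [x] τ 0 = some true ↔ τ ≤ gain f A x := by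
  have : A ∪ {x} = insert x A := by rw [Finset.union_comm]; rfl
  simp only [mark, gain, List.take_succ_cons, List.take_zero, List.toFinset_cons,
    List.toFinset_nil, insert_empty_eq, this, Finset.union_empty]
  split_ifs <;> simp_all

theorem mark_singleton_eq_false {A : Finset U} {x : U} {τ : ℝ}
    (h : mark f A [x] τ 0 = some false) : gain f A x < 0 := by
  have : A ∪ {x} = insert x A := by rw [Finset.union_comm]; rfl
  simp only [mark, gain, List.take_succ_cons, List.take_zero, List.toFinset_cons,
    List.toFinset_nil, insert_empty_eq, this, Finset.union_empty] at h ⊢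
  split_ifs at h <;> simp_all

theorem mark_singleton_ne_false {A : Finset U} {x : U} {τ : ℝ} (hτ : 0 ≤ τ)
    (h : mark f A [x] τ 0 ≠ some false) : 0 ≤ gain f A x := by
  have : A ∪ {x} = insert x A := by rw [Finset.union_comm]; rfl
  simp only [mark, gain, List.take_succ_cons, List.take_zero, List.toFinset_cons,
    List.toFinset_nil, insert_empty_eq, this, Finset.union_empty] at h ⊢
  split_ifs at h <;> simp_all
  linarith

/-- The list consists of distinct elements outside `A`, each with its correct mark. -/
inductive Marked (f : Finset U → ℝ) (τ : ℝ) : Finset U → List (U × Option Bool) → Prop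
  | nil (A : Finset U) : Marked f τ A []
  | cons {A : Finset U} {x : U} {l : List (U × Option Bool)} (hx : x ∉ A)
      (h : Marked f τ (insert x A) l) : Marked f τ A ((x, mark f A [x] τ 0) :: l)

theorem marked_zip_marks {τ : ℝ} : ∀ (w : List U) (A : Finset U) (s p : ℕ), w.Nodup →
    (∀ x ∈ w, x ∉ A) → s ≤ w.length → Marked f τ A ((w.zip (marks f A w τ s)).take p)
  | [], A, s, p, _, _, _ => by simpa using Marked.nil A
  | x :: w, A, 0, p, _, _, _ => by simpa [marks] using Marked.nil A
  | x :: w, A, s + 1, 0, _, _, _ => by simpa using Marked.nil A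
  | x :: w, A, s + 1, p + 1, hw, hA, hs => by
      rw [marks_cons, List.zip_cons_cons, List.take_succ_cons]
      rw [List.nodup_cons] at hw
      refine Marked.cons (hA x (by simp)) (marked_zip_marks w _ s p hw.2 ?_ (by simpa using hs))
      intro y hy
      rw [Finset.mem_insert, not_or]
      exact ⟨fun h => hw.1 (h ▸ hy), hA y (by simp [hy])⟩

theorem Marked.notMem {τ : ℝ} {A : Finset U} {l : List (U × Option Bool)} (h : Marked f τ A l) :
    ∀ y ∈ l, y.1 ∉ A := by
  induction h with
  | nil => simp
  | cons hx _ ih =>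
      intro y hy
      rcases List.mem_cons.1 hy with rfl | hy
      · exact hx
      · exact fun h => ih y hy (Finset.mem_insert_of_mem h)

theorem Marked.nodup {τ : ℝ} {A : Finset U} {l : List (U × Option Bool)} (h : Marked f τ A l) :
    (l.map Prod.fst).Nodup := by
  induction h with
  | nil => simp
  | @cons A x l hx h ih =>
      rw [List.map_cons, List.nodup_cons]
      refine ⟨fun hx' => ?_, ih⟩
      obtain ⟨y, hy, hyx⟩ := List.mem_map.1 hx'
      exact h.notMem y hy (by rw [hyx]; simp)

/-- Adding marked elements, none of them marked false, to a smaller set `X`. -/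
theorem Marked.add_count_le (hf : IsSubmodular f) {τ : ℝ} (hτ : 0 ≤ τ)
    (q : U × Option Bool → Bool) (hq : ∀ y, q y = true → y.2 ≠ some false) {A : Finset U}
    {l : List (U × Option Bool)} (h : Marked f τ A l) : ∀ X ⊆ A,
      f X + τ * ((l.filter q).countP fun y => y.2 = some true) ≤
        f (X ∪ ((l.filter q).map Prod.fst).toFinset) := by
  induction h with
  | nil => simp
  | @cons A x l hx h ih =>
      intro X hX
      rw [List.filter_cons]
      split_ifs with hqx
      · have h1 := ih (insert x X) (Finset.insert_subset_insert x hX)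
        have h2 := hf.gain_anti hX hx
        have h3 : X ∪ (((x, mark f A [x] τ 0) :: l.filter q).map Prod.fst).toFinset =
            insert x X ∪ ((l.filter q).map Prod.fst).toFinset := by
          ext y
          simp only [List.map_cons, List.toFinset_cons, Finset.mem_union, Finset.mem_insert]
          tauto
        rw [h3, List.countP_cons]
        have h4 := mark_singleton_ne_false hτ (hq _ hqx)
        have h5 := mark_singleton_eq_true (f := f) A x τ
        simp only [gain] at h2 h4 h5
        split_ifs with h6
        · have := h5.1 (by simpa using h6)
          push_cast
          linarith
        · simp only [add_zero]
          linarith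
      · exact ih X (hX.trans (Finset.subset_insert x A))

/-- Elements marked false do not help, provided that each of them is added after all of its
predecessors. -/
theorem Marked.union_sub_le (hf : IsSubmodular f) {τ : ℝ} (q : U × Option Bool → Bool)
    {A : Finset U} {l : List (U × Option Bool)} (h : Marked f τ A l) :
    ∀ X Y, X ⊆ Y → Y ⊆ A → (Y = A ∨ ∀ y ∈ l, q y = true → y.2 ≠ some false) →
      (∀ l₁ y l₂, l = l₁ ++ y :: l₂ → q y = true → y.2 = some false → ∀ z ∈ l₁, q z = true) →
      f (Y ∪ ((l.filter q).map Prod.fst).toFinset) - f Y ≤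
        f (X ∪ ((l.filter fun y => q y && decide (y.2 ≠ some false)).map Prod.fst).toFinset) -
          f X := by
  induction h with
  | nil => simp
  | @cons A x l hx h ih =>
      intro X Y hXY hYA hor hcl
      have hcl' : ∀ l₁ y l₂, l = l₁ ++ y :: l₂ → q y = true → y.2 = some false →
          ∀ z ∈ l₁, q z = true := fun l₁ y l₂ hl hy hy' z hz =>
        hcl (_ :: l₁) y l₂ (by rw [hl]; rfl) hy hy' z (List.mem_cons_of_mem _ hz)
      have hins : ∀ (Z : Finset U) (b : Option Bool) (l' : List (U × Option Bool)),
          Z ∪ (((x, b) :: l').map Prod.fst).toFinset = insert x Z ∪ (l'.map Prod.fst).toFinset := by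
        intro Z b l'
        ext y
        simp only [List.map_cons, List.toFinset_cons, Finset.mem_union, Finset.mem_insert]
        tauto
      rw [List.filter_cons, List.filter_cons]
      by_cases hqx : q (x, mark f A [x] τ 0) = true
      · by_cases hm : mark f A [x] τ 0 = some false
        · have hYA' : Y = A := hor.resolve_right fun h' => h' _ (by simp) hqx hm
          subst hYA'
          rw [if_pos hqx, if_neg (by simp [hm]), hins]
          have h1 := ih X (insert x Y) (hXY.trans (Finset.subset_insert x Y)) le_rfl (Or.inl rfl)
            hcl'
          have h2 := mark_singleton_eq_false hm
          simp only [gain] at h2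
          linarith
        · rw [if_pos hqx, if_pos (by simp [hqx, hm]), hins, hins]
          have h1 := ih (insert x X) (insert x Y) (Finset.insert_subset_insert x hXY)
            (Finset.insert_subset_insert x hYA)
            (hor.imp (fun h' => by rw [h']) fun h' y hy => h' y (by simp [hy])) hcl'
          have h2 := hf hXY x fun hx' => hx (hYA hx')
          linarith
      · rw [if_neg hqx, if_neg (by simp [hqx])]
        -- Once an element has been skipped, no later false element can be selected; this switches
        -- to the second alternative of `hor`.
        refine ih X Y hXY (hYA.trans (Finset.subset_insert x A)) (Or.inr ?_) hcl'
        intro y hy hqy hyf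
        obtain ⟨l₁, l₂, hl⟩ := List.append_of_mem hy
        exact hqx (hcl (_ :: l₁) y l₂ (by rw [hl]; rfl) hqy hyf _ (by simp))

end

/-! ### The three passes -/

section

open PIG

variable {U : Type u}

/-- The marked elements in the order of the three passes. -/
def passes (l : List (U × Option Bool)) : List (U × Option Bool) :=
  l.filter (fun y => y.2 = some true) ++ l.filter (fun y => y.2 = none) ++
    l.filter (fun y => y.2 = some false)

theorem passes_perm (l : List (U × Option Bool)) : (passes l).Perm l := by
  induction l with
  | nil => simp [passes]
  | cons y l ih =>
      obtain ⟨x, b⟩ := y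
      rcases b with _ | _ | _
      · simp only [passes, List.filter_cons] at ih ⊢
        simp only [reduceCtorEq, decide_false, decide_true, if_true, Bool.false_eq_true, if_false]
        refine List.Perm.trans ?_ (List.Perm.cons _ ih)
        rw [List.append_assoc, List.append_assoc]
        exact List.perm_middle
      · simp only [passes, List.filter_cons] at ih ⊢
        simp only [reduceCtorEq, decide_false, decide_true, if_true, Bool.false_eq_true, if_false,
          Option.some.injEq]
        exact List.perm_middle.trans (List.Perm.cons _ ih)
      · simp only [passes, List.filter_cons] at ih ⊢
        simp only [reduceCtorEq, decide_false, decide_true, if_true, Bool.false_eq_true, if_false,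
          Option.some.injEq, Bool.true_eq_false]
        exact List.Perm.cons _ ih

/-- The marks are meaningful only in the original order. This allows the elements chosen by the
three passes to be added in that order. -/
theorem filter_mem_take_passes_perm [DecidableEq U] {l : List (U × Option Bool)} (hl : l.Nodup) (i : ℕ) :
    (l.filter fun y => y ∈ (passes l).take i).Perm ((passes l).take i) := by
  have hp := passes_perm l
  rw [List.perm_ext_iff_of_nodup (hl.filter _) ((hp.nodup_iff.2 hl).sublist (List.take_sublist _ _))]
  intro y
  rw [List.mem_filter]
  simp only [decide_eq_true_eq, and_iff_right_iff_imp]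
  exact fun h => hp.subset (List.mem_of_mem_take h)

/-- True marks come first, so the first i entries contain min(i, T) of them, T being their total
number. Both i and T are at least θ i. -/
theorem le_countP_take_passes {l : List (U × Option Bool)} {θ : ℝ} (hθ : θ ≤ 1) (h0 : 0 ≤ θ)
    (h : θ * l.length ≤ (l.countP fun y => y.2 = some true : ℕ)) {i : ℕ} (hi : i ≤ l.length) :
    θ * i ≤ (((passes l).take i).countP fun y => y.2 = some true : ℕ) := by
  have hi' : (i : ℝ) ≤ l.length := by exact_mod_cast hi
  rw [passes, List.append_assoc, List.take_append, List.countP_append]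
  set T := l.filter fun y => y.2 = some true with hT
  have hTl : T.length = l.countP fun y => y.2 = some true := by
    rw [hT, List.countP_eq_length_filter]
  have hall : (T.take i).countP (fun y => y.2 = some true) = (T.take i).length := by
    rw [List.countP_eq_length]
    intro y hy
    exact (List.mem_filter.1 (List.mem_of_mem_take hy)).2
  rw [hall, List.length_take, hTl]
  have : θ * i ≤ (min i (l.countP fun y => y.2 = some true) : ℕ) := by
    rw [Nat.cast_min]
    refine le_min ?_ (le_trans (by gcongr) h)
    have : (0 : ℝ) ≤ i := Nat.cast_nonneg i
    nlinarith
  push_cast at this ⊢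
  have h3 : (0 : ℝ) ≤ ((List.take (i - l.countP fun y => decide (y.2 = some true))
    (l.filter (fun y => decide (y.2 = none)) ++ l.filter fun y => decide (y.2 = some false))).countP
      fun y => decide (y.2 = some true) : ℕ) := Nat.cast_nonneg _
  linarith

/-- When a false entry makes it into the first i, both earlier passes have been exhausted, and
within the last pass the original order is kept. -/
theorem mem_take_passes_of_false {l l₁ l₂ : List (U × Option Bool)} (hl : l.Nodup)
    {y : U × Option Bool} (hly : l = l₁ ++ y :: l₂) {i : ℕ} (hy : y ∈ (passes l).take i)
    (hyf : y.2 = some false) : ∀ z ∈ l₁, z ∈ (passes l).take i := by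
  intro z hz
  set M := l.filter (fun y => y.2 = some true) ++ l.filter (fun y => y.2 = none) with hM
  set Fs := l.filter (fun y => y.2 = some false) with hFs
  have hpass : passes l = M ++ Fs := rfl
  rw [hpass, List.take_append, List.mem_append] at hy ⊢
  have hyM : y ∉ M := by
    intro h
    rcases List.mem_append.1 h with h | h <;> simp [List.mem_filter, hyf] at h
  have hy' := hy.resolve_left fun h => hyM (List.mem_of_mem_take h)
  have hlt : M.length < i := by
    by_contra h
    rw [Nat.sub_eq_zero_of_le (not_lt.1 h)] at hy'
    simp at hy'
  by_cases hzf : z.2 = some false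
  · right
    set m := i - M.length
    have hF : Fs = l₁.filter (fun y => y.2 = some false) ++
        y :: l₂.filter (fun y => y.2 = some false) := by
      rw [hFs, hly, List.filter_append, List.filter_cons, if_pos (by simpa using hyf)]
    have hFn : Fs.Nodup := hl.filter _
    rw [hF] at hFn hy' ⊢
    have hlen : (l₁.filter fun y => y.2 = some false).length < m := by
      by_contra h
      rw [List.take_append_of_le_length (not_lt.1 h)] at hy'
      exact (List.nodup_append.1 hFn).2.2 y (List.mem_of_mem_take hy') y (by simp) rfl
    rw [List.take_append, List.take_of_length_le hlen.le]
    exact List.mem_append_left _ (List.mem_filter.2 ⟨hz, by simpa using hzf⟩)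
  · left
    rw [List.take_of_length_le hlt.le]
    have hzl : z ∈ l := by rw [hly]; simp [hz]
    rw [hM, List.mem_append, List.mem_filter, List.mem_filter]
    rcases h : z.2 with _ | _ | _
    · exact Or.inr ⟨hzl, by simp⟩
    · exact absurd h hzf
    · exact Or.inl ⟨hzl, by simp⟩

end

/-! ### The elements that a block adds to one solution -/

section

open PIG

variable {U : Type u} [DecidableEq U]

/-- The elements, with their marks, that are added to the solution `A` when the random order is
`w`, the first `s` elements are examined and `i` elements are added. -/
noncomputable def selection (f : Finset U → ℝ) (ε : ℝ) (A : Finset U) (w : List U) (τ : ℝ)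
    (s i : ℕ) : List (U × Option Bool) :=
  (threePasses w (marks f A w τ s) (goodPrefix ε (marks f A w τ s))).take i

theorem length_marks (f : Finset U → ℝ) (A : Finset U) (w : List U) (τ : ℝ) (s : ℕ) :
    (marks f A w τ s).length = s := by
  simp [marks]

theorem goodPrefix_le (f : Finset U → ℝ) (ε : ℝ) (A : Finset U) (w : List U) (τ : ℝ) (s : ℕ) :
    goodPrefix ε (marks f A w τ s) ≤ s :=
  (Nat.findGreatest_le _).trans (length_marks f A w τ s).le

theorem le_goodPrefix {ε : ℝ} {B : List (Option Bool)} {i : ℕ} (hi : i ≤ B.length)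
    (h : (1 - ε) * i ≤ ((B.take i).count (some true) : ℝ)) : i ≤ goodPrefix ε B :=
  Nat.le_findGreatest hi h

theorem goodPrefix_spec (ε : ℝ) (B : List (Option Bool)) :
    (1 - ε) * goodPrefix ε B ≤ ((B.take (goodPrefix ε B)).count (some true) : ℝ) := by
  classical
  have := Nat.findGreatest_spec (P := fun i : ℕ => (1 - ε) * (i : ℝ) ≤
    ((B.take i).count (some true) : ℝ)) (Nat.zero_le B.length) (by simp)
  unfold goodPrefix
  convert this

variable {f : Finset U → ℝ} {ε τ : ℝ} {A : Finset U} {w : List U} {s : ℕ}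

/-- The first element is tested against A itself, so a genuine candidate is marked true. This is why
every block makes progress. -/
theorem one_le_goodPrefix (hε : 0 < ε) {x : U} (hx : τ ≤ gain f A x) :
    1 ≤ goodPrefix ε (marks f A (x :: w) τ (s + 1)) := by
  refine le_goodPrefix (by simp [length_marks]) ?_
  rw [marks_cons, (mark_singleton_eq_true A x τ).2 hx]
  simp [hε.le]

/-- The good prefix together with its marks. -/
theorem length_zip_take (hs : s ≤ w.length) {p : ℕ} (hp : p ≤ s) :
    ((w.zip (marks f A w τ s)).take p).length = p := by
  simp [length_marks]
  omega

theorem map_fst_zip_take {p : ℕ} (hp : p ≤ s) :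
    ((w.zip (marks f A w τ s)).take p).map Prod.fst = w.take p := by
  rw [List.zip, List.take_zipWith, ← List.zip, List.map_fst_zip]
  simp [length_marks]
  omega

theorem map_snd_zip_take (hs : s ≤ w.length) {p : ℕ} :
    ((w.zip (marks f A w τ s)).take p).map Prod.snd = (marks f A w τ s).take p := by
  rw [List.map_take, List.map_snd_zip (by simpa [length_marks] using hs)]

theorem countP_zip_take (hs : s ≤ w.length) {p : ℕ} :
    ((w.zip (marks f A w τ s)).take p).countP (fun y => y.2 = some true) =
      ((marks f A w τ s).take p).count (some true) := by
  rw [← map_snd_zip_take hs, List.count, List.countP_map]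
  refine List.countP_congr fun y _ => ?_
  simp

theorem selection_eq (f : Finset U → ℝ) (ε : ℝ) (A : Finset U) (w : List U) (τ : ℝ) (s i : ℕ) :
    selection f ε A w τ s i =
      (passes ((w.zip (marks f A w τ s)).take (goodPrefix ε (marks f A w τ s)))).take i :=
  rfl

theorem selection_map_fst_subset (i : ℕ) :
    ((selection f ε A w τ s i).map Prod.fst).toFinset ⊆
      (w.take (goodPrefix ε (marks f A w τ s))).toFinset := by
  intro x hx
  rw [List.mem_toFinset] at hx ⊢
  rw [← map_fst_zip_take (goodPrefix_le f ε A w τ s)]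
  obtain ⟨y, hy, rfl⟩ := List.mem_map.1 hx
  exact List.mem_map_of_mem ((passes_perm _).subset (List.mem_of_mem_take hy))

theorem selection_false_subset (i : ℕ) :
    (((selection f ε A w τ s i).filter fun y => y.2 ≠ some false).map Prod.fst).toFinset ⊆
      ((selection f ε A w τ s i).map Prod.fst).toFinset := by
  intro x hx
  rw [List.mem_toFinset] at hx ⊢
  obtain ⟨y, hy, rfl⟩ := List.mem_map.1 hx
  exact List.mem_map_of_mem (List.mem_of_mem_filter hy)

theorem le_countP_selection (hs : s ≤ w.length) (hε : 0 < ε) (hε1 : ε < 1) {i : ℕ}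
    (hi : i ≤ goodPrefix ε (marks f A w τ s)) :
    (1 - ε) * i ≤ ((selection f ε A w τ s i).countP fun y => y.2 = some true : ℕ) := by
  have hlen := length_zip_take (f := f) (A := A) (τ := τ) hs (goodPrefix_le f ε A w τ s)
  refine le_countP_take_passes (by linarith) (by linarith) ?_ (by rwa [hlen])
  rw [hlen, countP_zip_take hs]
  exact goodPrefix_spec ε _

variable (hw : w.Nodup) (hwA : ∀ x ∈ w, x ∉ A) (hs : s ≤ w.length)

include hw hwA hs

theorem card_selection {i : ℕ} (hi : i ≤ goodPrefix ε (marks f A w τ s)) :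
    ((selection f ε A w τ s i).map Prod.fst).toFinset.card = i := by
  have hm := marked_zip_marks (f := f) (τ := τ) w A s (goodPrefix ε (marks f A w τ s)) hw hwA hs
  have hn : ((selection f ε A w τ s i).map Prod.fst).Nodup :=
    (((passes_perm _).map Prod.fst).nodup_iff.2 hm.nodup).sublist
      ((List.take_sublist _ _).map _)
  rw [List.toFinset_card_of_nodup hn, List.length_map, selection_eq, List.length_take,
    (passes_perm _).length_eq, length_zip_take hs (goodPrefix_le f ε A w τ s), min_eq_left hi]

/-- Reordering is invisible when the whole good prefix is taken. This applies to the index at which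
the minimum i* is attained. -/
theorem selection_eq_prefix :
    ((selection f ε A w τ s (goodPrefix ε (marks f A w τ s))).map Prod.fst).toFinset =
      (w.take (goodPrefix ε (marks f A w τ s))).toFinset := by
  refine Finset.eq_of_subset_of_card_le (selection_map_fst_subset _) ?_
  rw [card_selection hw hwA hs le_rfl]
  exact (List.toFinset_card_le _).trans (by simp)

theorem filter_mem_selection (i : ℕ) :
    ((((w.zip (marks f A w τ s)).take (goodPrefix ε (marks f A w τ s))).filter fun y =>
      y ∈ selection f ε A w τ s i)).Perm (selection f ε A w τ s i) :=
  filter_mem_take_passes_perm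
    ((marked_zip_marks (f := f) (τ := τ) w A s _ hw hwA hs).nodup.of_map Prod.fst) i

theorem filter_mem_selection_false (i : ℕ) :
    (((w.zip (marks f A w τ s)).take (goodPrefix ε (marks f A w τ s))).filter fun y =>
      decide (y ∈ selection f ε A w τ s i) && decide (y.2 ≠ some false)).Perm
        ((selection f ε A w τ s i).filter fun y => y.2 ≠ some false) := by
  have := (filter_mem_selection (f := f) (ε := ε) (τ := τ) hw hwA hs i).filter
    fun y => decide (y.2 ≠ some false)
  rw [List.filter_filter] at this
  refine List.Perm.trans (List.Perm.of_eq ?_) this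
  refine List.filter_congr fun y _ => ?_
  rw [Bool.and_comm]

/-- Passing from A to A' and discarding the false elements never hurts; this propagates f (A j) ≤ f
(A' j). -/
theorem selection_sub_le (hf : IsSubmodular f) (i : ℕ) {A' : Finset U} (hA : A' ⊆ A) :
    f (A ∪ ((selection f ε A w τ s i).map Prod.fst).toFinset) - f A ≤
      f (A' ∪ (((selection f ε A w τ s i).filter fun y => y.2 ≠ some false).map
        Prod.fst).toFinset) - f A' := by
  have hm := marked_zip_marks (f := f) (τ := τ) w A s (goodPrefix ε (marks f A w τ s)) hw hwA hs
  have h := hm.union_sub_le hf (fun y => y ∈ selection f ε A w τ s i) A' A hA le_rfl (Or.inl rfl)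
    (fun l₁ y l₂ hl hy hyf z hz => by
      simp only [decide_eq_true_eq] at hy ⊢
      exact mem_take_passes_of_false (hm.nodup.of_map Prod.fst) hl hy hyf z hz)
  rwa [List.toFinset_eq_of_perm _ _ ((filter_mem_selection hw hwA hs i).map Prod.fst),
    List.toFinset_eq_of_perm _ _ ((filter_mem_selection_false hw hwA hs i).map Prod.fst)] at h

theorem countP_filter_selection (i : ℕ) :
    (((w.zip (marks f A w τ s)).take (goodPrefix ε (marks f A w τ s))).filter fun y =>
      decide (y ∈ selection f ε A w τ s i) && decide (y.2 ≠ some false)).countP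
        (fun y => y.2 = some true) =
      (selection f ε A w τ s i).countP fun y => y.2 = some true := by
  rw [(filter_mem_selection_false hw hwA hs i).countP_eq, List.countP_filter]
  refine List.countP_congr fun y _ => ?_
  simp only [ne_eq, decide_not, Bool.and_eq_true, decide_eq_true_eq, Bool.not_eq_eq_eq_not,
    Bool.not_true, decide_eq_false_iff_not]
  constructor
  · exact fun h => h.1
  · exact fun h => ⟨h, by simp [h]⟩

/-- The true elements, a fraction 1 - ε, each earn τ even over the smaller base X, and the unmarked
ones earn at least 0. -/
theorem add_le_selection (hf : IsSubmodular f) (hτ : 0 ≤ τ) (hε : 0 < ε) (hε1 : ε < 1) {i : ℕ}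
    (hi : i ≤ goodPrefix ε (marks f A w τ s)) {X : Finset U} (hX : X ⊆ A) :
    f X + (1 - ε) * i * τ ≤
      f (X ∪ (((selection f ε A w τ s i).filter fun y => y.2 ≠ some false).map
        Prod.fst).toFinset) := by
  have hm := marked_zip_marks (f := f) (τ := τ) w A s (goodPrefix ε (marks f A w τ s)) hw hwA hs
  have h := hm.add_count_le hf hτ (fun y => decide (y ∈ selection f ε A w τ s i) &&
    decide (y.2 ≠ some false)) (fun y hy => by simp at hy; exact hy.2) X hX
  rw [List.toFinset_eq_of_perm _ _ ((filter_mem_selection_false hw hwA hs i).map Prod.fst),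
    countP_filter_selection hw hwA hs] at h
  have := mul_le_mul_of_nonneg_left (le_countP_selection (f := f) (A := A) (τ := τ) hs hε hε1 hi) hτ
  linarith

omit hw hwA hs

theorem mem_selection_head {x : U} (hx : τ ≤ gain f A x)
    (hp : 1 ≤ goodPrefix ε (marks f A (x :: w) τ s)) {i : ℕ} (hi : 1 ≤ i) :
    (x, some true) ∈ selection f ε A (x :: w) τ s i := by
  obtain ⟨i, rfl⟩ := Nat.exists_eq_add_of_le' hi
  obtain ⟨p, hp'⟩ := Nat.exists_eq_add_of_le' hp
  obtain ⟨s, rfl⟩ := Nat.exists_eq_add_of_le' (hp.trans (goodPrefix_le f ε A (x :: w) τ s))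
  rw [selection_eq, hp', marks_cons, (mark_singleton_eq_true A x τ).2 hx, List.zip_cons_cons,
    List.take_succ_cons, passes, List.filter_cons, if_pos (by simp)]
  simp

/-- The head x of the order is itself marked true and selected, so it can be added first without a
price being put on it; it is one of the (1 - ε) i true elements, which leaves (1 - ε) i - 1 for the
rest. -/
theorem insert_add_le_selection (hf : IsSubmodular f) (hτ : 0 ≤ τ) (hε : 0 < ε) (hε1 : ε < 1)
    {x : U} (hw : (x :: w).Nodup) (hwA : ∀ y ∈ x :: w, y ∉ A) (hs : s ≤ (x :: w).length) {i : ℕ}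
    (hi : i ≤ goodPrefix ε (marks f A (x :: w) τ s)) (hi1 : 1 ≤ i) (hx : τ ≤ gain f A x)
    {X : Finset U} (hX : X ⊆ A) :
    f (insert x X) + ((1 - ε) * i - 1) * τ ≤
      f (X ∪ (((selection f ε A (x :: w) τ s i).filter fun y => y.2 ≠ some false).map
        Prod.fst).toFinset) := by
  have hhead := mem_selection_head hx (hi1.trans hi) hi1
  have hm := marked_zip_marks (f := f) (τ := τ) (x :: w) A s
    (goodPrefix ε (marks f A (x :: w) τ s)) hw hwA hs
  have hperm := filter_mem_selection_false (f := f) (ε := ε) (τ := τ) hw hwA hs i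
  have hcount := countP_filter_selection (f := f) (ε := ε) (τ := τ) hw hwA hs i
  have hle := le_countP_selection (f := f) (A := A) (τ := τ) hs hε hε1 hi
  rw [← List.toFinset_eq_of_perm _ _ (hperm.map Prod.fst)]
  rw [← hcount] at hle
  clear hperm hcount
  set q : U × Option Bool → Bool := fun y => decide (y ∈ selection f ε A (x :: w) τ s i) &&
    decide (y.2 ≠ some false) with hq
  have hqh : q (x, some true) = true := by simp [hq, hhead]
  have hqf : ∀ y, q y = true → y.2 ≠ some false := fun y hy => by simp [hq] at hy; exact hy.2
  clear_value q
  obtain ⟨p, hp'⟩ := Nat.exists_eq_add_of_le' (hi1.trans hi)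
  obtain ⟨s, rfl⟩ := Nat.exists_eq_add_of_le'
    ((hi1.trans hi).trans (goodPrefix_le f ε A (x :: w) τ s))
  have htrue := (mark_singleton_eq_true (f := f) A x τ).2 hx
  rw [hp', marks_cons, List.zip_cons_cons, List.take_succ_cons] at hm hle ⊢
  rw [htrue, List.filter_cons, if_pos hqh] at hle ⊢
  cases hm with
  | cons _ hm' =>
    have h := hm'.add_count_le hf hτ q hqf (insert x X) (Finset.insert_subset_insert x hX)
    have hset : ∀ l : List (U × Option Bool), X ∪ (((x, some true) :: l).map Prod.fst).toFinset =
        insert x X ∪ (l.map Prod.fst).toFinset := by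
      intro l
      ext y
      simp only [List.map_cons, List.toFinset_cons, Finset.mem_union, Finset.mem_insert]
      tauto
    rw [hset]
    rw [List.countP_cons_of_pos (by simp)] at hle
    push_cast at hle
    have := mul_le_mul_of_nonneg_left hle hτ
    linarith

end

/-! ### Potential of a state -/

section

/-- A bound for the number of times that a threshold can be lowered. -/
noncomputable def levels (ε τmin τ : ℝ) : ℕ :=
  ⌈Real.log (τ / τmin) / ε⌉₊ + 1

/-- A bound for the number of times that a set of `n` candidates can lose a fraction `ε / 64` of
its elements. -/
noncomputable def logSize (ε : ℝ) (n : ℕ) : ℕ :=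
  if n = 0 then 0 else ⌈64 * Real.log n / ε⌉₊ + 1

/-- log (1 - ε) ≤ -ε, so each reduction lowers the quotient by at least 1. The threshold is still at
least τmin afterwards, which keeps the logarithm nonnegative and lets the ceiling commute with
adding 1. -/
theorem levels_succ_le {ε τmin τ : ℝ} (hε : 0 < ε) (hε1 : ε < 1) (hτ : 0 < τmin)
    (h : τmin ≤ (1 - ε) * τ) : levels ε τmin ((1 - ε) * τ) + 1 ≤ levels ε τmin τ := by
  unfold levels
  have h1 : 0 < 1 - ε := by linarith
  have hτ0 : 0 < τ := by
    by_contra h'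
    nlinarith
  have h2 : Real.log ((1 - ε) * τ / τmin) = Real.log (1 - ε) + Real.log (τ / τmin) := by
    rw [mul_div_assoc, Real.log_mul h1.ne' (div_pos hτ0 hτ).ne']
  have h3 : Real.log (1 - ε) ≤ -ε := by
    have := Real.log_le_sub_one_of_pos h1
    linarith
  have h4 : Real.log ((1 - ε) * τ / τmin) / ε + 1 ≤ Real.log (τ / τmin) / ε := by
    rw [h2, div_add_one hε.ne']
    gcongr
    linarith
  have h5 : 0 ≤ Real.log ((1 - ε) * τ / τmin) / ε :=
    div_nonneg (Real.log_nonneg ((one_le_div hτ).2 h)) hε.le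
  have := Nat.ceil_mono h4
  rw [Nat.ceil_add_one h5] at this
  omega

theorem logSize_mono {ε : ℝ} (hε : 0 < ε) {m n : ℕ} (h : m ≤ n) : logSize ε m ≤ logSize ε n := by
  unfold logSize
  split_ifs with h1 h2 h2
  · exact le_rfl
  · exact Nat.zero_le _
  · omega
  · have : (0 : ℝ) < m := by exact_mod_cast Nat.pos_of_ne_zero h1
    gcongr

/-- Again log (1 - ε/64) ≤ -ε/64. The summand 1 in `logSize`, absent for the empty set, pays for the
loss of the last candidates. -/
theorem logSize_succ_le {ε : ℝ} (hε : 0 < ε) (hε1 : ε < 1) {m n : ℕ} (hn : n ≠ 0)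
    (h : (m : ℝ) ≤ (1 - ε / 64) * n) : logSize ε m + 1 ≤ logSize ε n := by
  unfold logSize
  rw [if_neg hn]
  split_ifs with h1
  · omega
  · have hm : (0 : ℝ) < m := by exact_mod_cast Nat.pos_of_ne_zero h1
    have hn' : (0 : ℝ) < n := by exact_mod_cast Nat.pos_of_ne_zero hn
    have h0 : 0 < 1 - ε / 64 := by linarith
    have h2 := Real.log_le_log hm h
    rw [Real.log_mul h0.ne' hn'.ne'] at h2
    have h3 := Real.log_le_sub_one_of_pos h0
    have h4 : 64 * Real.log m / ε + 1 ≤ 64 * Real.log n / ε := by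
      rw [div_add_one hε.ne']
      gcongr
      linarith
    have h5 : 0 ≤ 64 * Real.log m / ε := by
      have : 0 ≤ Real.log m := Real.log_natCast_nonneg m
      positivity
    have := Nat.ceil_mono h4
    rw [Nat.ceil_add_one h5] at this
    omega

end

/-! ### Candidates and the potential of a state -/

namespace PIG

theorem gain_answers {U : Type u} [DecidableEq U] {ℓ : ℕ} {f : Finset U → ℝ}
    {E : Finset (Fin ℓ)} {A W : Fin ℓ → Finset U} {j : Fin ℓ}
    (hj : j ∈ E) {x : U} (hx : x ∈ W j) :
    gain (fun S => if S ∈ ∑ j ∈ E, gainBatch (A j) (W j) then f S else 0) (A j) x =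
      gain f (A j) x := by
  have h1 : A j ∈ ∑ j ∈ E, gainBatch (A j) (W j) :=
    Multiset.mem_sum.2 ⟨j, hj, by simp [gainBatch]⟩
  have h2 : insert x (A j) ∈ ∑ j ∈ E, gainBatch (A j) (W j) :=
    Multiset.mem_sum.2 ⟨j, hj, by
      rw [gainBatch, Multiset.mem_cons, Multiset.mem_map]
      exact Or.inr ⟨x, hx, rfl⟩⟩
  simp only [gain, if_pos h1, if_pos h2]

section

variable {U : Type u} [Fintype U] [DecidableEq U] {ℓ : ℕ}

/-- The elements outside the solutions whose gain is at least the threshold of `j`. -/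
noncomputable def State.cand (f : Finset U → ℝ) (s : State U ℓ) (j : Fin ℓ) : Finset U :=
  s.rest.filter fun x => s.τ j ≤ gain f (s.A j) x

/-- The contribution of an index to the potential. -/
noncomputable def State.indexPot (f : Finset U → ℝ) (ε τmin : ℝ) (s : State U ℓ) (j : Fin ℓ) : ℕ :=
  if τmin ≤ s.τ j then
    (logSize ε (Fintype.card U) + 3) * levels ε τmin (s.τ j) + logSize ε (s.cand f j).card
  else 0

/-- The potential that bounds the number of rounds. -/
noncomputable def State.pot (f : Finset U → ℝ) (ε τmin : ℝ) (s : State U ℓ) : ℕ :=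
  ∑ j, s.indexPot f ε τmin j + Nat.size s.m₀

theorem mem_cand {f : Finset U → ℝ} {s : State U ℓ} {j : Fin ℓ} {x : U} :
    x ∈ s.cand f j ↔ x ∈ s.rest ∧ s.τ j ≤ gain f (s.A j) x := by
  simp [State.cand]

theorem mem_rest {s : State U ℓ} {x : U} : x ∈ s.rest ↔ ∀ j, x ∉ s.A j := by
  simp [State.rest]

/-- A level is worth `logSize` of the whole ground set plus 3: the first part pays for refilling the
candidate set, and 3 is left over. Of these, one pays for the round of the reduction, one for the
filtering round of `Update`, and one is a net decrease (see `refresh_sat`). -/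
theorem indexPot_lower {f : Finset U → ℝ} {ε τmin : ℝ} (hε : 0 < ε) (hε1 : ε < 1)
    (hτ : 0 < τmin) {s s' : State U ℓ} {j : Fin ℓ} (h : τmin ≤ s.τ j)
    (h' : s'.τ j = (1 - ε) * s.τ j) :
    s'.indexPot f ε τmin j + 3 ≤ s.indexPot f ε τmin j := by
  unfold State.indexPot
  rw [if_pos h]
  split_ifs with h1
  · rw [h'] at h1 ⊢
    have h2 := levels_succ_le hε hε1 hτ h1
    have h3 := logSize_mono hε (Finset.card_le_univ (s'.cand f j))
    have h4 := Nat.mul_le_mul_left (logSize ε (Fintype.card U) + 3) h2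
    rw [mul_add, mul_one] at h4
    omega
  · have : 1 ≤ levels ε τmin (s.τ j) := by simp [levels]
    nlinarith

/-! ### `Update` -/

/-- The effect of `Update` on the indices in `J`. -/
structure Updated (f : Finset U → ℝ) (ε τmin : ℝ) (J : Finset (Fin ℓ)) (s s' : State U ℓ) :
    Prop where
  I_eq : s'.I = s.I
  m_eq : s'.m₀ = s.m₀
  A_eq : s'.A = s.A
  A'_eq : s'.A' = s.A'
  off_V : ∀ j ∉ J, s'.V j = s.V j
  off_τ : ∀ j ∉ J, s'.τ j = s.τ j
  τ_le : ∀ j, s'.τ j ≤ s.τ j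
  V_eq : ∀ j ∈ J, s'.V j = s'.cand f j
  done : ∀ j ∈ J, s'.V j ≠ ∅ ∨ s'.τ j < τmin
  bound : ∀ j, ∀ x ∈ s.rest, gain f (s.A j) x ≤ (1 - ε)⁻¹ * max (s.τ j) τmin →
    gain f (s.A j) x ≤ (1 - ε)⁻¹ * max (s'.τ j) τmin

variable {f : Finset U → ℝ} {ε τmin : ℝ} {c : Prop}

/-- Every iteration lowers the threshold of each index in E, so each round is paid for by 3 units of
potential. With `c` true this gives partial correctness for any N, and even τmin = 0; with `c` false
it shows that N iterations suffice. -/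
theorem updateLoop_sat (hε : 0 < ε) (hε1 : ε < 1) (hτ : 0 ≤ τmin) (J : Finset (Fin ℓ)) :
    ∀ (N : ℕ) (s : State U ℓ) (r : ℕ), (∀ j ∈ J, s.V j = s.cand f j) →
      (c ∨ (0 < τmin ∧ s.pot f ε τmin < N)) →
      Prog.Sat f (fun s' r' => Updated f ε τmin J s s' ∧ r ≤ r' ∧ (r' = r → s'.τ = s.τ) ∧
        (0 < τmin → s'.pot f ε τmin + 3 * r' ≤ s.pot f ε τmin + 3 * r)) c r
        (updateLoop ε τmin J N s)
  | 0, s, r, _, hc => hc.resolve_right (by simp)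
  | N + 1, s, r, hV, hc => by
      classical
      rw [updateLoop]
      set E := J.filter fun j => s.V j = ∅ ∧ τmin ≤ s.τ j with hE
      have hmemE : ∀ j, j ∈ E ↔ j ∈ J ∧ s.V j = ∅ ∧ τmin ≤ s.τ j := fun j => by simp [hE]
      by_cases hE0 : E = ∅
      · rw [if_pos (by convert hE0)]
        refine ⟨⟨rfl, rfl, rfl, rfl, fun _ _ => rfl, fun _ _ => rfl, fun _ => le_rfl, hV, ?_,
          fun _ _ _ h => h⟩, le_rfl, fun _ => rfl, fun _ => le_rfl⟩
        intro j hj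
        by_contra h
        push Not at h
        have : j ∈ E := (hmemE j).2 ⟨hj, h⟩
        simp [hE0] at this
      · rw [if_neg (by convert hE0)]
        simp only [Prog.Sat]
        have h1ε : 0 < 1 - ε := by linarith
        set s₁ : State U ℓ := { s with
          τ := fun j => if j ∈ E then (1 - ε) * s.τ j else s.τ j
          V := fun j => if j ∈ E then s.rest.filter fun x => (1 - ε) * s.τ j ≤ gain
                (fun S => if S ∈ ∑ j ∈ E, gainBatch (s.A j) s.rest then f S else 0) (s.A j) x
              else s.V j } with hs₁
        have hrest : s₁.rest = s.rest := rfl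
        have hV₁ : ∀ j ∈ J, s₁.V j = s₁.cand f j := by
          intro j hj
          by_cases hjE : j ∈ E
          · have : s₁.τ j = (1 - ε) * s.τ j := if_pos hjE
            ext x
            rw [mem_cand, this, hrest]
            simp only [hs₁, if_pos hjE, Finset.mem_filter]
            refine and_congr_right fun hx => ?_
            rw [gain_answers (W := fun _ => s.rest) hjE hx]
          · have h1 : s₁.V j = s.V j := if_neg hjE
            have h2 : s₁.τ j = s.τ j := if_neg hjE
            rw [h1, hV j hj]
            ext x
            rw [mem_cand, mem_cand, h2, hrest]
        have hpot : 0 < τmin → s₁.pot f ε τmin + 3 ≤ s.pot f ε τmin := by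
          intro hτ0
          obtain ⟨i, hi⟩ := Finset.nonempty_iff_ne_empty.2 hE0
          have hi' : s₁.indexPot f ε τmin i + 3 ≤ s.indexPot f ε τmin i :=
            indexPot_lower hε hε1 hτ0 ((hmemE i).1 hi).2.2 (if_pos hi)
          have hle : ∀ j, s₁.indexPot f ε τmin j ≤ s.indexPot f ε τmin j := by
            intro j
            by_cases hjE : j ∈ E
            · have : s₁.indexPot f ε τmin j + 3 ≤ s.indexPot f ε τmin j :=
                indexPot_lower hε hε1 hτ0 ((hmemE j).1 hjE).2.2 (if_pos hjE)
              omega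
            · have h2 : s₁.τ j = s.τ j := if_neg hjE
              have h3 : s₁.cand f j = s.cand f j := by
                ext x
                rw [mem_cand, mem_cand, h2, hrest]
              rw [State.indexPot, State.indexPot, h2, h3]
          have := Finset.sum_le_sum fun j (_ : j ∈ Finset.univ.erase i) => hle j
          have e1 := Finset.add_sum_erase Finset.univ (s₁.indexPot f ε τmin) (Finset.mem_univ i)
          have e2 := Finset.add_sum_erase Finset.univ (s.indexPot f ε τmin) (Finset.mem_univ i)
          have e3 : s₁.m₀ = s.m₀ := rfl
          rw [State.pot, State.pot, e3]
          omega
        have ih := updateLoop_sat hε hε1 hτ J N s₁ (r + 1) hV₁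
          (hc.imp_right fun h => ⟨h.1, by have := hpot h.1; omega⟩)
        convert Prog.Sat.mono ?_ id ih using 2
        · rintro s' r' ⟨hU, hr, -, hp⟩
          refine ⟨⟨hU.I_eq, hU.m_eq, hU.A_eq, hU.A'_eq, ?_, ?_, ?_, hU.V_eq, hU.done, ?_⟩, by omega,
            fun h => by omega, fun h => ?_⟩
          · intro j hj
            rw [hU.off_V j hj]
            exact if_neg fun h => hj ((hmemE j).1 h).1
          · intro j hj
            rw [hU.off_τ j hj]
            exact if_neg fun h => hj ((hmemE j).1 h).1
          · intro j
            refine (hU.τ_le j).trans ?_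
            by_cases hjE : j ∈ E
            · have h1 : s₁.τ j = (1 - ε) * s.τ j := if_pos hjE
              have h2 := hτ.trans ((hmemE j).1 hjE).2.2
              rw [h1]
              nlinarith
            · exact (if_neg hjE : s₁.τ j = s.τ j).le
          · intro j x hx hb
            refine hU.bound j x hx ?_
            by_cases hjE : j ∈ E
            · have h1 : s₁.τ j = (1 - ε) * s.τ j := if_pos hjE
              -- The complete candidate set was empty, so x gains less than the old threshold, which
              -- is (1 - ε)⁻¹ times the new one.
              have h2 : x ∉ s.cand f j := by
                rw [← hV j ((hmemE j).1 hjE).1, ((hmemE j).1 hjE).2.1]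
                simp
              have h3 : gain f (s.A j) x < s.τ j := by
                by_contra h
                exact h2 (mem_cand.2 ⟨hx, not_lt.1 h⟩)
              have h4 : s.τ j = (1 - ε)⁻¹ * ((1 - ε) * s.τ j) := by
                rw [inv_mul_cancel_left₀ h1ε.ne']
              rw [h1]
              exact h3.le.trans (h4.le.trans
                (mul_le_mul_of_nonneg_left (le_max_left _ _) (inv_nonneg.2 h1ε.le)))
            · have h2 : s₁.τ j = s.τ j := if_neg hjE
              rwa [h2]
          · have := hpot h
            have := hp h
            omega

theorem update_sat (hε : 0 < ε) (hε1 : ε < 1) (hτ : 0 ≤ τmin) (N : ℕ) (J : Finset (Fin ℓ))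
    (s : State U ℓ) (r : ℕ) (hV : ∀ j ∈ J, s.cand f j ⊆ s.V j)
    (hc : c ∨ (0 < τmin ∧ s.pot f ε τmin < N)) :
    Prog.Sat f (fun s' r' => Updated f ε τmin J s s' ∧ r + 1 ≤ r' ∧ (r' = r + 1 → s'.τ = s.τ) ∧
      (0 < τmin → s'.pot f ε τmin + 3 * r' ≤ s.pot f ε τmin + 3 * (r + 1))) c r
      (update ε τmin N J s) := by
  classical
  rw [update]
  simp only [Prog.Sat]
  set s₁ : State U ℓ := { s with
    V := fun j => if j ∈ J then (s.V j ∩ s.rest).filter fun x => s.τ j ≤ gain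
        (fun S => if S ∈ ∑ j ∈ J, gainBatch (s.A j) (s.V j ∩ s.rest) then f S else 0) (s.A j) x
      else s.V j } with hs₁
  have hV₁ : ∀ j ∈ J, s₁.V j = s₁.cand f j := by
    intro j hj
    have hrest : s₁.rest = s.rest := rfl
    ext x
    rw [mem_cand, hrest]
    simp only [hs₁, if_pos hj, Finset.mem_filter, Finset.mem_inter]
    constructor
    · rintro ⟨⟨h1, h2⟩, h3⟩
      rw [gain_answers (W := fun j => s.V j ∩ s.rest) hj (Finset.mem_inter.2 ⟨h1, h2⟩)] at h3
      exact ⟨h2, h3⟩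
    · rintro ⟨h2, h3⟩
      have h1 := hV j hj (mem_cand.2 ⟨h2, h3⟩)
      refine ⟨⟨h1, h2⟩, ?_⟩
      rwa [gain_answers (W := fun j => s.V j ∩ s.rest) hj (Finset.mem_inter.2 ⟨h1, h2⟩)]
  have h := updateLoop_sat (c := c) hε hε1 hτ J N s₁ (r + 1) hV₁ hc
  convert Prog.Sat.mono ?_ id h using 2
  rintro s' r' ⟨hU, hr, ht, hp⟩
  refine ⟨⟨hU.I_eq, hU.m_eq, hU.A_eq, hU.A'_eq, ?_, hU.off_τ, hU.τ_le, hU.V_eq, hU.done,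
    hU.bound⟩, hr, ht, hp⟩
  intro j hj
  rw [hU.off_V j hj]
  exact if_neg hj

end

end PIG

/-! ### `Distribute`, random orders, and the effect of a block -/

namespace PIG

section

variable {U : Type u} [DecidableEq U] {ℓ : ℕ}

theorem card_biUnion_update_le (W : Fin ℓ → Finset U) (j : Fin ℓ) (S : Finset U) :
    (Finset.univ.biUnion (Function.update W j S)).card ≤
      (Finset.univ.biUnion W).card + S.card := by
  refine (Finset.card_le_card ?_).trans (Finset.card_union_le _ _)
  intro x hx
  obtain ⟨i, -, hi⟩ := Finset.mem_biUnion.1 hx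
  by_cases h : i = j
  · subst h
    rw [Function.update_self] at hi
    exact Finset.mem_union_right _ hi
  · rw [Function.update_of_ne h] at hi
    exact Finset.mem_union_left _ (Finset.mem_biUnion.2 ⟨i, Finset.mem_univ i, hi⟩)

/-- At each step of `Distribute` enough elements are left to choose from. -/
structure DistributeReady (r : ℕ) (V : Fin ℓ → Finset U) (js : List (Fin ℓ))
    (W : Fin ℓ → Finset U) : Prop where
  nodup : js.Nodup
  sorted : js.Pairwise fun i j => (V i).card ≤ (V j).card
  room : ∀ j ∈ js, (Finset.univ.biUnion W).card + js.length * ((V j).card / r) ≤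
    r * ((V j).card / r)

variable {r : ℕ} {V : Fin ℓ → Finset U} {js : List (Fin ℓ)} {W : Fin ℓ → Finset U} {j : Fin ℓ}

/-- Processing by nondecreasing size matters here: the elements already taken never exceed the
shares reserved in the later, larger sets. -/
theorem DistributeReady.tail (h : DistributeReady r V (j :: js) W) {S : Finset U}
    (hS : S.card = (V j).card / r) : DistributeReady r V js (Function.update W j S) := by
  refine ⟨(List.nodup_cons.1 h.nodup).2, (List.pairwise_cons.1 h.sorted).2, fun i hi => ?_⟩
  have h1 := h.room i (List.mem_cons_of_mem _ hi)
  have h2 := card_biUnion_update_le W j S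
  have h3 := Nat.div_le_div_right (c := r) ((List.pairwise_cons.1 h.sorted).1 i hi)
  rw [List.length_cons, add_mul, one_mul] at h1
  omega

/-- The number of elements left when `j` is processed. -/
theorem DistributeReady.card_sdiff (h : DistributeReady r V (j :: js) W) :
    (V j).card + (V j).card / r ≤
      (V j \ Finset.univ.biUnion W).card + r * ((V j).card / r) := by
  have h1 := h.room j (by simp)
  have h2 := Finset.le_card_sdiff (Finset.univ.biUnion W) (V j)
  rw [List.length_cons, add_mul, one_mul] at h1
  omega

theorem DistributeReady.nonempty (h : DistributeReady r V (j :: js) W) :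
    ((V j \ Finset.univ.biUnion W).powersetCard ((V j).card / r)).Nonempty := by
  rw [Finset.powersetCard_nonempty]
  have h1 := h.card_sdiff
  have h2 := Nat.mul_div_le (V j).card r
  omega

variable {f : Finset U → ℝ} {c : Prop}

theorem distributeLoop_sat (r : ℕ) (V : Fin ℓ → Finset U) (t : ℕ) :
    ∀ (js : List (Fin ℓ)) (W : Fin ℓ → Finset U), DistributeReady r V js W →
      (∀ i j, i ≠ j → Disjoint (W i) (W j)) →
      Prog.Sat f (fun W' t' => t' = t ∧ (∀ i j, i ≠ j → Disjoint (W' i) (W' j)) ∧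
        (∀ j ∈ js, W' j ⊆ V j ∧ (W' j).card = (V j).card / r) ∧ ∀ j ∉ js, W' j = W j) c t
        (distributeLoop r V js W)
  | [], W, _, hd => ⟨rfl, hd, by simp, fun _ _ => rfl⟩
  | j :: js, W, h, hd => by
      intro S hS
      have hS' := Finset.mem_powersetCard.1 (mem_of_mem_support_uniformOn h.nonempty hS)
      refine Prog.Sat.mono ?_ id (distributeLoop_sat r V t js (Function.update W j S)
        (h.tail hS'.2) ?_)
      · rintro W' t' ⟨ht, hd', hW, hoff⟩
        have hj : W' j = S := by
          rw [hoff j (List.nodup_cons.1 h.nodup).1, Function.update_self]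
        refine ⟨ht, hd', fun i hi => ?_, fun i hi => ?_⟩
        · rcases List.mem_cons.1 hi with rfl | hi
          · rw [hj]
            exact ⟨hS'.1.trans Finset.sdiff_subset, hS'.2⟩
          · exact hW i hi
        · rw [List.mem_cons, not_or] at hi
          rw [hoff i hi.2, Function.update_of_ne hi.1]
      · have hSW : ∀ i, Disjoint S (W i) := fun i => Finset.disjoint_left.2 fun x hx hx' =>
          (Finset.mem_sdiff.1 (hS'.1 hx)).2 (Finset.mem_biUnion.2 ⟨i, Finset.mem_univ i, hx'⟩)
        intro i i' hii
        by_cases h1 : i = j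
        · subst h1
          rw [Function.update_self, Function.update_of_ne hii.symm]
          exact hSW i'
        · rw [Function.update_of_ne h1]
          by_cases h2 : i' = j
          · subst h2
            rw [Function.update_self]
            exact (hSW i).symm
          · rw [Function.update_of_ne h2]
            exact hd i i' hii

/-- The order in which `Distribute` processes the indices. -/
noncomputable def distributeOrder (I : Finset (Fin ℓ)) (V : Fin ℓ → Finset U) : List (Fin ℓ) :=
  ((List.finRange ℓ).filter fun j => j ∈ I).insertionSort fun i j => (V i).card ≤ (V j).card

theorem distributeOrder_perm (I : Finset (Fin ℓ)) (V : Fin ℓ → Finset U) :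
    (distributeOrder I V).Perm ((List.finRange ℓ).filter fun j => j ∈ I) :=
  List.perm_insertionSort _ _

theorem mem_distributeOrder {I : Finset (Fin ℓ)} {V : Fin ℓ → Finset U} {j : Fin ℓ} :
    j ∈ distributeOrder I V ↔ j ∈ I := by
  rw [(distributeOrder_perm I V).mem_iff]
  simp

theorem distributeReady (I : Finset (Fin ℓ)) (V : Fin ℓ → Finset U) :
    DistributeReady I.card V (distributeOrder I V) fun _ => ∅ := by
  have hn : (distributeOrder I V).Nodup :=
    (distributeOrder_perm I V).nodup_iff.2 ((List.nodup_finRange ℓ).filter _)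
  refine ⟨hn, ?_, fun j _ => ?_⟩
  · have : Std.Total fun i j : Fin ℓ => (V i).card ≤ (V j).card := ⟨fun i j => le_total _ _⟩
    have : IsTrans (Fin ℓ) fun i j => (V i).card ≤ (V j).card := ⟨fun _ _ _ => le_trans⟩
    exact List.pairwise_insertionSort _ _
  · have h1 : (distributeOrder I V).toFinset = I := by
      ext j
      rw [List.mem_toFinset, mem_distributeOrder]
    have h2 : (distributeOrder I V).length = I.card := by
      rw [← List.toFinset_card_of_nodup hn, h1]
    have h3 : (Finset.univ.biUnion fun _ : Fin ℓ => (∅ : Finset U)) = ∅ := by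
      ext
      simp
    rw [h2, h3, Finset.card_empty, zero_add]

theorem distribute_sat (I : Finset (Fin ℓ)) (V : Fin ℓ → Finset U) (t : ℕ) :
    Prog.Sat f (fun W' t' => t' = t ∧ (∀ i j, i ≠ j → Disjoint (W' i) (W' j)) ∧
      ∀ j ∈ I, W' j ⊆ V j ∧ (W' j).card = (V j).card / I.card) c t (distribute I V) := by
  refine Prog.Sat.mono ?_ id (distributeLoop_sat I.card V t _ _ (distributeReady I V)
    fun _ _ _ => Finset.disjoint_empty_left _)
  rintro W t' ⟨h1, h2, h3, -⟩
  exact ⟨h1, h2, fun j hj => h3 j (mem_distributeOrder.2 hj)⟩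

theorem mem_lists_toFinset {S : Finset U} {w : List U} :
    w ∈ S.val.lists.toFinset ↔ w.Nodup ∧ w.toFinset = S := by
  rw [Multiset.mem_toFinset, Multiset.mem_lists_iff]
  constructor
  · intro h
    have hn : w.Nodup := by
      have := S.nodup
      rw [h] at this
      exact Multiset.coe_nodup.1 this
    refine ⟨hn, Finset.val_injective ?_⟩
    rw [List.toFinset_val, hn.dedup, h]
    rfl
  · rintro ⟨hn, rfl⟩
    rw [List.toFinset_val, hn.dedup]
    rfl

theorem lists_toFinset_nonempty (S : Finset U) : S.val.lists.toFinset.Nonempty :=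
  ⟨S.toList, mem_lists_toFinset.2 ⟨S.nodup_toList, S.toList_toFinset⟩⟩

theorem permute_sat (W : Fin ℓ → Finset U) (t : ℕ) :
    ∀ (js : List (Fin ℓ)) (v : Fin ℓ → List U), js.Nodup →
      Prog.Sat f (fun v' t' => t' = t ∧ (∀ j ∈ js, (v' j).Nodup ∧ (v' j).toFinset = W j) ∧
        ∀ j ∉ js, v' j = v j) c t (permute W js v)
  | [], v, _ => ⟨rfl, by simp, fun _ _ => rfl⟩
  | j :: js, v, hn => by
      intro w hw
      have hw' := mem_lists_toFinset.1
        (mem_of_mem_support_uniformOn (lists_toFinset_nonempty (W j)) hw)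
      refine Prog.Sat.mono ?_ id (permute_sat W t js (Function.update v j w)
        (List.nodup_cons.1 hn).2)
      rintro v' t' ⟨ht, hv, hoff⟩
      refine ⟨ht, fun i hi => ?_, fun i hi => ?_⟩
      · rcases List.mem_cons.1 hi with rfl | hi
        · rw [hoff i (List.nodup_cons.1 hn).1, Function.update_self]
          exact hw'
        · exact hv i hi
      · rw [List.mem_cons, not_or] at hi
        rw [hoff i hi.2, Function.update_of_ne hi.1]

end

section

variable {U : Type u} [DecidableEq U] {ℓ : ℕ}

/-- The number of elements that a block examines for each active index. -/
noncomputable def State.blockSize (s : State U ℓ) (hI : s.I.Nonempty) : ℕ :=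
  min s.m₀ (s.I.inf' hI fun j => (s.V j).card / s.I.card)

/-- The number of elements that a block adds to each active solution. -/
noncomputable def State.blockCount (f : Finset U → ℝ) (ε : ℝ) (s : State U ℓ) (hI : s.I.Nonempty)
    (v : Fin ℓ → List U) (n : ℕ) : ℕ :=
  s.I.inf' hI fun j => goodPrefix ε (marks f (s.A j) (v j) (s.τ j) n)

/-- The state after a block with the random orders `v`. -/
noncomputable def State.block (f : Finset U → ℝ) (ε : ℝ) (s : State U ℓ) (hI : s.I.Nonempty)
    (v : Fin ℓ → List U) (n : ℕ) : State U ℓ :=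
  { s with
    A := fun j => if j ∈ s.I then s.A j ∪
        ((selection f ε (s.A j) (v j) (s.τ j) n (s.blockCount f ε hI v n)).map Prod.fst).toFinset
      else s.A j
    A' := fun j => if j ∈ s.I then s.A' j ∪
        (((selection f ε (s.A j) (v j) (s.τ j) n (s.blockCount f ε hI v n)).filter fun y =>
          y.2 ≠ some false).map Prod.fst).toFinset
      else s.A' j
    m₀ := s.m₀ - s.blockCount f ε hI v n }

/-- `v` is a possible outcome of the random choices of a block. -/
structure BlockOrder (s : State U ℓ) (v : Fin ℓ → List U) : Prop where
  nodup : ∀ j ∈ s.I, (v j).Nodup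
  mem : ∀ j ∈ s.I, ∀ x ∈ v j, x ∈ s.V j
  length : ∀ j ∈ s.I, (v j).length = (s.V j).card / s.I.card
  disjoint : ∀ i ∈ s.I, ∀ j ∈ s.I, i ≠ j → Disjoint (v i).toFinset (v j).toFinset

theorem marks_answers {f : Finset U → ℝ} {I : Finset (Fin ℓ)} {A : Fin ℓ → Finset U}
    {v : Fin ℓ → List U} {n : ℕ} {j : Fin ℓ} (hj : j ∈ I) (τ : ℝ) :
    marks (fun S => if S ∈ ∑ j ∈ I, prefixBatch (A j) (v j) n then f S else 0) (A j) (v j) τ n =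
      marks f (A j) (v j) τ n := by
  have h : ∀ i ≤ n, A j ∪ ((v j).take i).toFinset ∈ ∑ j ∈ I, prefixBatch (A j) (v j) n := by
    intro i hi
    refine Multiset.mem_sum.2 ⟨j, hj, Multiset.mem_map.2 ⟨i, ?_, rfl⟩⟩
    rw [Multiset.mem_range]
    omega
  refine List.map_congr_left fun i hi => ?_
  rw [List.mem_range] at hi
  simp only [mark, if_pos (h i hi.le), if_pos (h (i + 1) hi)]

variable {f : Finset U → ℝ} {ε : ℝ} {c : Prop}

/-- The batch contains every prefix that the marks compare, so the default value 0 for unqueried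
sets is never used. -/
theorem block_answers (s : State U ℓ) (hI : s.I.Nonempty) (v : Fin ℓ → List U) (n : ℕ) :
    s.block (fun S => if S ∈ ∑ j ∈ s.I, prefixBatch (s.A j) (v j) n then f S else 0) ε hI v n =
      s.block f ε hI v n := by
  have h : ∀ j ∈ s.I, marks (fun S => if S ∈ ∑ j ∈ s.I, prefixBatch (s.A j) (v j) n then f S
      else 0) (s.A j) (v j) (s.τ j) n = marks f (s.A j) (v j) (s.τ j) n :=
    fun j hj => marks_answers hj _
  have hc : s.blockCount (fun S => if S ∈ ∑ j ∈ s.I, prefixBatch (s.A j) (v j) n then f S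
      else 0) ε hI v n = s.blockCount f ε hI v n := by
    unfold State.blockCount
    exact Finset.inf'_congr hI rfl fun j hj => by rw [h j hj]
  unfold State.block
  rw [hc]
  congr 1
  · funext j
    split_ifs with hj
    · simp only [selection, h j hj]
    · rfl
  · funext j
    split_ifs with hj
    · simp only [selection, h j hj]
    · rfl

theorem addBlocks_eq (ε : ℝ) (s : State U ℓ) (hI : s.I.Nonempty) :
    addBlocks ε s hI = (distribute s.I s.V).bind fun W =>
      (permute W ((List.finRange ℓ).filter fun j => j ∈ s.I) fun _ => []).bind fun v =>
        .ask (∑ j ∈ s.I, prefixBatch (s.A j) (v j)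
            (min s.m₀ (s.I.inf' hI fun j => (W j).card))) fun ans =>
          .ret (s.block ans ε hI v (min s.m₀ (s.I.inf' hI fun j => (W j).card))) :=
  rfl

theorem blockSize_eq (s : State U ℓ) (hI : s.I.Nonempty) {W : Fin ℓ → Finset U}
    (hW : ∀ j ∈ s.I, (W j).card = (s.V j).card / s.I.card) :
    min s.m₀ (s.I.inf' hI fun j => (W j).card) = s.blockSize hI := by
  rw [State.blockSize, Finset.inf'_congr hI rfl hW]

theorem blockOrder_of_subset {s : State U ℓ} {W : Fin ℓ → Finset U} {v : Fin ℓ → List U}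
    (hd : ∀ i j, i ≠ j → Disjoint (W i) (W j))
    (hW : ∀ j ∈ s.I, W j ⊆ s.V j ∧ (W j).card = (s.V j).card / s.I.card)
    (hv : ∀ j ∈ s.I, (v j).Nodup ∧ (v j).toFinset = W j) : BlockOrder s v where
  nodup j hj := (hv j hj).1
  mem j hj x hx := (hW j hj).1 (by rw [← (hv j hj).2]; simpa using hx)
  length j hj := by
    rw [← (hW j hj).2, ← (hv j hj).2, List.toFinset_card_of_nodup (hv j hj).1]
  disjoint i hi j hj hij := by
    rw [(hv i hi).2, (hv j hj).2]
    exact hd i j hij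

/-- Once the random orders are fixed a block is deterministic, so properties of all runs reduce to
properties of `State.block` over all possible orders. -/
theorem addBlocks_sat (s : State U ℓ) (hI : s.I.Nonempty) (r : ℕ) {φ : State U ℓ → ℕ → Prop}
    (h : ∀ v, BlockOrder s v → φ (s.block f ε hI v (s.blockSize hI)) (r + 1)) :
    Prog.Sat f φ c r (addBlocks ε s hI) := by
  rw [addBlocks_eq]
  refine Prog.Sat.bind ?_ (distribute_sat s.I s.V r)
  rintro W r₁ ⟨rfl, hd, hW⟩
  refine Prog.Sat.bind ?_ (permute_sat W r₁ _ _ ((List.nodup_finRange ℓ).filter _))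
  rintro v r₂ ⟨rfl, hv, -⟩
  simp only [Prog.Sat]
  rw [block_answers, blockSize_eq s hI fun j hj => (hW j hj).2]
  exact h v (blockOrder_of_subset hd hW fun j hj => hv j (by simpa using hj))

end

end PIG

/-! ### Adding one element to a solution -/

namespace PIG

section

variable {U : Type u} [DecidableEq U] {ℓ : ℕ}

/-- Add `x` to the solution `j`. -/
def State.addOne (s : State U ℓ) (j : Fin ℓ) (x : U) : State U ℓ :=
  { s with
    A := Function.update s.A j (insert x (s.A j))
    A' := Function.update s.A' j (insert x (s.A' j))
    V := fun l => (s.V l).erase x }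

theorem subset_addOne (s : State U ℓ) (j : Fin ℓ) (x : U) (i : Fin ℓ) :
    s.A i ⊆ (s.addOne j x).A i := by
  by_cases h : i = j
  · subst h
    simp [State.addOne]
  · simp [State.addOne, Function.update_of_ne h]

theorem addOne_A_self (s : State U ℓ) (j : Fin ℓ) (x : U) :
    (s.addOne j x).A j = insert x (s.A j) := by
  simp [State.addOne]

theorem addOne_A_of_ne (s : State U ℓ) {i j : Fin ℓ} (h : i ≠ j) (x : U) :
    (s.addOne j x).A i = s.A i := by
  simp [State.addOne, Function.update_of_ne h]

variable [Fintype U]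

theorem mem_rest_addOne {s : State U ℓ} {j : Fin ℓ} {x y : U} :
    y ∈ (s.addOne j x).rest ↔ y ∈ s.rest ∧ y ≠ x := by
  rw [mem_rest, mem_rest]
  constructor
  · intro h
    refine ⟨fun i hi => h i (subset_addOne s j x i hi), ?_⟩
    rintro rfl
    exact h j (by simp [addOne_A_self])
  · rintro ⟨h, hxy⟩ i hi
    by_cases hij : i = j
    · subst hij
      rw [addOne_A_self, Finset.mem_insert] at hi
      exact hi.elim hxy (h i)
    · rw [addOne_A_of_ne s hij] at hi
      exact h i hi

/-- The candidates become fewer when the solutions grow and the thresholds stay the same. -/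
theorem cand_anti {f : Finset U → ℝ} (hf : IsSubmodular f) {s s' : State U ℓ}
    (hA : ∀ j, s.A j ⊆ s'.A j) {j : Fin ℓ} (hτ : s'.τ j = s.τ j) : s'.cand f j ⊆ s.cand f j := by
  intro x hx
  rw [mem_cand, mem_rest] at hx ⊢
  rw [hτ] at hx
  exact ⟨fun i hi => hx.1 i (hA i hi), hx.2.trans (hf.gain_anti (hA j) (hx.1 j))⟩

theorem cand_addOne_of_ne {f : Finset U → ℝ} (s : State U ℓ) {i j : Fin ℓ} (h : i ≠ j) (x : U) :
    (s.addOne j x).cand f i = (s.cand f i).erase x := by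
  ext y
  rw [mem_cand, mem_rest_addOne, Finset.mem_erase, mem_cand, addOne_A_of_ne s h]
  have : (s.addOne j x).τ i = s.τ i := rfl
  rw [this]
  tauto

theorem cand_addOne_subset {f : Finset U → ℝ} (hf : IsSubmodular f) (s : State U ℓ)
    {i j : Fin ℓ} (x : U) : (s.addOne j x).cand f i ⊆ (s.cand f i).erase x := by
  intro y hy
  refine Finset.mem_erase.2 ⟨(mem_rest_addOne.1 (mem_cand.1 hy).1).2, ?_⟩
  exact cand_anti hf (subset_addOne s j x) rfl hy

variable {f : Finset U → ℝ} {ε τmin : ℝ} {c : Prop}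

/-- The effect of the conditional call of `Update` for the index `j` in `addOneEach`, which takes
the number of rounds from `r` to `r'`. -/
structure Refreshed (f : Finset U → ℝ) (ε τmin : ℝ) (j : Fin ℓ) (s s' : State U ℓ) (r r' : ℕ) :
    Prop where
  updated : Updated f ε τmin {j} s s'
  r_le : r ≤ r'
  eq_of_nonempty : s.V j ≠ ∅ → s' = s
  pot_le : 0 < τmin → s'.pot f ε τmin + r' ≤ s.pot f ε τmin + r
  pot_lt : 0 < τmin → s.V j = ∅ → s'.pot f ε τmin + r' + 1 ≤ s.pot f ε τmin + r

/-- If the update runs, d ≥ 1 reductions take d + 1 rounds and release 3d units of potential, and 3d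
≥ (d + 1) + 1. -/
theorem refresh_sat (hε : 0 < ε) (hε1 : ε < 1) (hτ : 0 ≤ τmin) (N : ℕ) (j : Fin ℓ)
    (s : State U ℓ) (r : ℕ) (hV : s.V j = s.cand f j) (hj : τmin ≤ s.τ j)
    (hc : c ∨ (0 < τmin ∧ s.pot f ε τmin < N)) [Decidable (s.V j = ∅)] :
    Prog.Sat f (fun s' r' => Refreshed f ε τmin j s s' r r') c r
      (if s.V j = ∅ then update ε τmin N {j} s else .ret s) := by
  split_ifs with hV0
  · refine Prog.Sat.mono ?_ id (update_sat hε hε1 hτ N {j} s r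
      (fun i hi => by rw [Finset.mem_singleton.1 hi, hV]) hc)
    rintro s' r' ⟨hU, hr, ht, hp⟩
    -- At least one reduction happens: with unchanged thresholds the candidate set would still be
    -- empty and the index still active.
    have hr2 : r' ≠ r + 1 := by
      intro h
      have h1 := ht h
      have h2 : s'.cand f j = s.cand f j := by
        ext x
        rw [mem_cand, mem_cand, mem_rest, mem_rest, hU.A_eq, h1]
      rcases hU.done j (Finset.mem_singleton_self j) with h3 | h3
      · rw [hU.V_eq j (Finset.mem_singleton_self j), h2, ← hV] at h3
        exact h3 hV0
      · rw [h1] at h3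
        exact absurd hj (not_le.2 h3)
    refine ⟨hU, by omega, fun h => absurd hV0 h, fun h => ?_, fun h _ => ?_⟩
    · have := hp h
      omega
    · have := hp h
      omega
  · refine ⟨⟨rfl, rfl, rfl, rfl, fun _ _ => rfl, fun _ _ => rfl, fun _ => le_rfl, ?_, ?_,
      fun _ _ _ h => h⟩, le_rfl, fun _ => rfl, fun _ => le_rfl, fun _ h => absurd h hV0⟩
    · intro i hi
      rw [Finset.mem_singleton.1 hi, hV]
    · intro i hi
      rw [Finset.mem_singleton.1 hi]
      exact Or.inl hV0

variable [Nonempty U]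

theorem addOneEach_cons_sat (hε : 0 < ε) (hε1 : ε < 1) (hτ : 0 ≤ τmin) {N : ℕ} {j : Fin ℓ}
    {js : List (Fin ℓ)} {s : State U ℓ} {r : ℕ} (hjI : j ∈ s.I) (hV : s.V j = s.cand f j)
    (hj : τmin ≤ s.τ j) (hc : c ∨ (0 < τmin ∧ s.pot f ε τmin < N)) {φ : State U ℓ → ℕ → Prop}
    (h₁ : ∀ s' r', Refreshed f ε τmin j s s' r r' → s'.τ j < τmin →
      Prog.Sat f φ c r' (addOneEach ε τmin N js { s' with I := s'.I.erase j }))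
    (h₂ : ∀ s' r', Refreshed f ε τmin j s s' r r' → τmin ≤ s'.τ j → ∀ x ∈ s'.cand f j,
      Prog.Sat f φ c r' (addOneEach ε τmin N js (s'.addOne j x))) :
    Prog.Sat f φ c r (addOneEach ε τmin N (j :: js) s) := by
  classical
  rw [addOneEach, if_pos hjI]
  refine Prog.Sat.bind ?_ (refresh_sat hε hε1 hτ N j s r hV hj hc)
  intro s' r' hR
  split_ifs with hτj
  · convert h₁ s' r' hR hτj
  · have hVj := hR.updated.V_eq j (Finset.mem_singleton_self j)
    have hne : s'.V j ≠ ∅ := (hR.updated.done j (Finset.mem_singleton_self j)).resolve_right hτj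
    intro x hx
    have hx' := mem_of_mem_support_uniformOn (Finset.nonempty_iff_ne_empty.2 hne) hx
    rw [hVj] at hx'
    exact h₂ s' r' hR (not_lt.1 hτj) x hx'

theorem addOneEach_cons_of_notMem (N : ℕ) {j : Fin ℓ} {js : List (Fin ℓ)} {s : State U ℓ}
    (hj : j ∉ s.I) : addOneEach ε τmin N (j :: js) s = addOneEach ε τmin N js s := by
  rw [addOneEach, if_neg hj]

end

end PIG

/-! ### The approximation guarantee -/

namespace PIG

section

variable {U : Type u} [DecidableEq U]

/-- There is a ledger with at least `b j` unused slots, whose total is covered by the values of the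
solutions. -/
def HasLedger (f : Finset U → ℝ) (O : Finset U) (k : ℕ) (ε τmin : ℝ) (s : State U 2)
    (b : Fin 2 → ℝ) : Prop :=
  ∃ c Γ, (∀ j, b j ≤ c j) ∧ Ledger f O k (1 - ε)⁻¹ τmin s.A s.τ c Γ ∧
    Γ ≤ (1 - ε)⁻¹ ^ 2 * (f (s.A' 0) + f (s.A' 1))

/-- As long as the solutions are not contained in `O`, the second of two active solutions has an
unused slot. -/
def LedgerInv (f : Finset U → ℝ) (O : Finset U) (k : ℕ) (ε τmin : ℝ) (s : State U 2) : Prop :=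
  Finset.univ.biUnion s.A ⊆ O ∨ HasLedger f O k ε τmin s ![0, 1] ∨
    (HasLedger f O k ε τmin s 0 ∧ ∃ j, s.τ j < τmin)

variable {f : Finset U → ℝ} {O : Finset U} {k : ℕ} {ε τmin : ℝ} {s s' : State U 2}
  {b : Fin 2 → ℝ}

theorem HasLedger.mono (h : HasLedger f O k ε τmin s b) {b' : Fin 2 → ℝ}
    (hb : ∀ j, b' j ≤ b j) : HasLedger f O k ε τmin s b' := by
  obtain ⟨c, Γ, hc, hL, hΓ⟩ := h
  exact ⟨c, Γ, fun j => (hb j).trans (hc j), hL, hΓ⟩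

/-- Slot requirements need only be checked for active indices. -/
theorem HasLedger.raise (h : HasLedger f O k ε τmin s b) {b' : Fin 2 → ℝ}
    (hb : ∀ j, τmin ≤ s.τ j → b' j ≤ b j) : HasLedger f O k ε τmin s b' := by
  obtain ⟨c, Γ, hc, hL, hΓ⟩ := h
  refine ⟨fun j => if τmin ≤ s.τ j then c j else max (c j) (b' j), Γ, fun j => ?_,
    hL.raise (fun j => ?_) (fun j hj => if_pos hj), hΓ⟩
  · beta_reduce
    split_ifs with hj
    · exact (hb j hj).trans (hc j)
    · exact le_max_right _ _
  · split_ifs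
    · exact le_rfl
    · exact le_max_left _ _

theorem addOne_A (s : State U 2) (j : Fin 2) (x : U) :
    (s.addOne j x).A = Function.update s.A j (s.A j ∪ {x}) := by
  rw [Finset.union_comm]
  rfl

theorem biUnion_addOne_subset {x : U} {j : Fin 2} (h : Finset.univ.biUnion s.A ⊆ O) (hx : x ∈ O) :
    Finset.univ.biUnion (s.addOne j x).A ⊆ O := by
  rw [addOne_A, biUnion_update_union]
  exact Finset.union_subset h (Finset.singleton_subset_iff.2 hx)

variable [Fintype U]

/-- The properties of the two solutions that hold throughout. -/
structure Sound (f : Finset U → ℝ) (ε τmin : ℝ) (s : State U 2) : Prop where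
  disj : Disjoint (s.A 0) (s.A 1)
  A'_sub : ∀ j, s.A' j ⊆ s.A j
  val : ∀ j, f (s.A j) ≤ f (s.A' j)
  cand : ∀ j ∈ s.I, s.cand f j ⊆ s.V j
  bound : GainBound f (1 - ε)⁻¹ τmin s.A s.τ
  active : ∀ j, τmin ≤ s.τ j → j ∈ s.I

theorem one_le_inv_one_sub (hε : 0 < ε) (hε1 : ε < 1) : 1 ≤ (1 - ε)⁻¹ :=
  (one_le_inv₀ (by linarith)).2 (by linarith)

theorem HasLedger.of_subset (hf : IsSubmodular f) (h0 : ∀ S, 0 ≤ f S) (hε : 0 < ε) (hε1 : ε < 1)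
    (hτ : 0 ≤ τmin) (hO : O.card ≤ k) (hs : Sound f ε τmin s)
    (h : Finset.univ.biUnion s.A ⊆ O) : HasLedger f O k ε τmin s 0 := by
  have hl := one_le_inv_one_sub hε hε1
  refine ⟨fun _ => 0, _, fun _ => le_rfl,
    Ledger.of_subset hf h0 (zero_le_one.trans hl) hτ hO hs.disj h, ?_⟩
  have h1 : 1 ≤ (1 - ε)⁻¹ ^ 2 := one_le_pow₀ hl
  nlinarith [hs.val 0, hs.val 1, h0 (s.A' 0), h0 (s.A' 1)]

theorem LedgerInv.hasLedger (hf : IsSubmodular f) (h0 : ∀ S, 0 ≤ f S) (hε : 0 < ε) (hε1 : ε < 1)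
    (hτ : 0 ≤ τmin) (hO : O.card ≤ k) (hs : Sound f ε τmin s) (h : LedgerInv f O k ε τmin s) :
    HasLedger f O k ε τmin s 0 := by
  rcases h with h | h | h
  · exact HasLedger.of_subset hf h0 hε hε1 hτ hO hs h
  · refine h.mono fun j => ?_
    fin_cases j <;> simp
  · exact h.1

theorem HasLedger.update (hε1 : ε < 1) (hτ : 0 ≤ τmin) (hO : O.card ≤ k) {J : Finset (Fin 2)}
    (h : HasLedger f O k ε τmin s b) (hb : ∀ j, 0 ≤ b j) (hU : Updated f ε τmin J s s') :
    HasLedger f O k ε τmin s' b := by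
  obtain ⟨c, Γ, hc, hL, hΓ⟩ := h
  refine ⟨c, Γ, hc, ?_, by rwa [hU.A'_eq]⟩
  rw [hU.A_eq]
  exact hL.lower (inv_nonneg.2 (by linarith)) hτ hO (fun j => (hb j).trans (hc j)) hU.τ_le

theorem LedgerInv.update (hε1 : ε < 1) (hτ : 0 ≤ τmin) (hO : O.card ≤ k) {J : Finset (Fin 2)}
    (h : LedgerInv f O k ε τmin s) (hU : Updated f ε τmin J s s') :
    LedgerInv f O k ε τmin s' := by
  rcases h with h | h | ⟨h, j, hj⟩
  · left
    rwa [hU.A_eq]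
  · exact Or.inr (Or.inl (h.update hε1 hτ hO (fun j => by fin_cases j <;> simp) hU))
  · exact Or.inr (Or.inr ⟨h.update hε1 hτ hO (fun _ => le_rfl) hU, j, (hU.τ_le j).trans_lt hj⟩)

theorem Sound.update {J : Finset (Fin 2)} (hs : Sound f ε τmin s)
    (hU : Updated f ε τmin J s s') : Sound f ε τmin s' := by
  have hrest : s'.rest = s.rest := by rw [State.rest, State.rest, hU.A_eq]
  refine ⟨by rw [hU.A_eq]; exact hs.disj, by rw [hU.A_eq, hU.A'_eq]; exact hs.A'_sub,
    by rw [hU.A_eq, hU.A'_eq]; exact hs.val, fun j hj => ?_, fun j x hx => ?_,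
    fun j hj => by rw [hU.I_eq]; exact hs.active j (hj.trans (hU.τ_le j))⟩
  · by_cases hjJ : j ∈ J
    · rw [hU.V_eq j hjJ]
    · rw [hU.off_V j hjJ]
      refine subset_trans (fun x hx => ?_) (hs.cand j (hU.I_eq ▸ hj))
      rw [mem_cand, hrest, hU.A_eq, hU.off_τ j hjJ] at hx
      exact mem_cand.2 hx
  · rw [hU.A_eq] at hx ⊢
    refine hU.bound j x ?_ (hs.bound j x hx)
    simpa [State.rest] using hx

theorem disjoint_singleton_of_mem_rest {x : U} (hx : x ∈ s.rest) :
    Disjoint {x} (Finset.univ.biUnion s.A) := by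
  rw [Finset.disjoint_singleton_left]
  simpa [State.rest] using hx

/-- A' j is a subset of A j, so x gains at least as much over it. -/
theorem le_value_addOne (hf : IsSubmodular f) (hs : Sound f ε τmin s) {j : Fin 2} {x : U}
    (hx : x ∈ s.cand f j) : f (s.A' j) + s.τ j ≤ f (insert x (s.A' j)) := by
  have h1 := mem_cand.1 hx
  have h2 := hf.gain_anti (hs.A'_sub j) (mem_rest.1 h1.1 j)
  have h3 := h1.2
  simp only [gain] at h2 h3
  linarith

theorem Sound.addOne (hf : IsSubmodular f) (hs : Sound f ε τmin s) {j : Fin 2} {x : U}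
    (hx : x ∈ s.rest) : Sound f ε τmin (s.addOne j x) := by
  have hx' := mem_rest.1 hx
  refine ⟨?_, fun i => ?_, fun i => ?_, fun i hi => ?_, hs.bound.mono hf (subset_addOne s j x),
    hs.active⟩
  · have h0 := hx' 0
    have h1 := hx' 1
    have := hs.disj
    fin_cases j <;> simp [State.addOne, *]
  · by_cases hij : i = j
    · subst hij
      simpa [State.addOne] using Finset.insert_subset_insert x (hs.A'_sub i)
    · simpa [State.addOne, Function.update_of_ne hij] using hs.A'_sub i
  · by_cases hij : i = j
    · subst hij
      have h1 := hf (hs.A'_sub i) x (hx' i)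
      have h2 := hs.val i
      simp only [State.addOne, Function.update_self]
      linarith
    · simpa [State.addOne, Function.update_of_ne hij] using hs.val i
  · exact (cand_addOne_subset hf s x).trans (Finset.erase_subset_erase x (hs.cand i hi))

/-- The value of A' j rises by at least τ j, which covers the charge (1 - ε)⁻¹ τ j since (1 - ε)⁻¹ ≤
(1 - ε)⁻². The new element opens a slot for j, and if it is in O it takes one from the other index.
-/
theorem HasLedger.addOne (hf : IsSubmodular f) (hε : 0 < ε) (hε1 : ε < 1) (hτ : 0 ≤ τmin)
    (hs : Sound f ε τmin s) (h : HasLedger f O k ε τmin s b) {j : Fin 2} (hj : τmin ≤ s.τ j)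
    {x : U} (hx : x ∈ s.cand f j) :
    HasLedger f O k ε τmin (s.addOne j x)
      fun l => if l = j then b l + 1 else b l - if x ∈ O then 1 else 0 := by
  obtain ⟨c, Γ, hc, hL, hΓ⟩ := h
  obtain ⟨i, hij⟩ := exists_ne j
  have hxr := (mem_cand.1 hx).1
  have hl := one_le_inv_one_sub hε hε1
  have hnew := hL.add hf hs.bound hij (disjoint_singleton_of_mem_rest hxr) hj
  rw [← addOne_A] at hnew
  refine ⟨_, _, ?_, hnew, ?_⟩
  · intro l
    have := hc l
    have h2 : ((O ∩ {x}).card : ℝ) = if x ∈ O then 1 else 0 := by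
      split_ifs with hxO
      · rw [Finset.inter_singleton_of_mem hxO]
        simp
      · rw [Finset.inter_singleton_of_notMem hxO]
        simp
    rw [h2]
    split_ifs <;> simp_all
  · have h1 := le_value_addOne hf hs hx
    have h2 : f ((s.addOne j x).A' 0) + f ((s.addOne j x).A' 1) =
        f (insert x (s.A' j)) + f (s.A' i) := by
      rw [add_comm (f (insert x (s.A' j)))]
      have := sum_fin_two_of_ne hij fun l => f ((s.addOne j x).A' l)
      rw [Fin.sum_univ_two] at this
      rw [this]
      simp [State.addOne, Function.update_of_ne hij]
    have h3 : f (s.A' 0) + f (s.A' 1) = f (s.A' i) + f (s.A' j) := by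
      have := sum_fin_two_of_ne hij fun l => f (s.A' l)
      rwa [Fin.sum_univ_two] at this
    rw [h2]
    rw [h3] at hΓ
    rw [Finset.card_singleton, Nat.cast_one, mul_one]
    have h4 : 0 ≤ s.τ j := hτ.trans hj
    have h5 : (1 - ε)⁻¹ * s.τ j ≤ (1 - ε)⁻¹ ^ 2 * s.τ j := by
      refine mul_le_mul_of_nonneg_right ?_ h4
      nlinarith
    have h6 : 0 ≤ (1 - ε)⁻¹ ^ 2 := sq_nonneg _
    nlinarith

/-! #### The value of a ledger at the end -/

theorem approx_arith {x y : ℝ} (hε : 0 < ε) (hε4 : ε < 1 / 4) (hx : 0 ≤ x)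
    (h : x ≤ 2 * y + (1 - ε)⁻¹ ^ 2 * (2 * y) + 2 * ((1 - ε)⁻¹ * (ε * x))) :
    (1 / 4 - ε) * x ≤ y := by
  have h1 : 0 < 1 - ε := by linarith
  have h2 : (1 - ε) ^ 2 * x ≤ (1 - ε) ^ 2 * (2 * y) + 2 * y + 2 * ((1 - ε) * (ε * x)) := by
    have := mul_le_mul_of_nonneg_left h (sq_nonneg (1 - ε))
    have e : (1 - ε) ^ 2 * (2 * y + (1 - ε)⁻¹ ^ 2 * (2 * y) + 2 * ((1 - ε)⁻¹ * (ε * x))) =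
        (1 - ε) ^ 2 * (2 * y) + 2 * y + 2 * ((1 - ε) * (ε * x)) := by
      field_simp
    rwa [e] at this
  -- This polynomial is the slack: after multiplication by (1 - ε)², it is the coefficient (1 - ε)²
  -- - 2ε(1 - ε) of x minus (1/4 - ε) · 2((1 - ε)² + 1).
  have h3 : 0 ≤ (ε - 3 / 2 * ε ^ 2 + 2 * ε ^ 3) * x := by
    refine mul_nonneg ?_ hx
    nlinarith [pow_pos hε 3]
  have h4 : 0 < 2 * ((1 - ε) ^ 2 + 1) := by positivity
  refine le_of_mul_le_mul_left ?_ h4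
  nlinarith

theorem LedgerInv.final (hf : IsSubmodular f) (h0 : ∀ S, 0 ≤ f S) (hε : 0 < ε) (hε1 : ε < 1)
    (hτ : 0 ≤ τmin) (hkτ : k * τmin ≤ ε * f O) (hO : O.card ≤ k) (hs : Sound f ε τmin s)
    (h : LedgerInv f O k ε τmin s) (hk : ∀ j, τmin ≤ s.τ j → k ≤ (s.A j).card) :
    (1 / 4 - ε) * f O ≤ max (f (s.A' 0)) (f (s.A' 1)) := by
  by_cases hε4 : ε < 1 / 4
  · obtain ⟨c, Γ, -, hL, hΓ⟩ := h.hasLedger hf h0 hε hε1 hτ hO hs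
    have hl := one_le_inv_one_sub hε hε1
    have h1 := hL.final hf h0 (zero_le_one.trans hl) hτ hO hs.disj hs.bound hk
    have m0 := le_max_left (f (s.A' 0)) (f (s.A' 1))
    have m1 := le_max_right (f (s.A' 0)) (f (s.A' 1))
    refine approx_arith hε hε4 (h0 O) ?_
    have h2 : (1 - ε)⁻¹ ^ 2 * (f (s.A' 0) + f (s.A' 1)) ≤
        (1 - ε)⁻¹ ^ 2 * (2 * max (f (s.A' 0)) (f (s.A' 1))) :=
      mul_le_mul_of_nonneg_left (by linarith) (sq_nonneg _)
    have h3 : (1 - ε)⁻¹ * (k * τmin) ≤ (1 - ε)⁻¹ * (ε * f O) :=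
      mul_le_mul_of_nonneg_left hkτ (zero_le_one.trans hl)
    have := hs.val 0
    have := hs.val 1
    linarith
  -- For ε ≥ 1/4 the claimed bound is nonpositive.
  · have h1 : (1 / 4 - ε) * f O ≤ 0 := mul_nonpos_of_nonpos_of_nonneg (by linarith) (h0 O)
    exact h1.trans ((h0 _).trans (le_max_left _ _))

/-! #### One element for each solution -/

/-- With one index inactive nothing can go wrong: the active one only gains slots, and the counter
of the other is free. -/
theorem LedgerInv.addOne_of_inactive (hf : IsSubmodular f) (h0 : ∀ S, 0 ≤ f S) (hε : 0 < ε)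
    (hε1 : ε < 1) (hτ : 0 ≤ τmin) (hO : O.card ≤ k) (hs : Sound f ε τmin s)
    (h : LedgerInv f O k ε τmin s) {i j : Fin 2} (hij : i ≠ j) (hi : s.τ i < τmin)
    (hj : τmin ≤ s.τ j) {x : U} (hx : x ∈ s.cand f j) :
    LedgerInv f O k ε τmin (s.addOne j x) := by
  refine Or.inr (Or.inr ⟨?_, i, hi⟩)
  refine ((h.hasLedger hf h0 hε hε1 hτ hO hs).addOne hf hε hε1 hτ hs hj hx).raise fun l hl => ?_
  have : l = j := by
    by_contra hlj
    have : l = i := by omega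
    subst this
    exact absurd hl (not_le.2 hi)
  subst this
  simp

/-- The first solution has received its element. -/
theorem LedgerInv.addOne_zero (hf : IsSubmodular f) (h0 : ∀ S, 0 ≤ f S) (hε : 0 < ε)
    (hε1 : ε < 1) (hτ : 0 ≤ τmin) (hO : O.card ≤ k) (hs : Sound f ε τmin s)
    (h : LedgerInv f O k ε τmin s) (ha : ∀ j, τmin ≤ s.τ j) {x : U} (hx : x ∈ s.cand f 0) :
    Finset.univ.biUnion (s.addOne 0 x).A ⊆ O ∨
      HasLedger f O k ε τmin (s.addOne 0 x) ![1, 0] := by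
  rcases h with h | h | ⟨-, j, hj⟩
  · by_cases hxO : x ∈ O
    · exact Or.inl (biUnion_addOne_subset h hxO)
    · right
      refine ((HasLedger.of_subset hf h0 hε hε1 hτ hO hs h).addOne hf hε hε1 hτ hs (ha 0)
        hx).mono fun l => ?_
      fin_cases l <;> simp [hxO]
  · right
    refine (h.addOne hf hε hε1 hτ hs (ha 0) hx).mono fun l => ?_
    fin_cases l
    · simp
    · simp only [Fin.mk_one, Matrix.cons_val_one, Matrix.cons_val_fin_one, one_ne_zero, if_false]
      split_ifs <;> norm_num
  · exact absurd (ha j) (not_le.2 hj)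

/-- The second solution receives its element. -/
theorem LedgerInv.addOne_one (hf : IsSubmodular f) (h0 : ∀ S, 0 ≤ f S) (hε : 0 < ε)
    (hε1 : ε < 1) (hτ : 0 ≤ τmin) (hO : O.card ≤ k) (hs : Sound f ε τmin s)
    (h : Finset.univ.biUnion s.A ⊆ O ∨ HasLedger f O k ε τmin s ![1, 0])
    (h1 : τmin ≤ s.τ 1) {x : U} (hx : x ∈ s.cand f 1) :
    LedgerInv f O k ε τmin (s.addOne 1 x) := by
  rcases h with h | h
  · by_cases hxO : x ∈ O
    · exact Or.inl (biUnion_addOne_subset h hxO)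
    · refine Or.inr (Or.inl (((HasLedger.of_subset hf h0 hε hε1 hτ hO hs h).addOne hf hε hε1 hτ
        hs h1 hx).mono fun l => ?_))
      fin_cases l <;> simp [hxO]
  · refine Or.inr (Or.inl ((h.addOne hf hε hε1 hτ hs h1 hx).mono fun l => ?_))
    fin_cases l
    · simp only [Fin.zero_eta, Matrix.cons_val_zero, zero_ne_one, if_false]
      split_ifs <;> norm_num
    · simp

/-- What the iteration that adds one element to each active solution guarantees, apart from the
budget. -/
structure OneEach (f : Finset U → ℝ) (O : Finset U) (k : ℕ) (ε τmin : ℝ) (s s' : State U 2) :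
    Prop where
  sound : Sound f ε τmin s'
  ledger : LedgerInv f O k ε τmin s'
  m_eq : s'.m₀ = s.m₀
  card_le : ∀ j, (s'.A j).card ≤ (s.A j).card + 1
  card_eq : ∀ j ∈ s'.I, (s'.A j).card = (s.A j).card + 1 ∧ j ∈ s.I

theorem card_addOne_self {j : Fin 2} {x : U} (hx : x ∈ s.rest) :
    ((s.addOne j x).A j).card = (s.A j).card + 1 := by
  rw [addOne_A_self, Finset.card_insert_of_notMem (mem_rest.1 hx j)]

/-- The hazard is a reduction of the threshold of 1 between the two additions, after solution 0 took
its last candidate. At that moment the slots are at least (1, 0), or the solutions lie in O, so no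
counter is negative. -/
theorem addOneEach_sound [Nonempty U] (hf : IsSubmodular f) (h0 : ∀ S, 0 ≤ f S) (hε : 0 < ε)
    (hε1 : ε < 1) (hτ : 0 ≤ τmin) (hO : O.card ≤ k) (hs : Sound f ε τmin s)
    (h : LedgerInv f O k ε τmin s) (hI : ∀ j ∈ s.I, τmin ≤ s.τ j)
    (hV : ∀ j ∈ s.I, s.V j = s.cand f j) (hne : ∀ j ∈ s.I, s.V j ≠ ∅) (N r : ℕ) :
    Prog.Sat f (fun s' _ => OneEach f O k ε τmin s s') True r
      (addOneEach ε τmin N (List.finRange 2) s) := by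
  have hlist : List.finRange 2 = [0, 1] := by decide
  rw [hlist]
  by_cases hI0 : (0 : Fin 2) ∈ s.I
  · refine addOneEach_cons_sat hε hε1 hτ hI0 (hV 0 hI0) (hI 0 hI0) (Or.inl trivial) ?_ ?_
    · intro s₁ r₁ hR h1
      rw [hR.eq_of_nonempty (hne 0 hI0)] at h1
      exact absurd (hI 0 hI0) (not_le.2 h1)
    · intro s₁ r₁ hR _ x hx
      have hs₁ := hR.eq_of_nonempty (hne 0 hI0)
      subst hs₁
      have hxr := (mem_cand.1 hx).1
      have hs₂ := hs.addOne hf (j := 0) hxr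
      have hc0 := card_addOne_self (j := 0) hxr
      have hc1 : (s₁.addOne 0 x).A 1 = s₁.A 1 := addOne_A_of_ne s₁ (by decide) x
      by_cases hI1 : (1 : Fin 2) ∈ s₁.I
      · have hV1 : (s₁.addOne 0 x).V 1 = (s₁.addOne 0 x).cand f 1 := by
          rw [cand_addOne_of_ne s₁ (by decide) x, ← hV 1 hI1]
          rfl
        have hmid := h.addOne_zero hf h0 hε hε1 hτ hO hs
          (fun j => by fin_cases j; exacts [hI 0 hI0, hI 1 hI1]) hx
        refine addOneEach_cons_sat hε hε1 hτ (s := s₁.addOne 0 x) hI1 hV1 (hI 1 hI1)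
          (Or.inl trivial) ?_ ?_
        · intro s₃ r₃ hR₃ h3
          have hU := hR₃.updated
          have hs₃ := hs₂.update hU
          have hI₃ : s₃.I = s₁.I := hU.I_eq
          refine ⟨⟨hs₃.disj, hs₃.A'_sub, hs₃.val, fun j hj => hs₃.cand j
            (Finset.mem_of_mem_erase hj), hs₃.bound, fun j hj => ?_⟩, ?_, hU.m_eq, ?_, ?_⟩
          · refine Finset.mem_erase.2 ⟨?_, hs₃.active j hj⟩
            rintro rfl
            exact absurd hj (not_le.2 h3)
          · refine Or.inr (Or.inr ⟨?_, 1, h3⟩)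
            have : HasLedger f O k ε τmin (s₁.addOne 0 x) 0 := by
              rcases hmid with hmid | hmid
              · exact HasLedger.of_subset hf h0 hε hε1 hτ hO hs₂ hmid
              · exact hmid.mono fun j => by fin_cases j <;> simp
            have h4 := this.update hε1 hτ hO (fun _ => le_rfl) hU
            exact h4
          · intro j
            simp only [hU.A_eq]
            fin_cases j
            · exact hc0.le
            · simp [hc1]
          · intro j hj
            simp only [hU.A_eq]
            fin_cases j
            · exact ⟨hc0, hI0⟩
            · simp at hj
        · intro s₃ r₃ hR₃ h3 y hy
          have hU := hR₃.updated
          have hs₃ := hs₂.update hU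
          have hyr := (mem_cand.1 hy).1
          have hmid' : Finset.univ.biUnion s₃.A ⊆ O ∨ HasLedger f O k ε τmin s₃ ![1, 0] := by
            refine hmid.imp (fun h => by rwa [hU.A_eq]) fun h =>
              h.update hε1 hτ hO (fun j => by fin_cases j <;> simp) hU
          have hd0 : ((s₃.addOne 1 y).A 0).card = (s₁.A 0).card + 1 := by
            rw [addOne_A_of_ne s₃ (by decide) y, hU.A_eq, hc0]
          have hd1 : ((s₃.addOne 1 y).A 1).card = (s₁.A 1).card + 1 := by
            rw [card_addOne_self hyr, hU.A_eq, hc1]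
          refine ⟨hs₃.addOne hf hyr, LedgerInv.addOne_one hf h0 hε hε1 hτ hO hs₃ hmid' h3 hy,
            hU.m_eq, ?_, ?_⟩
          · intro j
            fin_cases j
            exacts [hd0.le, hd1.le]
          · intro j _
            fin_cases j
            exacts [⟨hd0, hI0⟩, ⟨hd1, hI1⟩]
      · rw [addOneEach_cons_of_notMem N (s := s₁.addOne 0 x) hI1]
        have hin : s₁.τ 1 < τmin := by
          by_contra hcon
          exact hI1 (hs.active 1 (not_lt.1 hcon))
        refine ⟨hs₂, h.addOne_of_inactive hf h0 hε hε1 hτ hO hs (i := 1) (by decide) hin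
          (hI 0 hI0) hx, rfl, ?_, ?_⟩
        · intro j
          fin_cases j
          · exact hc0.le
          · simp [hc1]
        · intro j hj
          fin_cases j
          · exact ⟨hc0, hI0⟩
          · exact absurd hj hI1
  · rw [addOneEach_cons_of_notMem N hI0]
    have hin : s.τ 0 < τmin := by
      by_contra hcon
      exact hI0 (hs.active 0 (not_lt.1 hcon))
    by_cases hI1 : (1 : Fin 2) ∈ s.I
    · refine addOneEach_cons_sat hε hε1 hτ hI1 (hV 1 hI1) (hI 1 hI1) (Or.inl trivial) ?_ ?_
      · intro s₁ r₁ hR h1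
        rw [hR.eq_of_nonempty (hne 1 hI1)] at h1
        exact absurd (hI 1 hI1) (not_le.2 h1)
      · intro s₁ r₁ hR _ x hx
        have hs₁ := hR.eq_of_nonempty (hne 1 hI1)
        subst hs₁
        have hxr := (mem_cand.1 hx).1
        have hc1 := card_addOne_self (j := 1) hxr
        have hc0 : (s₁.addOne 1 x).A 0 = s₁.A 0 := addOne_A_of_ne s₁ (by decide) x
        refine ⟨hs.addOne hf hxr, h.addOne_of_inactive hf h0 hε hε1 hτ hO hs (i := 0) (by decide)
          hin (hI 1 hI1) hx, rfl, ?_, ?_⟩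
        · intro j
          fin_cases j
          · simp [hc0]
          · exact hc1.le
        · intro j hj
          fin_cases j
          · exact absurd hj hI0
          · exact ⟨hc1, hI1⟩
    · rw [addOneEach_cons_of_notMem N hI1]
      refine ⟨hs, h, rfl, fun _ => by omega, fun j hj => ?_⟩
      fin_cases j
      exacts [absurd hj hI0, absurd hj hI1]

end

end PIG

/-! ### The effect of a block -/

namespace PIG

section

variable {U : Type u} [DecidableEq U] {ℓ : ℕ}

/-- The elements that a block adds to `A j`. -/
noncomputable def State.blockSet (f : Finset U → ℝ) (ε : ℝ) (s : State U ℓ) (hI : s.I.Nonempty)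
    (v : Fin ℓ → List U) (j : Fin ℓ) : Finset U :=
  ((selection f ε (s.A j) (v j) (s.τ j) (s.blockSize hI)
    (s.blockCount f ε hI v (s.blockSize hI))).map Prod.fst).toFinset

/-- The elements that a block adds to `A' j`. -/
noncomputable def State.blockSet' (f : Finset U → ℝ) (ε : ℝ) (s : State U ℓ) (hI : s.I.Nonempty)
    (v : Fin ℓ → List U) (j : Fin ℓ) : Finset U :=
  (((selection f ε (s.A j) (v j) (s.τ j) (s.blockSize hI)
    (s.blockCount f ε hI v (s.blockSize hI))).filter fun y => y.2 ≠ some false).map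
      Prod.fst).toFinset

variable {f : Finset U → ℝ} {ε τmin : ℝ} {s : State U ℓ} {hI : s.I.Nonempty}
  {v : Fin ℓ → List U} {j : Fin ℓ}

theorem block_A (hj : j ∈ s.I) :
    (s.block f ε hI v (s.blockSize hI)).A j = s.A j ∪ s.blockSet f ε hI v j :=
  if_pos hj

theorem block_A' (hj : j ∈ s.I) :
    (s.block f ε hI v (s.blockSize hI)).A' j = s.A' j ∪ s.blockSet' f ε hI v j :=
  if_pos hj

theorem block_A_of_notMem (hj : j ∉ s.I) {n : ℕ} : (s.block f ε hI v n).A j = s.A j :=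
  if_neg hj

theorem block_A'_of_notMem (hj : j ∉ s.I) {n : ℕ} : (s.block f ε hI v n).A' j = s.A' j :=
  if_neg hj

theorem subset_block_A (j : Fin ℓ) {n : ℕ} : s.A j ⊆ (s.block f ε hI v n).A j := by
  by_cases hj : j ∈ s.I
  · have : (s.block f ε hI v n).A j = s.A j ∪ _ := if_pos hj
    rw [this]
    exact Finset.subset_union_left
  · rw [block_A_of_notMem hj]

theorem blockCount_le_goodPrefix (hj : j ∈ s.I) {n : ℕ} :
    s.blockCount f ε hI v n ≤ goodPrefix ε (marks f (s.A j) (v j) (s.τ j) n) :=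
  Finset.inf'_le _ hj

theorem blockCount_le {n : ℕ} : s.blockCount f ε hI v n ≤ n := by
  obtain ⟨j, hj⟩ := id hI
  exact (blockCount_le_goodPrefix hj).trans (goodPrefix_le ..)

theorem blockCount_le_m : s.blockCount f ε hI v (s.blockSize hI) ≤ s.m₀ :=
  blockCount_le.trans (min_le_left _ _)

theorem blockSize_le_length (hv : BlockOrder s v) (hj : j ∈ s.I) :
    s.blockSize hI ≤ (v j).length := by
  rw [hv.length j hj]
  exact (min_le_right _ _).trans (Finset.inf'_le _ hj)

theorem blockSet_subset (hv : BlockOrder s v) (hj : j ∈ s.I) :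
    s.blockSet f ε hI v j ⊆ s.V j := by
  intro x hx
  have := selection_map_fst_subset _ hx
  rw [List.mem_toFinset] at this
  exact hv.mem j hj x (List.mem_of_mem_take this)

theorem blockSet_subset_toFinset :
    s.blockSet f ε hI v j ⊆ (v j).toFinset := by
  intro x hx
  have := selection_map_fst_subset _ hx
  rw [List.mem_toFinset] at this ⊢
  exact List.mem_of_mem_take this

theorem blockSet'_subset : s.blockSet' f ε hI v j ⊆ s.blockSet f ε hI v j :=
  selection_false_subset _

theorem disjoint_blockSet (hv : BlockOrder s v) {i : Fin ℓ} (hi : i ∈ s.I) (hj : j ∈ s.I)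
    (hij : i ≠ j) : Disjoint (s.blockSet f ε hI v i) (s.blockSet f ε hI v j) :=
  (hv.disjoint i hi j hj hij).mono blockSet_subset_toFinset blockSet_subset_toFinset

theorem block_A_eq_update {s : State U 2} {hI : s.I.Nonempty} {v : Fin 2 → List U}
    (h₀ : (0 : Fin 2) ∈ s.I) (h₁ : (1 : Fin 2) ∈ s.I)
    {B : Fin 2 → Finset U}
    (hB : B 0 = s.A 0 ∪ s.blockSet f ε hI v 0) (hB1 : B 1 = s.A 1) :
    Function.update B 1 (B 1 ∪ s.blockSet f ε hI v 1) =
      (s.block f ε hI v (s.blockSize hI)).A := by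
  funext l
  fin_cases l
  · simp only [Fin.zero_eta, ne_eq, zero_ne_one, not_false_eq_true, Function.update_of_ne,
      block_A h₀, hB]
  · simp only [Fin.mk_one, Function.update_self, block_A h₁, hB1]

variable [Fintype U]

theorem BlockOrder.notMem (hv : BlockOrder s v) (hV : ∀ j ∈ s.I, s.V j = s.cand f j)
    (hj : j ∈ s.I) : ∀ x ∈ v j, x ∉ s.A j := by
  intro x hx
  have := hv.mem j hj x hx
  rw [hV j hj, mem_cand] at this
  exact mem_rest.1 this.1 j

theorem card_blockSet (hv : BlockOrder s v) (hV : ∀ j ∈ s.I, s.V j = s.cand f j) (hj : j ∈ s.I) :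
    (s.blockSet f ε hI v j).card = s.blockCount f ε hI v (s.blockSize hI) :=
  card_selection (hv.nodup j hj) (hv.notMem hV hj) (blockSize_le_length hv hj)
    (blockCount_le_goodPrefix hj)

theorem blockSet_subset_rest (hv : BlockOrder s v) (hV : ∀ j ∈ s.I, s.V j = s.cand f j)
    (hj : j ∈ s.I) : s.blockSet f ε hI v j ⊆ s.rest := by
  refine (blockSet_subset hv hj).trans ?_
  rw [hV j hj]
  exact Finset.filter_subset _ _

end

section

variable {U : Type u} [Fintype U] [DecidableEq U] {f : Finset U → ℝ} {O : Finset U} {k : ℕ}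
  {ε τmin : ℝ} {s : State U 2} {hI : s.I.Nonempty} {v : Fin 2 → List U}

theorem Sound.block (hf : IsSubmodular f) (hs : Sound f ε τmin s) (hv : BlockOrder s v)
    (hV : ∀ j ∈ s.I, s.V j = s.cand f j) :
    Sound f ε τmin (s.block f ε hI v (s.blockSize hI)) := by
  refine ⟨?_, fun j => ?_, fun j => ?_, fun j hj => ?_, hs.bound.mono hf (subset_block_A ·),
    hs.active⟩
  · have key : ∀ i j : Fin 2, i ≠ j → i ∈ s.I → Disjoint (s.blockSet f ε hI v i) (s.A j) := by
      intro i j hij hi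
      exact Finset.disjoint_left.2 fun x hx => mem_rest.1 (blockSet_subset_rest hv hV hi hx) j
    by_cases h0 : (0 : Fin 2) ∈ s.I <;> by_cases h1 : (1 : Fin 2) ∈ s.I
    · rw [block_A h0, block_A h1, Finset.disjoint_union_left, Finset.disjoint_union_right,
        Finset.disjoint_union_right]
      exact ⟨⟨hs.disj, (key 1 0 (by decide) h1).symm⟩, key 0 1 (by decide) h0,
        disjoint_blockSet hv h0 h1 (by decide)⟩
    · rw [block_A h0, block_A_of_notMem h1, Finset.disjoint_union_left]
      exact ⟨hs.disj, key 0 1 (by decide) h0⟩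
    · rw [block_A_of_notMem h0, block_A h1, Finset.disjoint_union_right]
      exact ⟨hs.disj, (key 1 0 (by decide) h1).symm⟩
    · rw [block_A_of_notMem h0, block_A_of_notMem h1]
      exact hs.disj
  · by_cases hj : j ∈ s.I
    · rw [block_A hj, block_A' hj]
      exact Finset.union_subset_union (hs.A'_sub j) blockSet'_subset
    · rw [block_A_of_notMem hj, block_A'_of_notMem hj]
      exact hs.A'_sub j
  · by_cases hj : j ∈ s.I
    · rw [block_A hj, block_A' hj]
      have h1 := selection_sub_le (ε := ε) (τ := s.τ j) (hv.nodup j hj) (hv.notMem hV hj)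
        (blockSize_le_length (hI := hI) hv hj) hf
        (s.blockCount f ε hI v (s.blockSize hI)) (hs.A'_sub j)
      have h2 := hs.val j
      simp only [State.blockSet, State.blockSet']
      linarith
    · rw [block_A_of_notMem hj, block_A'_of_notMem hj]
      exact hs.val j
  · exact (cand_anti hf (subset_block_A ·) rfl).trans (hs.cand j hj)

theorem le_value_block (hf : IsSubmodular f) (hε : 0 < ε) (hε1 : ε < 1) (hτ : 0 ≤ τmin)
    (hs : Sound f ε τmin s) (hv : BlockOrder s v) (hV : ∀ j ∈ s.I, s.V j = s.cand f j)
    {j : Fin 2} (hj : j ∈ s.I) (ha : τmin ≤ s.τ j) :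
    f (s.A' j) + (1 - ε) * s.blockCount f ε hI v (s.blockSize hI) * s.τ j ≤
      f ((s.block f ε hI v (s.blockSize hI)).A' j) := by
  rw [block_A' hj]
  exact add_le_selection (hv.nodup j hj) (hv.notMem hV hj) (blockSize_le_length hv hj) hf
    (hτ.trans ha) hε hε1 (blockCount_le_goodPrefix hj) (hs.A'_sub j)

theorem inv_sq_mul_one_sub (hε1 : ε < 1) (x : ℝ) :
    (1 - ε)⁻¹ ^ 2 * ((1 - ε) * x) = (1 - ε)⁻¹ * x := by
  have : 1 - ε ≠ 0 := by linarith
  field_simp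

/-- A block that adds elements to only one solution. -/
theorem LedgerInv.block_of_inactive (hf : IsSubmodular f) (h0 : ∀ S, 0 ≤ f S) (hε : 0 < ε)
    (hε1 : ε < 1) (hτ : 0 ≤ τmin) (hO : O.card ≤ k) (hs : Sound f ε τmin s)
    (h : LedgerInv f O k ε τmin s) (hv : BlockOrder s v)
    (hV : ∀ j ∈ s.I, s.V j = s.cand f j) {i j : Fin 2} (hij : i ≠ j) (hi : i ∉ s.I)
    (hj : j ∈ s.I) (ha : τmin ≤ s.τ j) :
    LedgerInv f O k ε τmin (s.block f ε hI v (s.blockSize hI)) := by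
  have hin : s.τ i < τmin := not_le.1 fun h => hi (hs.active i h)
  obtain ⟨c, Γ, hc, hL, hΓ⟩ := h.hasLedger hf h0 hε hε1 hτ hO hs
  have hS : Disjoint (s.blockSet f ε hI v j) (Finset.univ.biUnion s.A) := by
    refine Finset.disjoint_left.2 fun x hx => ?_
    have := blockSet_subset_rest hv hV hj hx
    simpa [State.rest] using this
  have hnew := hL.add hf hs.bound hij hS ha
  have hA : Function.update s.A j (s.A j ∪ s.blockSet f ε hI v j) =
      (s.block f ε hI v (s.blockSize hI)).A := by
    funext l
    by_cases hl : l = j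
    · subst hl
      rw [Function.update_self, block_A hj]
    · have : l = i := by omega
      subst this
      rw [Function.update_of_ne hl, block_A_of_notMem hi]
  rw [hA] at hnew
  refine Or.inr (Or.inr ⟨HasLedger.raise (b := fun l => if l = j then 0 else
    -(O ∩ s.blockSet f ε hI v j).card) ⟨_, _, fun l => ?_, hnew, ?_⟩ fun l hl => ?_, i, hin⟩)
  · have := hc l
    simp only [Pi.zero_apply] at this
    beta_reduce
    split_ifs
    · exact add_nonneg this (Nat.cast_nonneg _)
    · linarith
  · have h1 := le_value_block (hI := hI) hf hε hε1 hτ hs hv hV hj ha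
    have h2 := sum_fin_two_of_ne hij fun l => f (s.A' l)
    have h3 := sum_fin_two_of_ne hij fun l => f ((s.block f ε hI v (s.blockSize hI)).A' l)
    rw [Fin.sum_univ_two] at h2 h3
    rw [h2] at hΓ
    rw [h3, block_A'_of_notMem hi, card_blockSet hv hV hj]
    have h4 := mul_le_mul_of_nonneg_left h1 (sq_nonneg (1 - ε)⁻¹)
    rw [mul_add, mul_assoc (1 - ε), inv_sq_mul_one_sub hε1] at h4
    linarith
  · have : l = j := by
      by_contra hlj
      have : l = i := by omega
      subst this
      exact absurd hl (not_le.2 hin)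
    simp [this]

/-- A block that adds elements to both solutions, starting from a ledger with `b j` unused
slots. -/
theorem HasLedger.block (hf : IsSubmodular f) (hε : 0 < ε)
    (hε1 : ε < 1) (hτ : 0 ≤ τmin) (hs : Sound f ε τmin s) {b : Fin 2 → ℝ}
    (h : HasLedger f O k ε τmin s b) (hv : BlockOrder s v)
    (hV : ∀ j ∈ s.I, s.V j = s.cand f j) (hj : ∀ j, j ∈ s.I) (ha : ∀ j, τmin ≤ s.τ j) :
    HasLedger f O k ε τmin (s.block f ε hI v (s.blockSize hI))
      ![b 0 + s.blockCount f ε hI v (s.blockSize hI) - (O ∩ s.blockSet f ε hI v 1).card,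
        b 1 + s.blockCount f ε hI v (s.blockSize hI) - (O ∩ s.blockSet f ε hI v 0).card] := by
  obtain ⟨c, Γ, hc, hL, hΓ⟩ := h
  have hS : ∀ j, Disjoint (s.blockSet f ε hI v j) (Finset.univ.biUnion s.A) := by
    refine fun j => Finset.disjoint_left.2 fun x hx => ?_
    have := blockSet_subset_rest hv hV (hj j) hx
    simpa [State.rest] using this
  have h1 := hL.add hf hs.bound (i := 1) (by decide) (hS 0) (ha 0)
  have hb1 : GainBound f (1 - ε)⁻¹ τmin
      (Function.update s.A 0 (s.A 0 ∪ s.blockSet f ε hI v 0)) s.τ := by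
    refine hs.bound.mono hf fun l => ?_
    fin_cases l <;> simp
  have hS1 : Disjoint (s.blockSet f ε hI v 1)
      (Finset.univ.biUnion (Function.update s.A 0 (s.A 0 ∪ s.blockSet f ε hI v 0))) := by
    rw [biUnion_update_union, Finset.disjoint_union_right]
    exact ⟨hS 1, disjoint_blockSet hv (hj 1) (hj 0) (by decide)⟩
  have h2 := h1.add hf hb1 (i := 0) (j := 1) (by decide) hS1 (ha 1)
  rw [block_A_eq_update (hj 0) (hj 1) (by simp) (by simp)] at h2
  refine ⟨_, _, fun l => ?_, h2, ?_⟩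
  · rw [card_blockSet hv hV (hj 0), card_blockSet hv hV (hj 1)]
    have := hc l
    fin_cases l
    · simp at this ⊢
      linarith
    · simp at this ⊢
      linarith
  · rw [card_blockSet hv hV (hj 0), card_blockSet hv hV (hj 1)]
    have e0 := mul_le_mul_of_nonneg_left
      (le_value_block (hI := hI) hf hε hε1 hτ hs hv hV (hj 0) (ha 0)) (sq_nonneg (1 - ε)⁻¹)
    have e1 := mul_le_mul_of_nonneg_left
      (le_value_block (hI := hI) hf hε hε1 hτ hs hv hV (hj 1) (ha 1)) (sq_nonneg (1 - ε)⁻¹)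
    rw [mul_add, mul_assoc (1 - ε), inv_sq_mul_one_sub hε1] at e0 e1
    linarith

theorem card_inter_blockSet_le (hv : BlockOrder s v) (hV : ∀ j ∈ s.I, s.V j = s.cand f j)
    {j : Fin 2} (hj : j ∈ s.I) :
    (O ∩ s.blockSet f ε hI v j).card ≤ s.blockCount f ε hI v (s.blockSize hI) := by
  rw [← card_blockSet (hI := hI) hv hV hj]
  exact Finset.card_le_card Finset.inter_subset_right

/-- A block whose elements for the first solution all belong to `O`, as do all the elements of the
solutions before. The first element of the block is treated separately. -/
theorem HasLedger.block_of_subset (hf : IsSubmodular f) (h0 : ∀ S, 0 ≤ f S) (hε : 0 < ε)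
    (hε1 : ε < 1) (hτ : 0 ≤ τmin) (hO : O.card ≤ k) (hs : Sound f ε τmin s)
    (h : Finset.univ.biUnion s.A ⊆ O) (hv : BlockOrder s v)
    (hV : ∀ j ∈ s.I, s.V j = s.cand f j) (hj : ∀ j, j ∈ s.I) (ha : ∀ j, τmin ≤ s.τ j)
    (hα : s.blockSet f ε hI v 0 ⊆ O)
    (hβ : (O ∩ s.blockSet f ε hI v 1).card < s.blockCount f ε hI v (s.blockSize hI)) :
    HasLedger f O k ε τmin (s.block f ε hI v (s.blockSize hI)) ![0, 1] := by
  have hl := one_le_inv_one_sub hε hε1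
  have hl0 := zero_le_one.trans hl
  have hi1 : 1 ≤ s.blockCount f ε hI v (s.blockSize hI) := by omega
  have hS : ∀ j, Disjoint (s.blockSet f ε hI v j) (Finset.univ.biUnion s.A) := by
    refine fun j => Finset.disjoint_left.2 fun x hx => ?_
    have := blockSet_subset_rest hv hV (hj j) hx
    simpa [State.rest] using this
  have hlen := blockSize_le_length (hI := hI) hv (hj 0)
  have hgp := blockCount_le_goodPrefix (f := f) (ε := ε) (hI := hI) (v := v)
    (n := s.blockSize hI) (hj 0)
  obtain ⟨x, w, hxw⟩ : ∃ x w, v 0 = x :: w := by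
    refine List.exists_cons_of_length_pos ?_
    have := goodPrefix_le f ε (s.A 0) (v 0) (s.τ 0) (s.blockSize hI)
    omega
  have hxc : x ∈ s.cand f 0 := by
    rw [← hV 0 (hj 0)]
    exact hv.mem 0 (hj 0) x (by simp [hxw])
  have hxg := (mem_cand.1 hxc).2
  have hn := hv.nodup 0 (hj 0)
  have hnA := hv.notMem hV (hj 0)
  rw [hxw] at hlen hn hnA hgp
  have hxS : x ∈ s.blockSet f ε hI v 0 := by
    have := mem_selection_head (w := w) hxg (hi1.trans hgp) hi1
    rw [State.blockSet, List.mem_toFinset, hxw]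
    exact List.mem_map.2 ⟨_, this, rfl⟩
  have hval := insert_add_le_selection hf (hτ.trans (ha 0)) hε hε1 hn hnA hlen hgp hi1 hxg
    (hs.A'_sub 0)
  rw [← hxw] at hval
  change _ ≤ f (s.A' 0 ∪ s.blockSet' f ε hI v 0) at hval
  rw [← block_A' (hj 0)] at hval
  have hxval := le_value_addOne hf hs hxc
  have hx2 : f (insert x (s.A 0)) ≤ f (insert x (s.A' 0)) := by
    have e1 := hf (hs.A'_sub 0) x (mem_rest.1 (mem_cand.1 hxc).1 0)
    have e2 := hs.val 0
    linarith
  have hs₁ := hs.addOne hf (j := 0) (mem_cand.1 hxc).1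
  -- The trivial ledger is opened after x alone has joined A 0, still inside O. The other i - 1
  -- elements of the first block cost index 1 that many slots, and its own block returns i, which
  -- leaves exactly one. Starting before x would leave none.
  have hL := Ledger.of_subset (τ := s.τ) hf h0 hl0 hτ hO hs₁.disj
    (biUnion_addOne_subset h (hα hxS))
  set i := s.blockCount f ε hI v (s.blockSize hI) with hi
  set B := (s.addOne 0 x).A with hB
  have hB0 : B 0 = s.A 0 ∪ {x} := by
    rw [hB, addOne_A_self, Finset.union_comm]
    rfl
  have hB1 : B 1 = s.A 1 := addOne_A_of_ne s (by decide) x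
  have hBU : Finset.univ.biUnion B = Finset.univ.biUnion s.A ∪ {x} := by
    rw [hB, addOne_A, biUnion_update_union]
  set S₀ := s.blockSet f ε hI v 0 \ {x} with hS₀
  have hSd : Disjoint S₀ (Finset.univ.biUnion B) := by
    rw [hBU, Finset.disjoint_union_right]
    exact ⟨(hS 0).mono_left Finset.sdiff_subset, Finset.sdiff_disjoint⟩
  have hS₀c : (S₀.card : ℝ) = i - 1 := by
    have e : S₀.card + 1 = i := by
      rw [hS₀, Finset.sdiff_singleton_eq_erase, Finset.card_erase_add_one hxS,
        card_blockSet hv hV (hj 0)]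
    rw [← e]
    push_cast
    ring
  have hOS₀ : (O ∩ S₀).card = S₀.card := by
    rw [Finset.inter_eq_right.2 (Finset.sdiff_subset.trans hα)]
  have h1 := hL.add hf hs₁.bound (i := 1) (j := 0) (by decide) hSd (ha 0)
  have hb1 : GainBound f (1 - ε)⁻¹ τmin (Function.update B 0 (B 0 ∪ S₀)) s.τ := by
    refine hs₁.bound.mono hf fun l => ?_
    fin_cases l <;> simp [hB]
  have hS1 : Disjoint (s.blockSet f ε hI v 1)
      (Finset.univ.biUnion (Function.update B 0 (B 0 ∪ S₀))) := by
    have hd := disjoint_blockSet (f := f) (ε := ε) (hI := hI) hv (hj 1) (hj 0) (by decide)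
    rw [biUnion_update_union, hBU, Finset.disjoint_union_right, Finset.disjoint_union_right]
    exact ⟨⟨hS 1, hd.mono_right (Finset.singleton_subset_iff.2 hxS)⟩,
      hd.mono_right Finset.sdiff_subset⟩
  have h2 := h1.add hf hb1 (i := 0) (j := 1) (by decide) hS1 (ha 1)
  rw [block_A_eq_update (hj 0) (hj 1) ?_ (by simpa using hB1)] at h2
  · refine ⟨_, _, fun l => ?_, h2, ?_⟩
    · rw [card_blockSet hv hV (hj 1), hOS₀, hS₀c, ← hi]
      have : ((O ∩ s.blockSet f ε hI v 1).card : ℝ) + 1 ≤ i := by exact_mod_cast hβ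
      fin_cases l
      · simp
        linarith
      · simp
    · rw [card_blockSet hv hV (hj 1), hS₀c, ← hi, hB1, hB0]
      have e0 := mul_le_mul_of_nonneg_left hval (sq_nonneg (1 - ε)⁻¹)
      have e1 := mul_le_mul_of_nonneg_left
        (le_value_block (hI := hI) hf hε hε1 hτ hs hv hV (hj 1) (ha 1)) (sq_nonneg (1 - ε)⁻¹)
      rw [mul_add, mul_assoc (1 - ε), inv_sq_mul_one_sub hε1] at e1
      -- The trivial ledger values the first element at f (insert x (A 0)) instead of one slot
      -- price; splitting off f (insert x (A' 0)) - τ 0, which is nonnegative, leaves the full i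
      -- slots to compare.
      have e2 : (1 - ε)⁻¹ ^ 2 * (f (insert x (s.A' 0)) + ((1 - ε) * i - 1) * s.τ 0) =
          (1 - ε)⁻¹ ^ 2 * (f (insert x (s.A' 0)) - s.τ 0) + (1 - ε)⁻¹ * (i * s.τ 0) := by
        rw [← inv_sq_mul_one_sub hε1]
        ring
      rw [e2] at e0
      have e3 : s.A 0 ∪ {x} = insert x (s.A 0) := by
        rw [Finset.union_comm]
        rfl
      rw [e3]
      have e4 : 0 ≤ f (insert x (s.A' 0)) - s.τ 0 := by linarith [h0 (s.A' 0)]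
      have e5 : 1 ≤ (1 - ε)⁻¹ ^ 2 := one_le_pow₀ hl
      have e6 : 1 * s.τ 0 ≤ (1 - ε)⁻¹ * s.τ 0 :=
        mul_le_mul_of_nonneg_right hl (hτ.trans (ha 0))
      have e7 : 1 * (f (insert x (s.A' 0)) - s.τ 0) ≤
          (1 - ε)⁻¹ ^ 2 * (f (insert x (s.A' 0)) - s.τ 0) := mul_le_mul_of_nonneg_right e5 e4
      have e8 : 1 * f (s.A' 1) ≤ (1 - ε)⁻¹ ^ 2 * f (s.A' 1) :=
        mul_le_mul_of_nonneg_right e5 (h0 _)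
      have e9 := hs.val 1
      linarith
  · rw [Function.update_self, hB0, hS₀, Finset.union_assoc, Finset.union_sdiff_of_subset
      (Finset.singleton_subset_iff.2 hxS)]

/-- Once the slots are at least (0, 1) they stay so, because each index receives i* slots and gives
away at most i*. From inside O: if the block of 0 leaves O, index 1 keeps a slot directly; if only
the block of 1 leaves O, its first element needs special treatment; otherwise the solutions remain
in O. -/
theorem LedgerInv.block_of_active (hf : IsSubmodular f) (h0 : ∀ S, 0 ≤ f S) (hε : 0 < ε)
    (hε1 : ε < 1) (hτ : 0 ≤ τmin) (hO : O.card ≤ k) (hs : Sound f ε τmin s)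
    (h : LedgerInv f O k ε τmin s) (hv : BlockOrder s v)
    (hV : ∀ j ∈ s.I, s.V j = s.cand f j) (hj : ∀ j, j ∈ s.I) (ha : ∀ j, τmin ≤ s.τ j) :
    LedgerInv f O k ε τmin (s.block f ε hI v (s.blockSize hI)) := by
  have hc0 := card_inter_blockSet_le (O := O) (ε := ε) (hI := hI) hv hV (hj 0)
  have hc1 := card_inter_blockSet_le (O := O) (ε := ε) (hI := hI) hv hV (hj 1)
  have hc0' : ((O ∩ s.blockSet f ε hI v 0).card : ℝ) ≤ s.blockCount f ε hI v (s.blockSize hI) := by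
    exact_mod_cast hc0
  have hc1' : ((O ∩ s.blockSet f ε hI v 1).card : ℝ) ≤ s.blockCount f ε hI v (s.blockSize hI) := by
    exact_mod_cast hc1
  have hsub : ∀ j, s.blockCount f ε hI v (s.blockSize hI) ≤ (O ∩ s.blockSet f ε hI v j).card →
      s.blockSet f ε hI v j ⊆ O := by
    intro j hle
    rw [← card_blockSet (hI := hI) hv hV (hj j)] at hle
    exact Finset.inter_eq_right.1 (Finset.eq_of_subset_of_card_le Finset.inter_subset_right hle)
  rcases h with h | h | ⟨-, j, hjlt⟩
  · rcases hc0.lt_or_eq with hα | hα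
    · refine Or.inr (Or.inl (((HasLedger.of_subset hf h0 hε hε1 hτ hO hs h).block hf hε hε1 hτ hs
        hv hV hj ha).mono fun l => ?_))
      have hα' : ((O ∩ s.blockSet f ε hI v 0).card : ℝ) + 1 ≤
          s.blockCount f ε hI v (s.blockSize hI) := by exact_mod_cast hα
      fin_cases l
      · simpa using hc1'
      · simp
        linarith
    · rcases hc1.lt_or_eq with hβ | hβ
      · exact Or.inr (Or.inl (HasLedger.block_of_subset hf h0 hε hε1 hτ hO hs h hv hV hj ha
          (hsub 0 hα.ge) hβ))
      · left
        intro x hx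
        obtain ⟨l, -, hl⟩ := Finset.mem_biUnion.1 hx
        rw [block_A (hj l), Finset.mem_union] at hl
        rcases hl with hl | hl
        · exact h (subset_biUnion_self s.A l hl)
        · fin_cases l
          exacts [hsub 0 hα.ge hl, hsub 1 hβ.ge hl]
  · refine Or.inr (Or.inl ((h.block hf hε hε1 hτ hs hv hV hj ha).mono fun l => ?_))
    fin_cases l
    · simpa using hc1'
    · simp
      linarith
  · exact absurd (ha j) (not_le.2 hjlt)

theorem LedgerInv.block (hf : IsSubmodular f) (h0 : ∀ S, 0 ≤ f S) (hε : 0 < ε)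
    (hε1 : ε < 1) (hτ : 0 ≤ τmin) (hO : O.card ≤ k) (hs : Sound f ε τmin s)
    (h : LedgerInv f O k ε τmin s) (hv : BlockOrder s v)
    (hV : ∀ j ∈ s.I, s.V j = s.cand f j) (ha : ∀ j ∈ s.I, τmin ≤ s.τ j) :
    LedgerInv f O k ε τmin (s.block f ε hI v (s.blockSize hI)) := by
  by_cases h₀ : (0 : Fin 2) ∈ s.I <;> by_cases h₁ : (1 : Fin 2) ∈ s.I
  · have hj : ∀ j, j ∈ s.I := fun j => by fin_cases j; exacts [h₀, h₁]
    exact h.block_of_active hf h0 hε hε1 hτ hO hs hv hV hj fun j => ha j (hj j)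
  · exact h.block_of_inactive hf h0 hε hε1 hτ hO hs hv hV (i := 1) (by decide) h₁ h₀ (ha 0 h₀)
  · exact h.block_of_inactive hf h0 hε hε1 hτ hO hs hv hV (i := 0) (by decide) h₀ h₁ (ha 1 h₁)
  · obtain ⟨j, hj⟩ := id hI
    fin_cases j
    exacts [absurd hj h₀, absurd hj h₁]

/-! ### The main loop -/

/-- The invariant of the main loop. -/
structure LoopInv (f : Finset U → ℝ) (O : Finset U) (k : ℕ) (ε τmin : ℝ) (s : State U 2) :
    Prop where
  sound : Sound f ε τmin s
  ledger : LedgerInv f O k ε τmin s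
  card_le : ∀ j, (s.A j).card + s.m₀ ≤ k
  le_card : ∀ j ∈ s.I, k ≤ (s.A j).card + s.m₀

/-- The guarantee for the result. -/
def Guarantee (f : Finset U → ℝ) (O : Finset U) (k : ℕ) (ε : ℝ) (A' : Fin 2 → Finset U) : Prop :=
  (A' 0).card ≤ k ∧ (A' 1).card ≤ k ∧ (1 / 4 - ε) * f O ≤ max (f (A' 0)) (f (A' 1))

theorem LoopInv.guarantee (hf : IsSubmodular f) (h0 : ∀ S, 0 ≤ f S) (hε : 0 < ε) (hε1 : ε < 1)
    (hτ : 0 ≤ τmin) (hkτ : k * τmin ≤ ε * f O) (hO : O.card ≤ k) (h : LoopInv f O k ε τmin s)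
    (hend : s.I = ∅ ∨ s.m₀ = 0) : Guarantee f O k ε s.A' := by
  have hcard : ∀ j, (s.A' j).card ≤ k := fun j =>
    (Finset.card_le_card (h.sound.A'_sub j)).trans (by have := h.card_le j; omega)
  refine ⟨hcard 0, hcard 1, h.ledger.final hf h0 hε hε1 hτ hkτ hO h.sound fun j hj => ?_⟩
  have hjI := h.sound.active j hj
  rcases hend with hend | hend
  · simp [hend] at hjI
  · have := h.le_card j hjI
    omega

/-- Partial correctness only: cutoffs are admitted, so the iteration bounds and the positivity of
τmin play no role. -/
theorem mainLoop_sound [Nonempty U] (hf : IsSubmodular f) (h0 : ∀ S, 0 ≤ f S) (hε : 0 < ε)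
    (hε1 : ε < 1) (hτ : 0 ≤ τmin) (hkτ : k * τmin ≤ ε * f O) (hO : O.card ≤ k) (N : ℕ) :
    ∀ (n : ℕ) (s : State U 2) (r : ℕ), LoopInv f O k ε τmin s →
      Prog.Sat f (fun s' _ => Guarantee f O k ε s'.A') True r (mainLoop ε τmin N n s)
  | 0, _, _, _ => trivial
  | n + 1, s, r, h => by
      classical
      rw [mainLoop]
      by_cases hend : s.I = ∅ ∨ s.m₀ = 0
      · rw [if_pos hend]
        exact h.guarantee hf h0 hε hε1 hτ hkτ hO hend
      rw [if_neg hend]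
      push Not at hend
      refine Prog.Sat.bind ?_ (update_sat hε hε1 hτ N s.I s r h.sound.cand (Or.inl trivial))
      rintro s₁ r₁ ⟨hU, -⟩
      set s₂ : State U 2 := { s₁ with I := s₁.I.filter fun j => ¬ s₁.τ j < τmin } with hs₂
      have hU1 := h.sound.update hU
      have hI₂ : ∀ j, j ∈ s₂.I ↔ j ∈ s.I ∧ τmin ≤ s₁.τ j := by
        intro j
        simp [hs₂, hU.I_eq]
      have hs : Sound f ε τmin s₂ := by
        refine ⟨hU1.disj, hU1.A'_sub, hU1.val, fun j hj => ?_, hU1.bound, fun j hj => ?_⟩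
        · exact hU1.cand j (by rw [hU.I_eq]; exact ((hI₂ j).1 hj).1)
        · exact (hI₂ j).2 ⟨hU.I_eq ▸ hU1.active j hj, hj⟩
      have hL₁ := h.ledger.update hε1 hτ hO hU
      have hL : LedgerInv f O k ε τmin s₂ := hL₁
      have hm : s₂.m₀ = s.m₀ := hU.m_eq
      have hA : s₂.A = s.A := hU.A_eq
      have hinv : LoopInv f O k ε τmin s₂ := by
        refine ⟨hs, hL, fun j => ?_, fun j hj => ?_⟩
        · rw [hm, hA]
          exact h.card_le j
        · rw [hm, hA]
          exact h.le_card j ((hI₂ j).1 hj).1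
      have hact : ∀ j ∈ s₂.I, τmin ≤ s₂.τ j := fun j hj => ((hI₂ j).1 hj).2
      have hV : ∀ j ∈ s₂.I, s₂.V j = s₂.cand f j := fun j hj => hU.V_eq j ((hI₂ j).1 hj).1
      have hne : ∀ j ∈ s₂.I, s₂.V j ≠ ∅ := fun j hj =>
        (hU.done j ((hI₂ j).1 hj).1).resolve_right (not_lt.2 (hact j hj))
      have hm1 : 1 ≤ s₂.m₀ := by
        rw [hm]
        exact Nat.one_le_iff_ne_zero.2 hend.2
      clear_value s₂
      dsimp only
      split_ifs with hI hsmall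
      · refine Prog.Sat.bind ?_ (addOneEach_sound hf h0 hε hε1 hτ hO hs hL hact hV hne N r₁)
        intro s₃ r₃ h₃
        refine mainLoop_sound hf h0 hε hε1 hτ hkτ hO N n _ r₃ ⟨?_, h₃.ledger, fun j => ?_,
          fun j hj => ?_⟩
        · exact ⟨h₃.sound.disj, h₃.sound.A'_sub, h₃.sound.val, h₃.sound.cand, h₃.sound.bound,
            h₃.sound.active⟩
        · have e1 := h₃.card_le j
          have e2 := h₃.m_eq
          have e3 := hinv.card_le j
          simp only
          omega
        · have e1 := h₃.card_eq j hj
          have e2 := h₃.m_eq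
          have e3 := hinv.le_card j e1.2
          simp only
          omega
      · refine Prog.Sat.bind (φ := fun s' _ => LoopInv f O k ε τmin s')
          (fun s' r' h' => mainLoop_sound hf h0 hε hε1 hτ hkτ hO N n s' r' h')
          (addBlocks_sat s₂ hI r₁ fun v hv => ?_)
        have hle := blockCount_le_m (f := f) (ε := ε) (s := s₂) (hI := hI) (v := v)
        have hm' : (s₂.block f ε hI v (s₂.blockSize hI)).m₀ =
          s₂.m₀ - s₂.blockCount f ε hI v (s₂.blockSize hI) := rfl
        have hcardA : ∀ j ∈ s₂.I, ((s₂.block f ε hI v (s₂.blockSize hI)).A j).card =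
            (s₂.A j).card + s₂.blockCount f ε hI v (s₂.blockSize hI) := by
          intro j hj
          rw [block_A hj, Finset.card_union_of_disjoint, card_blockSet hv hV hj]
          exact Finset.disjoint_right.2 fun x hx =>
            mem_rest.1 (blockSet_subset_rest hv hV hj hx) j
        refine ⟨hs.block hf hv hV, hL.block hf h0 hε hε1 hτ hO hs hv hV hact, fun j => ?_,
          fun j hj => ?_⟩
        · have e3 := hinv.card_le j
          by_cases hj : j ∈ s₂.I
          · have := hcardA j hj
            omega
          · rw [block_A_of_notMem hj]
            omega
        · have e3 := hinv.le_card j hj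
          have := hcardA j hj
          omega
      · exact hinv.guarantee hf h0 hε hε1 hτ hkτ hO (Or.inl (Finset.not_nonempty_iff_eq_empty.1 hI))

end

end PIG

/-! ### The potential decreases -/

namespace PIG

section

variable {U : Type u} [Fintype U] [DecidableEq U] {ℓ : ℕ} {f : Finset U → ℝ} {ε τmin : ℝ}
  {s s' : State U ℓ} {c : Prop}

/-- The candidate sets are complete, and all indices with a large threshold are active. -/
structure Tidy (f : Finset U → ℝ) (τmin : ℝ) (s : State U ℓ) : Prop where
  cand : ∀ j ∈ s.I, s.cand f j ⊆ s.V j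
  active : ∀ j, τmin ≤ s.τ j → j ∈ s.I

theorem indexPot_anti (hf : IsSubmodular f) (hε : 0 < ε) (hA : ∀ j, s.A j ⊆ s'.A j) {j : Fin ℓ}
    (hτ : s'.τ j = s.τ j) : s'.indexPot f ε τmin j ≤ s.indexPot f ε τmin j := by
  have := logSize_mono hε (Finset.card_le_card (cand_anti hf hA hτ))
  rw [State.indexPot, State.indexPot, hτ]
  split_ifs
  · omega
  · exact le_rfl

theorem pot_anti (hf : IsSubmodular f) (hε : 0 < ε) (hA : ∀ j, s.A j ⊆ s'.A j)
    (hτ : s'.τ = s.τ) (hm : s'.m₀ ≤ s.m₀) : s'.pot f ε τmin ≤ s.pot f ε τmin :=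
  add_le_add (Finset.sum_le_sum fun j _ => indexPot_anti hf hε hA (by rw [hτ]))
    (Nat.size_le_size hm)

/-- The potential decreases if an active index loses a fraction `ε / 64` of its candidates. -/
theorem pot_succ_le_of_card (hf : IsSubmodular f) (hε : 0 < ε) (hε1 : ε < 1)
    (hA : ∀ j, s.A j ⊆ s'.A j) (hτ : s'.τ = s.τ) (hm : s'.m₀ ≤ s.m₀) {i : Fin ℓ}
    (hi : τmin ≤ s.τ i) (hne : s.cand f i ≠ ∅)
    (hcard : ((s'.cand f i).card : ℝ) ≤ (1 - ε / 64) * (s.cand f i).card) :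
    s'.pot f ε τmin + 1 ≤ s.pot f ε τmin := by
  have h1 : s'.indexPot f ε τmin i + 1 ≤ s.indexPot f ε τmin i := by
    have := logSize_succ_le hε hε1 (Finset.card_ne_zero.2 (Finset.nonempty_iff_ne_empty.2 hne))
      hcard
    rw [State.indexPot, State.indexPot, hτ, if_pos hi, if_pos hi]
    omega
  have h2 := Finset.sum_le_sum fun j (_ : j ∈ Finset.univ.erase i) =>
    indexPot_anti (τmin := τmin) (j := j) hf hε hA (by rw [hτ])
  have e1 := Finset.add_sum_erase Finset.univ (s'.indexPot f ε τmin) (Finset.mem_univ i)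
  have e2 := Finset.add_sum_erase Finset.univ (s.indexPot f ε τmin) (Finset.mem_univ i)
  have e3 := Nat.size_le_size hm
  rw [State.pot, State.pot]
  omega

/-- The potential decreases if the budget is halved. -/
theorem pot_succ_le_of_m (hf : IsSubmodular f) (hε : 0 < ε) (hA : ∀ j, s.A j ⊆ s'.A j)
    (hτ : s'.τ = s.τ) (hm0 : s.m₀ ≠ 0) (hm : 2 * s'.m₀ ≤ s.m₀) :
    s'.pot f ε τmin + 1 ≤ s.pot f ε τmin := by
  have h1 := Finset.sum_le_sum fun j (_ : j ∈ Finset.univ) =>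
    indexPot_anti (τmin := τmin) (j := j) hf hε hA (by rw [hτ])
  have h2 : Nat.size s'.m₀ + 1 ≤ Nat.size s.m₀ := by
    by_cases h0 : s'.m₀ = 0
    · rw [h0, Nat.size_zero]
      exact Nat.size_pos.2 (Nat.pos_of_ne_zero hm0)
    -- Doubling a positive number adds exactly one binary digit.
    · have : Nat.size (2 * s'.m₀) = Nat.size s'.m₀ + 1 := by
        have := Nat.size_bit (b := false) (n := s'.m₀) (by simpa [Nat.bit] using h0)
        simpa [Nat.bit] using this
      rw [← this]
      exact Nat.size_le_size hm
  rw [State.pot, State.pot]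
  omega

theorem addOne_τ (s : State U ℓ) (j : Fin ℓ) (x : U) : (s.addOne j x).τ = s.τ := rfl

theorem Tidy.update {J : Finset (Fin ℓ)} (h : Tidy f τmin s) (hU : Updated f ε τmin J s s') :
    Tidy f τmin s' := by
  refine ⟨fun j hj => ?_, fun j hj => by
    rw [hU.I_eq]; exact h.active j (hj.trans (hU.τ_le j))⟩
  by_cases hjJ : j ∈ J
  · rw [hU.V_eq j hjJ]
  · rw [hU.off_V j hjJ]
    refine subset_trans (fun x hx => ?_) (h.cand j (hU.I_eq ▸ hj))
    rw [mem_cand, mem_rest, hU.A_eq, hU.off_τ j hjJ] at hx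
    rwa [mem_cand, mem_rest]

theorem Tidy.addOne (hf : IsSubmodular f) (h : Tidy f τmin s) (j : Fin ℓ) (x : U) :
    Tidy f τmin (s.addOne j x) :=
  ⟨fun i hi => (cand_addOne_subset hf s x).trans (Finset.erase_subset_erase x (h.cand i hi)),
    h.active⟩

theorem Tidy.erase (h : Tidy f τmin s) {j : Fin ℓ} (hj : s.τ j < τmin) :
    Tidy f τmin { s with I := s.I.erase j } := by
  refine ⟨fun i hi => h.cand i (Finset.mem_of_mem_erase hi), fun i hi => ?_⟩
  refine Finset.mem_erase.2 ⟨?_, h.active i hi⟩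
  rintro rfl
  exact absurd hi (not_le.2 hj)

theorem cand_eq_of_updated {J : Finset (Fin ℓ)} (hU : Updated f ε τmin J s s') {j : Fin ℓ}
    (hj : j ∉ J) : s'.cand f j = s.cand f j := by
  ext x
  rw [mem_cand, mem_cand, mem_rest, mem_rest, hU.A_eq, hU.off_τ j hj]

/-- An active index with at most 3 candidates either still has one when its turn comes, and using it
removes at least a third of them, or has lost all of them, and then its threshold falls. In both
cases the potential drops by at least one more than the rounds used. -/
theorem addOneEach_sat [Nonempty U] (hf : IsSubmodular f) (hε : 0 < ε) (hε1 : ε < 1)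
    (hτ : 0 < τmin) (N : ℕ) :
    ∀ (js : List (Fin ℓ)) (s : State U ℓ) (r : ℕ), js.Nodup → Tidy f τmin s →
      (∀ j ∈ js, j ∈ s.I → s.V j = s.cand f j ∧ τmin ≤ s.τ j) →
      (c ∨ s.pot f ε τmin < N) →
      Prog.Sat f (fun s' r' => Tidy f τmin s' ∧ s'.m₀ = s.m₀ ∧ r ≤ r' ∧
        s'.pot f ε τmin + r' ≤ s.pot f ε τmin + r ∧
        ((∃ i ∈ js, i ∈ s.I ∧ (s.V i).card ≤ 3) →
          s'.pot f ε τmin + r' + 1 ≤ s.pot f ε τmin + r)) c r (addOneEach ε τmin N js s)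
  | [], s, r, _, ht, _, _ => ⟨ht, rfl, le_rfl, le_rfl, by simp⟩
  | j :: js, s, r, hn, ht, hV, hc => by
      rw [List.nodup_cons] at hn
      by_cases hjI : j ∈ s.I
      swap
      · rw [addOneEach_cons_of_notMem N hjI]
        refine Prog.Sat.mono ?_ id (addOneEach_sat hf hε hε1 hτ N js s r hn.2 ht
          (fun i hi => hV i (List.mem_cons_of_mem _ hi)) hc)
        rintro s' r' ⟨h1, h2, h0, h3, h4⟩
        refine ⟨h1, h2, h0, h3, ?_⟩
        rintro ⟨i, hi, hiI, hi3⟩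
        rcases List.mem_cons.1 hi with rfl | hi
        · exact absurd hiI hjI
        · exact h4 ⟨i, hi, hiI, hi3⟩
      obtain ⟨hVj, hτj⟩ := hV j (by simp) hjI
      refine addOneEach_cons_sat hε hε1 hτ.le hjI hVj hτj (hc.imp_right fun h => ⟨hτ, h⟩) ?_ ?_
      · intro s₁ r₁ hR hlt
        have hU := hR.updated
        have hV0 : s.V j = ∅ := by
          by_contra hne
          rw [hR.eq_of_nonempty hne] at hlt
          exact absurd hτj (not_le.2 hlt)
        have hpot := hR.pot_lt hτ hV0
        have hr := hR.r_le
        refine Prog.Sat.mono ?_ id (addOneEach_sat hf hε hε1 hτ N js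
          { s₁ with I := s₁.I.erase j } r₁ hn.2 ((ht.update hU).erase hlt) ?_ ?_)
        · rintro s' r' ⟨h1, h2, h0, h3, -⟩
          have h3' : s'.pot f ε τmin + r' ≤ s₁.pot f ε τmin + r₁ := h3
          exact ⟨h1, h2.trans hU.m_eq, by omega, by omega, fun _ => by omega⟩
        · intro i hi hiI
          have hij : i ∉ ({j} : Finset (Fin ℓ)) := by
            rw [Finset.mem_singleton]
            rintro rfl
            exact hn.1 hi
          have hiI' : i ∈ s.I := hU.I_eq ▸ Finset.mem_of_mem_erase hiI
          have := hV i (List.mem_cons_of_mem _ hi) hiI'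
          refine ⟨?_, ?_⟩
          · change s₁.V i = s₁.cand f i
            rw [hU.off_V i hij, cand_eq_of_updated hU hij, this.1]
          · change τmin ≤ s₁.τ i
            rw [hU.off_τ i hij]
            exact this.2
        · refine hc.imp_right fun h => ?_
          have : s₁.pot f ε τmin < N := by omega
          exact this
      · intro s₁ r₁ hR hle x hx
        have hU := hR.updated
        have hpot := hR.pot_le hτ
        have hr := hR.r_le
        have hpot₂ : (s₁.addOne j x).pot f ε τmin ≤ s₁.pot f ε τmin :=
          pot_anti hf hε (subset_addOne s₁ j x) rfl le_rfl
        refine Prog.Sat.mono ?_ id (addOneEach_sat hf hε hε1 hτ N js (s₁.addOne j x) r₁ hn.2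
          ((ht.update hU).addOne hf j x) ?_ ?_)
        · rintro s' r' ⟨h1, h2, h0, h3, h4⟩
          refine ⟨h1, h2.trans hU.m_eq, by omega, by omega, ?_⟩
          rintro ⟨i, hi, hiI, hi3⟩
          by_cases hV0 : s.V j = ∅
          · have := hR.pot_lt hτ hV0
            omega
          have hs₁ := hR.eq_of_nonempty hV0
          subst hs₁
          rcases List.mem_cons.1 hi with rfl | hi
          · rw [hVj] at hi3 hV0
            have hcard := Finset.card_le_card (cand_addOne_subset (i := i) (j := i) hf s₁ x)
            rw [Finset.card_erase_of_mem hx] at hcard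
            have hpos := Finset.card_pos.2 ⟨x, hx⟩
            have := pot_succ_le_of_card (τmin := τmin) hf hε hε1 (subset_addOne s₁ i x) rfl le_rfl
              hτj hV0 (by
                have e1 : (((s₁.addOne i x).cand f i).card : ℝ) + 1 ≤ (s₁.cand f i).card := by
                  exact_mod_cast (by omega)
                have e2 : ((s₁.cand f i).card : ℝ) ≤ 3 := by exact_mod_cast hi3
                nlinarith)
            omega
          · have := h4 ⟨i, hi, hiI, (Finset.card_le_card (Finset.erase_subset _ _)).trans hi3⟩
            omega
        · intro i hi hiI
          have hij : i ≠ j := by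
            rintro rfl
            exact hn.1 hi
          have hij' : i ∉ ({j} : Finset (Fin ℓ)) := by rwa [Finset.mem_singleton]
          have hiI' : i ∈ s.I := hU.I_eq ▸ hiI
          have := hV i (List.mem_cons_of_mem _ hi) hiI'
          refine ⟨?_, ?_⟩
          · rw [cand_addOne_of_ne s₁ hij, cand_eq_of_updated hU hij', ← this.1, ← hU.off_V i hij']
            rfl
          · rw [addOne_τ, hU.off_τ i hij']
            exact this.2
        · exact hc.imp_right fun h => by omega

theorem two_mul_le_card_div {n : ℕ} (hI : s.I.Nonempty) (h : 2 * ℓ ≤ n) :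
    2 ≤ n / s.I.card := by
  have h1 : s.I.card ≤ ℓ := by simpa using Finset.card_le_univ s.I
  rw [Nat.le_div_iff_mul_le (Finset.card_pos.2 hI)]
  omega

theorem one_le_blockSize (hI : s.I.Nonempty) (hm : s.m₀ ≠ 0)
    (hbig : ∀ j ∈ s.I, 2 * ℓ ≤ (s.V j).card) : 1 ≤ s.blockSize hI := by
  refine le_min (Nat.one_le_iff_ne_zero.2 hm) ?_
  rw [Finset.le_inf'_iff]
  intro j hj
  have := two_mul_le_card_div hI (hbig j hj)
  omega

/-- Every order starts with a true candidate, so every good prefix is nonempty. -/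
theorem one_le_blockCount (hε : 0 < ε) {hI : s.I.Nonempty} {v : Fin ℓ → List U} (hm : s.m₀ ≠ 0)
    (hbig : ∀ j ∈ s.I, 2 * ℓ ≤ (s.V j).card) (hv : BlockOrder s v)
    (hV : ∀ j ∈ s.I, s.V j = s.cand f j) :
    1 ≤ s.blockCount f ε hI v (s.blockSize hI) := by
  unfold State.blockCount
  rw [Finset.le_inf'_iff]
  intro j hj
  have h1 := one_le_blockSize hI hm hbig
  have h2 := blockSize_le_length (hI := hI) hv hj
  obtain ⟨x, w, hxw⟩ : ∃ x w, v j = x :: w := List.exists_cons_of_length_pos (by omega)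
  obtain ⟨n, hn⟩ := Nat.exists_eq_add_of_le' h1
  have hx : x ∈ s.cand f j := by
    rw [← hV j hj]
    exact hv.mem j hj x (by simp [hxw])
  rw [hxw, hn]
  exact one_le_goodPrefix hε (mem_cand.1 hx).2

theorem Tidy.block (hf : IsSubmodular f) (h : Tidy f τmin s) {hI : s.I.Nonempty}
    {v : Fin ℓ → List U} {n : ℕ} : Tidy f τmin (s.block f ε hI v n) :=
  ⟨fun j hj => (cand_anti hf (subset_block_A ·) rfl).trans (h.cand j hj), h.active⟩

/-! ### The states in the main loop -/

/-- The state after the first `Update` of an iteration and the removal of indices. -/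
structure Ready (f : Finset U → ℝ) (τmin : ℝ) (s : State U ℓ) : Prop where
  tidy : Tidy f τmin s
  V_eq : ∀ j ∈ s.I, s.V j = s.cand f j
  le_τ : ∀ j ∈ s.I, τmin ≤ s.τ j
  m_ne : s.m₀ ≠ 0
  V_ne : ∀ j ∈ s.I, s.V j ≠ ∅

theorem ready_of_updated [DecidablePred fun j => ¬ s'.τ j < τmin] (h : Tidy f τmin s)
    (hm : s.m₀ ≠ 0) (hU : Updated f ε τmin s.I s s') :
    Ready f τmin { s' with I := s'.I.filter fun j => ¬ s'.τ j < τmin } := by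
  have ht := h.update hU
  have hI : ∀ j, j ∈ s'.I.filter (fun j => ¬ s'.τ j < τmin) ↔ j ∈ s.I ∧ τmin ≤ s'.τ j := by
    intro j
    rw [Finset.mem_filter, hU.I_eq, not_lt]
  refine ⟨⟨fun j hj => ht.cand j (Finset.mem_of_mem_filter j hj), fun j hj => ?_⟩, fun j hj => ?_,
    fun j hj => ((hI j).1 hj).2, by rw [← hU.m_eq] at hm; exact hm, fun j hj => ?_⟩
  · exact (hI j).2 ⟨hU.I_eq ▸ ht.active j hj, hj⟩
  · exact hU.V_eq j ((hI j).1 hj).1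
  · exact (hU.done j ((hI j).1 hj).1).resolve_right (not_lt.2 ((hI j).1 hj).2)

/-- The budget decreases in every iteration that continues, which bounds the main loop; the inner
loops are bounded by the potential, which never increases. -/
theorem mainLoop_terminates [Nonempty U] (hf : IsSubmodular f) (hε : 0 < ε) (hε1 : ε < 1)
    (hτ : 0 < τmin) (N : ℕ) : ∀ (n : ℕ) (s : State U ℓ) (r : ℕ), Tidy f τmin s →
      s.pot f ε τmin < N → s.m₀ < n →
      Prog.Sat f (fun _ _ => True) False r (mainLoop ε τmin N n s)
  | 0, _, _, _, _, hn => absurd hn (Nat.not_lt_zero _)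
  | n + 1, s, r, ht, hN, hn => by
      classical
      rw [mainLoop]
      by_cases hend : s.I = ∅ ∨ s.m₀ = 0
      · rw [if_pos hend]
        trivial
      rw [if_neg hend]
      push Not at hend
      refine Prog.Sat.bind ?_ (update_sat hε hε1 hτ.le N s.I s r ht.cand (Or.inr ⟨hτ, hN⟩))
      rintro s₁ r₁ ⟨hU, hr, -, hp⟩
      have hready := ready_of_updated ht hend.2 hU
      have hpot : s₁.pot f ε τmin < N := by
        have := hp hτ
        omega
      have hm : s₁.m₀ = s.m₀ := hU.m_eq
      set s₂ : State U ℓ := { s₁ with I := s₁.I.filter fun j => ¬ s₁.τ j < τmin } with hs₂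
      have hpot₂ : s₂.pot f ε τmin < N := hpot
      have hm₂ : s₂.m₀ = s.m₀ := hm
      clear_value s₂
      dsimp only
      split_ifs with hI hsmall
      · refine Prog.Sat.bind ?_ (addOneEach_sat hf hε hε1 hτ N (List.finRange ℓ) s₂ r₁
          (List.nodup_finRange ℓ) hready.tidy (fun j _ hj => ⟨hready.V_eq j hj, hready.le_τ j hj⟩)
          (Or.inr hpot₂))
        rintro s₃ r₃ ⟨h1, h2, h0, h3, -⟩
        refine mainLoop_terminates hf hε hε1 hτ N n { s₃ with m₀ := s₃.m₀ - 1 } r₃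
          ⟨h1.cand, h1.active⟩ ?_ ?_
        · have : ({ s₃ with m₀ := s₃.m₀ - 1 } : State U ℓ).pot f ε τmin ≤ s₃.pot f ε τmin :=
            pot_anti hf hε (fun _ => subset_rfl) rfl (Nat.sub_le _ _)
          omega
        · have : s₃.m₀ - 1 < n := by
            have := hend.2
            omega
          exact this
      · refine Prog.Sat.bind (φ := fun s' _ => Tidy f τmin s' ∧ s'.pot f ε τmin < N ∧ s'.m₀ < n)
          (fun s' r' h' => mainLoop_terminates hf hε hε1 hτ N n s' r' h'.1 h'.2.1 h'.2.2)
          (addBlocks_sat s₂ hI r₁ fun v hv => ⟨hready.tidy.block hf, ?_, ?_⟩)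
        · exact (pot_anti hf hε (subset_block_A ·) rfl (Nat.sub_le _ _)).trans_lt hpot₂
        · push Not at hsmall
          have := one_le_blockCount (f := f) hε (hI := hI) hready.m_ne hsmall hv hready.V_eq
          have e : (s₂.block f ε hI v (s₂.blockSize hI)).m₀ =
            s₂.m₀ - s₂.blockCount f ε hI v (s₂.blockSize hI) := rfl
          rw [e]
          omega
      · trivial

end

end PIG

/-! ### Random lists without repetitions -/

namespace PIG

section

variable {U : Type u} [DecidableEq U]

/-- The lists of `n` distinct elements of `X`. -/
def arrangements : ℕ → Finset U → Finset (List U)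
  | 0, _ => {[]}
  | n + 1, X => X.biUnion fun x => (arrangements n (X.erase x)).image (x :: ·)

theorem mem_arrangements : ∀ {n : ℕ} {X : Finset U} {w : List U},
    w ∈ arrangements n X ↔ w.Nodup ∧ w.toFinset ⊆ X ∧ w.length = n
  | 0, X, w => by
      rw [arrangements, Finset.mem_singleton, List.length_eq_zero_iff]
      constructor
      · rintro rfl
        simp
      · exact fun h => h.2.2
  | n + 1, X, w => by
      rw [arrangements, Finset.mem_biUnion]
      constructor
      · rintro ⟨x, hx, hw⟩
        obtain ⟨w', hw', rfl⟩ := Finset.mem_image.1 hw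
        obtain ⟨h1, h2, h3⟩ := mem_arrangements.1 hw'
        refine ⟨List.nodup_cons.2 ⟨fun h => ?_, h1⟩, ?_, by simp [h3]⟩
        · exact Finset.notMem_erase x X (h2 (List.mem_toFinset.2 h))
        · rw [List.toFinset_cons]
          exact Finset.insert_subset hx (h2.trans (Finset.erase_subset _ _))
      · rintro ⟨h1, h2, h3⟩
        obtain ⟨x, w', rfl⟩ := List.exists_cons_of_length_eq_add_one h3
        rw [List.nodup_cons] at h1
        rw [List.toFinset_cons, Finset.insert_subset_iff] at h2
        refine ⟨x, h2.1, Finset.mem_image.2 ⟨w', mem_arrangements.2 ⟨h1.2, ?_, by simpa using h3⟩,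
          rfl⟩⟩
        exact Finset.subset_erase.2 ⟨h2.2, by simpa using h1.1⟩

theorem sum_arrangements_succ {M : Type*} [AddCommMonoid M] (n : ℕ) (X : Finset U)
    (h : List U → M) :
    ∑ w ∈ arrangements (n + 1) X, h w = ∑ x ∈ X, ∑ w ∈ arrangements n (X.erase x), h (x :: w) := by
  rw [arrangements, Finset.sum_biUnion]
  · refine Finset.sum_congr rfl fun x _ => ?_
    rw [Finset.sum_image]
    intro w _ w' _ hw
    exact (List.cons.inj hw).2
  · intro x _ y _ hxy
    refine Finset.disjoint_left.2 fun w hw hw' => hxy ?_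
    obtain ⟨_, _, rfl⟩ := Finset.mem_image.1 hw
    obtain ⟨_, _, h⟩ := Finset.mem_image.1 hw'
    exact (List.cons.inj h).1.symm

theorem card_arrangements : ∀ (n : ℕ) (X : Finset U),
    (arrangements n X).card = X.card.descFactorial n
  | 0, X => by simp [arrangements]
  | n + 1, X => by
      have := sum_arrangements_succ n X fun _ => 1
      rw [Finset.card_eq_sum_ones, this]
      simp only [← Finset.card_eq_sum_ones, card_arrangements n]
      rw [Finset.sum_congr rfl fun x hx => by rw [Finset.card_erase_of_mem hx], Finset.sum_const,
        smul_eq_mul]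
      cases h : X.card with
      | zero => simp
      | succ k => rw [Nat.succ_descFactorial_succ, Nat.add_sub_cancel]

theorem arrangements_eq_biUnion (n : ℕ) (X : Finset U) :
    arrangements n X = (X.powersetCard n).biUnion fun S => S.val.lists.toFinset := by
  ext w
  rw [mem_arrangements, Finset.mem_biUnion]
  constructor
  · rintro ⟨h1, h2, h3⟩
    exact ⟨w.toFinset, Finset.mem_powersetCard.2 ⟨h2, by rw [List.toFinset_card_of_nodup h1, h3]⟩,
      mem_lists_toFinset.2 ⟨h1, rfl⟩⟩
  · rintro ⟨S, hS, hw⟩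
    obtain ⟨h1, rfl⟩ := mem_lists_toFinset.1 hw
    rw [Finset.mem_powersetCard, List.toFinset_card_of_nodup h1] at hS
    exact ⟨h1, hS.1, hS.2⟩

theorem sum_arrangements {M : Type*} [AddCommMonoid M] (n : ℕ) (X : Finset U) (h : List U → M) :
    ∑ w ∈ arrangements n X, h w =
      ∑ S ∈ X.powersetCard n, ∑ w ∈ S.val.lists.toFinset, h w := by
  rw [arrangements_eq_biUnion, Finset.sum_biUnion]
  intro S _ T _ hST
  refine Finset.disjoint_left.2 fun w hw hw' => hST ?_
  rw [← (mem_lists_toFinset.1 hw).2, ← (mem_lists_toFinset.1 hw').2]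

theorem card_lists_toFinset (S : Finset U) : S.val.lists.toFinset.card = S.card.factorial := by
  have := sum_arrangements S.card S fun _ => 1
  rw [Finset.powersetCard_self, Finset.sum_singleton, ← Finset.card_eq_sum_ones,
    ← Finset.card_eq_sum_ones, card_arrangements, Nat.descFactorial_self] at this
  exact this.symm

end

/-! ### The number of bad elements in a random order -/

section

variable {U : Type u} [DecidableEq U]

open Classical in
/-- The number of elements of `w` whose gain over `A` and their predecessors is less than `τ`. -/
noncomputable def badCount (f : Finset U → ℝ) (τ : ℝ) : Finset U → List U → ℕ
  | _, [] => 0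
  | A, x :: w => (if gain f A x < τ then 1 else 0) + badCount f τ (insert x A) w

open Classical in
/-- The elements of `V` whose gain over `A` is less than `τ`. -/
noncomputable def lowGain (f : Finset U → ℝ) (τ : ℝ) (V A : Finset U) : Finset U :=
  V.filter fun x => gain f A x < τ

/-- Some prefix of `w` of length `t ≤ m`, preceded by `i` elements with `b` bad ones, has few bad
elements, and either `t = m` or a fraction of at least `ε / 64` of `V` has low gain after it. -/
def GoodOrder (f : Finset U → ℝ) (τ ε : ℝ) (V A : Finset U) (b i m : ℕ) (w : List U) : Prop :=
  ∃ t ≤ m, (t = m ∨ ε / 64 * V.card ≤ (lowGain f τ V (A ∪ (w.take t).toFinset)).card) ∧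
    ((b + badCount f τ A (w.take t) : ℕ) : ℝ) ≤ ε * (i + t : ℕ)

variable {f : Finset U → ℝ} {τ ε : ℝ} {V A : Finset U}

open Classical in
theorem GoodOrder.cons {b i m : ℕ} {x : U} {w : List U}
    (h : GoodOrder f τ ε V (insert x A) (b + if gain f A x < τ then 1 else 0) (i + 1) m w) :
    GoodOrder f τ ε V A b i (m + 1) (x :: w) := by
  obtain ⟨t, ht, h1, h2⟩ := h
  refine ⟨t + 1, by omega, ?_, ?_⟩
  · refine h1.imp (by omega) fun h => ?_
    rwa [union_take_succ_cons]
  · rw [List.take_succ_cons, badCount, ← add_assoc]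
    have : i + (t + 1) = i + 1 + t := by omega
    rwa [this]

/-- Exceeding the allowance makes the supermartingale large: e^(-εi) ≥ e^(-b) and e < 4, so the
weight is at least 4 ^ b, where b ≥ 1. Its initial value is 1, so the exceptional probability is at
most 1/4. -/
theorem four_le_of_lt (hε : 0 < ε) {b i : ℕ} (h : ε * i < b) :
    4 ≤ 16 ^ b * Real.exp (-(ε * i)) := by
  have hb : 1 ≤ b := by
    by_contra hb
    obtain rfl : b = 0 := by omega
    have : 0 ≤ ε * i := by positivity
    simp at h
    linarith
  have h1 : Real.exp (-(b : ℝ)) ≤ Real.exp (-(ε * i)) := Real.exp_le_exp.2 (by linarith)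
  have h2 : (1 / 4 : ℝ) ≤ Real.exp (-1) := by
    rw [Real.exp_neg, one_div]
    exact inv_anti₀ (Real.exp_pos 1) (Real.exp_one_lt_d9.le.trans (by norm_num))
  have h3 : Real.exp (-(b : ℝ)) = Real.exp (-1) ^ b := by
    rw [← Real.exp_nat_mul]
    ring_nf
  calc (4 : ℝ) ≤ 4 ^ b := le_self_pow₀ (by norm_num) (by omega)
    _ = 16 ^ b * (1 / 4) ^ b := by rw [← mul_pow]; norm_num
    _ ≤ 16 ^ b * Real.exp (-1) ^ b := by gcongr
    _ ≤ _ := by rw [← h3]; gcongr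

open Classical in
/-- The number of bad elements minus its allowance is controlled by a supermartingale. -/
theorem four_mul_card_not_goodOrder_le (hε : 0 < ε) :
    ∀ (m n : ℕ) (X A : Finset U) (b i : ℕ), X ⊆ V → m ≤ n → V.card + 4 * m ≤ 4 * X.card + 4 →
      4 * (((arrangements n X).filter fun w => ¬ GoodOrder f τ ε V A b i m w).card : ℝ) ≤
        16 ^ b * Real.exp (-(ε * i)) * (arrangements n X).card := by
  intro m
  induction m with
  | zero =>
      intro n X A b i _ _ _
      by_cases hb : (b : ℝ) ≤ ε * i
      · rw [Finset.filter_false_of_mem, Finset.card_empty, Nat.cast_zero, mul_zero]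
        · positivity
        · intro w _ h
          exact h ⟨0, le_rfl, Or.inl rfl, by simpa [badCount] using hb⟩
      · have h1 := four_le_of_lt hε (not_le.1 hb)
        have h2 : (((arrangements n X).filter fun w => ¬ GoodOrder f τ ε V A b i 0 w).card : ℝ) ≤
          (arrangements n X).card := by exact_mod_cast Finset.card_filter_le _ _
        gcongr
  | succ m ih =>
      intro n X A b i hX hmn hcard
      by_cases hb : (b : ℝ) ≤ ε * i
      swap
      · have h1 := four_le_of_lt hε (not_le.1 hb)
        have h2 : (((arrangements n X).filter fun w =>
          ¬ GoodOrder f τ ε V A b i (m + 1) w).card : ℝ) ≤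
          (arrangements n X).card := by exact_mod_cast Finset.card_filter_le _ _
        gcongr
      -- If many candidates already have low gain, the empty continuation is a witness and the
      -- process may stop.
      by_cases hF : ε / 64 * V.card ≤ (lowGain f τ V A).card
      · rw [Finset.filter_false_of_mem, Finset.card_empty, Nat.cast_zero, mul_zero]
        · positivity
        · intro w _ h
          exact h ⟨0, by omega, Or.inr (by simpa using hF), by simpa [badCount] using hb⟩
      obtain ⟨n, rfl⟩ : ∃ n', n = n' + 1 := ⟨n - 1, by omega⟩
      have hXpos : 0 < X.card := by
        have : V.card ≠ 0 := by
          intro h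
          rw [h] at hF
          simp at hF
        omega
      rw [Finset.card_filter, sum_arrangements_succ, Nat.cast_sum, Finset.mul_sum]
      set c : ℝ := (((X.card - 1).descFactorial n : ℕ) : ℝ) with hc
      have hc0 : 0 ≤ c := by positivity
      have hXc : ((arrangements (n + 1) X).card : ℝ) = X.card * c := by
        rw [card_arrangements, hc]
        obtain ⟨k, hk⟩ : ∃ k, X.card = k + 1 := ⟨X.card - 1, by omega⟩
        rw [hk, Nat.succ_descFactorial_succ, Nat.add_sub_cancel]
        push_cast
        ring
      have hstep : ∀ x ∈ X, 4 * ((∑ w ∈ arrangements n (X.erase x),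
          if ¬ GoodOrder f τ ε V A b i (m + 1) (x :: w) then 1 else 0 : ℕ) : ℝ) ≤
          16 ^ b * Real.exp (-(ε * (i + 1 : ℕ))) * c *
            (1 + 15 * if gain f A x < τ then 1 else 0) := by
        intro x hx
        have h1 := ih n (X.erase x) (insert x A) (b + if gain f A x < τ then 1 else 0) (i + 1)
          ((Finset.erase_subset _ _).trans hX) (by omega)
          (by rw [Finset.card_erase_of_mem hx]; omega)
        rw [card_arrangements n (X.erase x), Finset.card_erase_of_mem hx, ← hc] at h1
        have h2 : (∑ w ∈ arrangements n (X.erase x),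
          if ¬ GoodOrder f τ ε V A b i (m + 1) (x :: w) then 1 else 0 : ℕ) ≤
          ((arrangements n (X.erase x)).filter fun w => ¬ GoodOrder f τ ε V (insert x A)
            (b + if gain f A x < τ then 1 else 0) (i + 1) m w).card := by
          rw [← Finset.card_filter]
          exact Finset.card_le_card (Finset.monotone_filter_right _
            fun w _ hw hw' => hw hw'.cons)
        have h3 : (16 : ℝ) ^ (b + if gain f A x < τ then 1 else 0) =
            16 ^ b * (1 + 15 * if gain f A x < τ then 1 else 0) := by
          split_ifs
          · rw [pow_succ]
            norm_num
          · simp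
        rw [h3] at h1
        have h2' := Nat.cast_le (α := ℝ).2 h2
        refine (mul_le_mul_of_nonneg_left h2' (by norm_num)).trans (h1.trans (le_of_eq ?_))
        ring
      refine (Finset.sum_le_sum hstep).trans ?_
      rw [← Finset.mul_sum, Finset.sum_add_distrib, ← Finset.mul_sum, Finset.sum_boole, hXc]
      -- The cardinality hypothesis keeps |V| ≤ 4 |X| while steps remain. The next element is
      -- therefore bad with probability at most ε/16, and the mean factor 1 + 15ε/16 is below e^ε.
      have hlow : (((X.filter fun x => gain f A x < τ).card : ℕ) : ℝ) ≤ ε / 16 * X.card := by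
        have h1 : (X.filter fun x => gain f A x < τ).card ≤ (lowGain f τ V A).card :=
          Finset.card_le_card (Finset.filter_subset_filter _ hX)
        have h2 : ((X.filter fun x => gain f A x < τ).card : ℝ) ≤ (lowGain f τ V A).card := by
          exact_mod_cast h1
        have h3 : (V.card : ℝ) ≤ 4 * X.card := by exact_mod_cast (by omega)
        have := not_le.1 hF
        nlinarith
      have hexp : Real.exp (-(ε * (i + 1 : ℕ))) * (1 + ε) ≤ Real.exp (-(ε * i)) := by
        have : Real.exp (-(ε * i)) = Real.exp (-(ε * (i + 1 : ℕ))) * Real.exp ε := by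
          rw [← Real.exp_add]
          push_cast
          ring_nf
        rw [this]
        gcongr
        linarith [Real.add_one_le_exp ε]
      calc _ ≤ 16 ^ b * Real.exp (-(ε * (i + 1 : ℕ))) * c * ((1 + ε) * X.card) := by
            gcongr
            simp only [Finset.sum_const, nsmul_eq_mul, mul_one]
            nlinarith
        _ = 16 ^ b * (Real.exp (-(ε * (i + 1 : ℕ))) * (1 + ε)) * (X.card * c) := by ring
        _ ≤ _ := by gcongr

theorem count_marks_add_badCount : ∀ (w : List U) (A : Finset U) (n t : ℕ), t ≤ n →
    n ≤ w.length →
    ((marks f A w τ n).take t).count (some true) + badCount f τ A (w.take t) = t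
  | _, _, _, 0, _, _ => by simp [badCount]
  | [], _, n, t + 1, ht, hn => by simp at hn; omega
  | x :: w, A, 0, t + 1, ht, hn => by omega
  | x :: w, A, n + 1, t + 1, ht, hn => by
      have ih := count_marks_add_badCount w (insert x A) n t (by omega) (by simpa using hn)
      rw [marks_cons, List.take_succ_cons, List.take_succ_cons, badCount, List.count_cons]
      by_cases h : τ ≤ gain f A x
      · rw [if_pos (by simpa using mark_singleton_eq_true A x τ |>.2 h), if_neg (not_lt.2 h)]
        omega
      · rw [if_neg (by simpa using fun h' => h ((mark_singleton_eq_true A x τ).1 h')),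
          if_pos (not_le.1 h)]
        omega

/-- In a good order, the good prefix is either long or leaves few candidates. -/
theorem GoodOrder.exists_le_goodPrefix {m n : ℕ} {w : List U} (hmn : m ≤ n) (hn : n ≤ w.length)
    (h : GoodOrder f τ ε V A 0 0 m w) :
    ∃ t ≤ goodPrefix ε (marks f A w τ n), t = m ∨
      ε / 64 * V.card ≤ (lowGain f τ V (A ∪ (w.take t).toFinset)).card := by
  obtain ⟨t, ht, h1, h2⟩ := h
  refine ⟨t, le_goodPrefix (by rw [length_marks]; omega) ?_, h1⟩
  have := count_marks_add_badCount (f := f) (τ := τ) w A n t (by omega) hn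
  have h3 : (((marks f A w τ n).take t).count (some true) : ℝ) + badCount f τ A (w.take t) = t := by
    exact_mod_cast this
  rw [zero_add, zero_add] at h2
  linarith

end

end PIG

/-! ### Progress of a block -/

namespace PIG

section

variable {U : Type u} [Fintype U] [DecidableEq U] {ℓ : ℕ} {f : Finset U → ℝ} {ε τmin : ℝ}
  {s : State U ℓ} {hI : s.I.Nonempty} {v : Fin ℓ → List U}

/-- The random order for the index `j` is good. -/
def State.GoodBlock (f : Finset U → ℝ) (ε : ℝ) (s : State U ℓ) (hI : s.I.Nonempty) (j : Fin ℓ)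
    (w : List U) : Prop :=
  GoodOrder f (s.τ j) ε (s.V j) (s.A j) 0 0 ((s.blockSize hI + 1) / 2) w

theorem card_cand_block_le_of_blockSet (hf : IsSubmodular f) (hv : BlockOrder s v)
    (hV : ∀ j ∈ s.I, s.V j = s.cand f j) {j : Fin ℓ} (hj : j ∈ s.I) :
    ((s.block f ε hI v (s.blockSize hI)).cand f j).card +
      s.blockCount f ε hI v (s.blockSize hI) ≤ (s.cand f j).card := by
  rw [← card_blockSet (hI := hI) hv hV hj, ← Finset.card_union_of_disjoint]
  · refine Finset.card_le_card (Finset.union_subset (cand_anti hf (subset_block_A ·) rfl) ?_)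
    rw [← hV j hj]
    exact blockSet_subset hv hj
  · refine Finset.disjoint_left.2 fun x hx hx' => mem_rest.1 (mem_cand.1 hx).1 j ?_
    rw [block_A hj]
    exact Finset.mem_union_right _ hx'

/-- At the index attaining i*, the whole prefix is added, so low gain over a shorter prefix excludes
an element for good. Other indices add a rearranged part of their prefix, for which this argument
fails. -/
theorem card_cand_block_le_of_lowGain (hf : IsSubmodular f) (hv : BlockOrder s v)
    (hV : ∀ j ∈ s.I, s.V j = s.cand f j) {j : Fin ℓ} (hj : j ∈ s.I)
    (hmin : s.blockCount f ε hI v (s.blockSize hI) =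
      goodPrefix ε (marks f (s.A j) (v j) (s.τ j) (s.blockSize hI))) {t : ℕ}
    (ht : t ≤ s.blockCount f ε hI v (s.blockSize hI)) :
    ((s.block f ε hI v (s.blockSize hI)).cand f j).card +
      (lowGain f (s.τ j) (s.V j) (s.A j ∪ ((v j).take t).toFinset)).card ≤ (s.cand f j).card := by
  rw [← Finset.card_union_of_disjoint]
  · refine Finset.card_le_card (Finset.union_subset (cand_anti hf (subset_block_A ·) rfl) ?_)
    rw [← hV j hj]
    exact Finset.filter_subset _ _
  · refine Finset.disjoint_left.2 fun x hx hx' => ?_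
    obtain ⟨h1, h2⟩ := mem_cand.1 hx
    have h3 : gain f (s.A j ∪ ((v j).take t).toFinset) x < s.τ j := (Finset.mem_filter.1 hx').2
    have h4 : s.A j ∪ ((v j).take t).toFinset ⊆ (s.block f ε hI v (s.blockSize hI)).A j := by
      rw [block_A hj, State.blockSet, hmin, selection_eq_prefix (hv.nodup j hj)
        (hv.notMem hV hj) (blockSize_le_length hv hj), ← hmin]
      refine Finset.union_subset_union_right fun y hy => ?_
      rw [List.mem_toFinset] at hy ⊢
      exact (List.take_subset_take_left _ ht) hy
    have h5 := hf.gain_anti h4 (mem_rest.1 h1 j)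
    exact absurd (h2.trans h5) (not_le.2 h3)

/-- If all the random orders are good then the potential decreases. -/
theorem pot_block_succ_le (hf : IsSubmodular f) (hε : 0 < ε) (hε1 : ε < 1) (hs : Ready f τmin s)
    (hI2 : s.I.card ≤ 2) (hbig : ∀ j ∈ s.I, 4 ≤ (s.V j).card) (hv : BlockOrder s v)
    (hgood : ∀ j ∈ s.I, s.GoodBlock f ε hI j (v j)) :
    (s.block f ε hI v (s.blockSize hI)).pot f ε τmin + 1 ≤ s.pot f ε τmin := by
  have hmle : (s.block f ε hI v (s.blockSize hI)).m₀ ≤ s.m₀ := Nat.sub_le _ _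
  have hne : ∀ j ∈ s.I, s.cand f j ≠ ∅ := fun j hj => hs.V_eq j hj ▸ hs.V_ne j hj
  obtain ⟨j, hj, hmin⟩ := Finset.exists_mem_eq_inf' hI
    fun j => goodPrefix ε (marks f (s.A j) (v j) (s.τ j) (s.blockSize hI))
  change s.blockCount f ε hI v (s.blockSize hI) = _ at hmin
  obtain ⟨t, ht, h⟩ := (hgood j hj).exists_le_goodPrefix (n := s.blockSize hI) (by omega)
    (blockSize_le_length hv hj)
  rw [← hmin] at ht
  rcases h with h | h
  -- At least half of the examined elements are added. If the block size is limited by the budget,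
  -- the budget is halved.
  · by_cases hsize : s.blockSize hI = s.m₀
    · refine pot_succ_le_of_m hf hε (subset_block_A ·) rfl hs.m_ne ?_
      change 2 * (s.m₀ - s.blockCount f ε hI v (s.blockSize hI)) ≤ s.m₀
      omega
    · obtain ⟨i, hi, himin⟩ := Finset.exists_mem_eq_inf' hI fun j => (s.V j).card / s.I.card
      have hsz : s.blockSize hI = (s.V i).card / s.I.card := by
        rw [← himin]
        rcases min_choice s.m₀ (s.I.inf' hI fun j => (s.V j).card / s.I.card) with h' | h'
        · exact absurd h' hsize
        · exact h'
      have h1 : (s.V i).card < 2 * (s.blockSize hI + 1) := by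
        rw [hsz]
        have hpos := Finset.card_pos.2 hI
        have := Nat.lt_mul_div_succ (s.V i).card hpos
        calc (s.V i).card < s.I.card * ((s.V i).card / s.I.card + 1) := this
          _ ≤ _ := Nat.mul_le_mul_right _ hI2
      have h2 := card_cand_block_le_of_blockSet (ε := ε) (hI := hI) hf hv hs.V_eq hi
      have h3 := hbig i hi
      rw [hs.V_eq i hi] at h1 h3
      refine pot_succ_le_of_card hf hε hε1 (subset_block_A ·) rfl hmle (hs.le_τ i hi) (hne i hi) ?_
      -- Otherwise the size is |V i| / |I| with |I| ≤ 2, so the index i loses a constant fraction of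
      -- its candidates, more than ε/64.
      have h4 : (s.cand f i).card ≤ 16 * s.blockCount f ε hI v (s.blockSize hI) := by omega
      have h2' : (((s.block f ε hI v (s.blockSize hI)).cand f i).card : ℝ) +
        s.blockCount f ε hI v (s.blockSize hI) ≤ (s.cand f i).card := by exact_mod_cast h2
      have h4' : ((s.cand f i).card : ℝ) ≤ 16 * s.blockCount f ε hI v (s.blockSize hI) := by
        exact_mod_cast h4
      nlinarith
  · refine pot_succ_le_of_card hf hε hε1 (subset_block_A ·) rfl hmle (hs.le_τ j hj) (hne j hj) ?_
    have h2 := card_cand_block_le_of_lowGain (ε := ε) (hI := hI) hf hv hs.V_eq hj hmin ht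
    have h2' : (((s.block f ε hI v (s.blockSize hI)).cand f j).card : ℝ) +
      (lowGain f (s.τ j) (s.V j) (s.A j ∪ ((v j).take t).toFinset)).card ≤ (s.cand f j).card := by
        exact_mod_cast h2
    have h3 : ((s.V j).card : ℝ) = (s.cand f j).card := by rw [hs.V_eq j hj]
    rw [h3] at h
    linarith

end

/-! ### The probability of a bad order -/

section

open scoped ENNReal

variable {U : Type u} [DecidableEq U] {ℓ : ℕ} {f : Finset U → ℝ} {q : ℝ≥0∞}

/-- Permuting costs no rounds and the other coordinates integrate to at most 1, so only the uniform
order at j remains. -/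
theorem wexp_permute_le (W : Fin ℓ → Finset U) (g : List U → ℝ≥0∞) {j : Fin ℓ} :
    ∀ (js : List (Fin ℓ)) (v : Fin ℓ → List U), js.Nodup → j ∈ js →
      Prog.wexp q f (fun v' => g (v' j)) (permute W js v) ≤
        ((W j).card.factorial : ℝ≥0∞)⁻¹ * ∑ w ∈ (W j).val.lists.toFinset, g w
  | [], _, _, hj => absurd hj List.not_mem_nil
  | i :: js, v, hn, hj => by
      rw [List.nodup_cons] at hn
      rw [permute, Prog.wexp]
      by_cases hij : j = i
      · subst hij
        rw [← card_lists_toFinset, ← tsum_uniformOn_mul (lists_toFinset_nonempty (W j))]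
        refine ENNReal.tsum_le_tsum fun w => mul_le_mul_right ?_ _
        have := Prog.wexp_le_of_sat (q := q) (g := fun v' : Fin ℓ → List U => g (v' j))
          (b := g w) (f := f) (c := True) ?_
          (permute_sat W 0 js (Function.update v j w) hn.2)
        · simpa using this
        · rintro v' r ⟨rfl, -, h⟩
          rw [h j hn.1, Function.update_self, pow_zero, one_mul]
      · exact Prog.tsum_mul_le_of_forall_support _ _ _ fun w _ =>
          wexp_permute_le W g js _ hn.2 ((List.mem_cons.1 hj).resolve_left hij)

theorem wexp_distributeLoop_of_notMem (r : ℕ) (V : Fin ℓ → Finset U) (g : Finset U → ℝ≥0∞)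
    {j : Fin ℓ} : ∀ (js : List (Fin ℓ)) (W : Fin ℓ → Finset U), j ∉ js →
      Prog.wexp q f (fun W' => g (W' j)) (distributeLoop r V js W) ≤ g (W j)
  | [], _, _ => le_rfl
  | i :: js, W, hj => by
      rw [List.mem_cons, not_or] at hj
      rw [distributeLoop, Prog.wexp]
      refine Prog.tsum_mul_le_of_forall_support _ _ _ fun S _ => ?_
      refine (wexp_distributeLoop_of_notMem r V g js _ hj.2).trans ?_
      rw [Function.update_of_ne hj.1]

/-- Given the earlier choices, W j is a uniform subset of what they left of V j. A bound that is
uniform in the remaining set X suffices, and dependence between indices is irrelevant. -/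
theorem wexp_distributeLoop_le (r : ℕ) (V : Fin ℓ → Finset U) (g : Finset U → ℝ≥0∞)
    {j : Fin ℓ} {b : ℝ≥0∞}
    (hb : ∀ X ⊆ V j, (V j).card + (V j).card / r ≤ X.card + r * ((V j).card / r) →
      ((X.powersetCard ((V j).card / r)).card : ℝ≥0∞)⁻¹ *
        ∑ S ∈ X.powersetCard ((V j).card / r), g S ≤ b) :
    ∀ (js : List (Fin ℓ)) (W : Fin ℓ → Finset U), DistributeReady r V js W → j ∈ js →
      Prog.wexp q f (fun W' => g (W' j)) (distributeLoop r V js W) ≤ b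
  | [], _, _, hj => absurd hj List.not_mem_nil
  | i :: js, W, h, hj => by
      rw [distributeLoop, Prog.wexp]
      by_cases hij : j = i
      · subst hij
        refine le_trans ?_ (hb _ Finset.sdiff_subset h.card_sdiff)
        rw [← tsum_uniformOn_mul h.nonempty]
        refine ENNReal.tsum_le_tsum fun S => mul_le_mul_right ?_ _
        refine (wexp_distributeLoop_of_notMem r V g js _ (List.nodup_cons.1 h.nodup).1).trans ?_
        rw [Function.update_self]
      · refine Prog.tsum_mul_le_of_forall_support _ _ _ fun S hS => ?_
        have hS' := Finset.mem_powersetCard.1 (mem_of_mem_support_uniformOn h.nonempty hS)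
        exact wexp_distributeLoop_le r V g hb js _ (h.tail hS'.2)
          ((List.mem_cons.1 hj).resolve_left hij)

/-- A uniformly random subset of size `n`, put into a uniformly random order, is a uniformly random
arrangement. -/
theorem sum_powersetCard_lists (n : ℕ) (X : Finset U) (g : List U → ℝ≥0∞) :
    ((X.powersetCard n).card : ℝ≥0∞)⁻¹ * ∑ S ∈ X.powersetCard n,
        (S.card.factorial : ℝ≥0∞)⁻¹ * ∑ w ∈ S.val.lists.toFinset, g w =
      ((arrangements n X).card : ℝ≥0∞)⁻¹ * ∑ w ∈ arrangements n X, g w := by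
  have h1 : ∀ S ∈ X.powersetCard n, (S.card.factorial : ℝ≥0∞)⁻¹ *
      ∑ w ∈ S.val.lists.toFinset, g w =
      (n.factorial : ℝ≥0∞)⁻¹ * ∑ w ∈ S.val.lists.toFinset, g w := by
    intro S hS
    rw [(Finset.mem_powersetCard.1 hS).2]
  rw [Finset.sum_congr rfl h1, ← Finset.mul_sum, ← sum_arrangements, ← mul_assoc,
    card_arrangements, Finset.card_powersetCard, Nat.descFactorial_eq_factorial_mul_choose,
    Nat.cast_mul, ENNReal.mul_inv (Or.inr (ENNReal.natCast_ne_top _))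
      (Or.inl (ENNReal.natCast_ne_top _)), mul_comm (_ : ℝ≥0∞)⁻¹]

variable {ε : ℝ} {s : State U ℓ}

open Classical in
-- With at most two active indices at least half of V j is still available, and half of the block
-- size is examined. This leaves the factor 4 of room that the supermartingale needs.
theorem sum_not_goodBlock_le (hε : 0 < ε) (hI : s.I.Nonempty) (hI2 : s.I.card ≤ 2) {j : Fin ℓ}
    (hj : j ∈ s.I) {X : Finset U} (hX : X ⊆ s.V j)
    (hcard : (s.V j).card + (s.V j).card / s.I.card ≤
      X.card + s.I.card * ((s.V j).card / s.I.card)) :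
    ((arrangements ((s.V j).card / s.I.card) X).card : ℝ≥0∞)⁻¹ *
      ∑ w ∈ arrangements ((s.V j).card / s.I.card) X,
        (if s.GoodBlock f ε hI j w then 0 else 1) ≤ 4⁻¹ := by
  set n := (s.V j).card / s.I.card with hn
  have hsz : s.blockSize hI ≤ n := (min_le_right _ _).trans (Finset.inf'_le _ hj)
  have hIpos := Finset.card_pos.2 hI
  have hnX : n * s.I.card ≤ (s.V j).card := Nat.div_mul_le_self _ _
  have h1 := four_mul_card_not_goodOrder_le (f := f) (τ := s.τ j) (V := s.V j) hε
    ((s.blockSize hI + 1) / 2) n X (s.A j) 0 0 hX (by omega) (by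
      obtain h | h : s.I.card = 1 ∨ s.I.card = 2 := by omega
      all_goals
        rw [h] at hcard hnX
        omega)
  rw [pow_zero, Nat.cast_zero, mul_zero, neg_zero, Real.exp_zero, one_mul, one_mul] at h1
  have h2 : 4 * ((arrangements n X).filter fun w => ¬ s.GoodBlock f ε hI j w).card ≤
      (arrangements n X).card := by exact_mod_cast h1
  have h3 : ∑ w ∈ arrangements n X, (if s.GoodBlock f ε hI j w then 0 else 1 : ℝ≥0∞) =
      ((arrangements n X).filter fun w => ¬ s.GoodBlock f ε hI j w).card := by
    rw [Finset.card_filter, Nat.cast_sum]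
    refine Finset.sum_congr rfl fun w _ => ?_
    split_ifs <;> simp
  rw [h3, mul_comm, ← div_eq_mul_inv]
  refine ENNReal.div_le_of_le_mul ?_
  rw [mul_comm, ← div_eq_mul_inv, ENNReal.le_div_iff_mul_le (Or.inl (by norm_num))
    (Or.inl (by norm_num)), mul_comm]
  exact_mod_cast h2

open Classical in
theorem wexp_not_goodBlock_le (hε : 0 < ε) (hI : s.I.Nonempty) (hI2 : s.I.card ≤ 2) {j : Fin ℓ}
    (hj : j ∈ s.I) :
    Prog.wexp q f (fun W => Prog.wexp q f (fun v => if s.GoodBlock f ε hI j (v j) then 0 else 1)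
      (permute W ((List.finRange ℓ).filter fun j => j ∈ s.I) fun _ => []))
      (distribute s.I s.V) ≤ 4⁻¹ := by
  have h1 : ∀ W, Prog.wexp q f (fun v => if s.GoodBlock f ε hI j (v j) then 0 else 1)
      (permute W ((List.finRange ℓ).filter fun j => j ∈ s.I) fun _ => []) ≤
      ((W j).card.factorial : ℝ≥0∞)⁻¹ * ∑ w ∈ (W j).val.lists.toFinset,
        if s.GoodBlock f ε hI j w then 0 else 1 := fun W =>
    wexp_permute_le W (fun w => if s.GoodBlock f ε hI j w then 0 else 1) _ _
      ((List.nodup_finRange ℓ).filter _) (by simpa using hj)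
  refine (Prog.wexp_mono (fun W _ _ => h1 W) (distribute_sat (c := True) s.I s.V 0)).trans ?_
  refine wexp_distributeLoop_le s.I.card s.V (fun S => (S.card.factorial : ℝ≥0∞)⁻¹ *
    ∑ w ∈ S.val.lists.toFinset, if s.GoodBlock f ε hI j w then 0 else 1) ?_ _ _
    (distributeReady s.I s.V) (mem_distributeOrder.2 hj)
  intro X hX hcard
  rw [sum_powersetCard_lists]
  exact sum_not_goodBlock_le hε hI hI2 hj hX hcard

variable [Fintype U]

open Classical in
/-- The expected value of `2 ^ pot` decreases in a block. -/
theorem wexp_addBlocks_le (hf : IsSubmodular f) (hε : 0 < ε) (hε1 : ε < 1) {τmin : ℝ}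
    (hs : Ready f τmin s) (hI : s.I.Nonempty) (hI2 : s.I.card ≤ 2)
    (hbig : ∀ j ∈ s.I, 4 ≤ (s.V j).card) :
    2 * Prog.wexp q f (fun s' => 2 ^ s'.pot f ε τmin) (addBlocks ε s hI) ≤
      q * (2 ^ s.pot f ε τmin * (1 + 2⁻¹)) := by
  set P : ℝ≥0∞ := 2 ^ s.pot f ε τmin with hP
  -- If all orders are good the potential drops by 1, and otherwise it does not grow; the sum over j
  -- encodes the union bound. With failure probability at most 1/2 the mean factor is 3/4.
  have key : ∀ v, BlockOrder s v →
      2 * (2 : ℝ≥0∞) ^ (s.block f ε hI v (s.blockSize hI)).pot f ε τmin ≤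
        P * (1 + ∑ j ∈ s.I, if s.GoodBlock f ε hI j (v j) then 0 else 1) := by
    intro v hv
    rw [← pow_succ']
    by_cases hg : ∀ j ∈ s.I, s.GoodBlock f ε hI j (v j)
    · have := pot_block_succ_le hf hε hε1 hs hI2 hbig hv hg
      calc _ ≤ P := pow_le_pow_right₀ (by norm_num) this
        _ ≤ _ := le_mul_of_one_le_right zero_le le_self_add
    · push Not at hg
      obtain ⟨j, hj, hbad⟩ := hg
      have h1 : (s.block f ε hI v (s.blockSize hI)).pot f ε τmin ≤ s.pot f ε τmin :=
        pot_anti hf hε (subset_block_A ·) rfl (Nat.sub_le _ _)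
      have h2 : (1 : ℝ≥0∞) ≤ ∑ j ∈ s.I, if s.GoodBlock f ε hI j (v j) then 0 else 1 := by
        refine le_trans ?_ (Finset.single_le_sum (fun _ _ => zero_le) hj)
        rw [if_neg hbad]
      calc _ ≤ P * 2 := by
            rw [pow_succ]
            exact mul_le_mul_left (pow_le_pow_right₀ (by norm_num) h1) _
        _ ≤ _ := by
          rw [← one_add_one_eq_two]
          gcongr
  have hconst : ∀ W, Prog.wexp q f (fun _ => (1 : ℝ≥0∞))
      (permute W ((List.finRange ℓ).filter fun j => j ∈ s.I) fun _ => []) ≤ 1 := by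
    intro W
    have := Prog.wexp_le_of_sat (q := q) (g := fun _ => (1 : ℝ≥0∞)) (b := 1) (f := f) (c := True)
      (fun _ _ h => by rw [h.1, pow_zero, one_mul])
      (permute_sat W 0 ((List.finRange ℓ).filter fun j => j ∈ s.I) (fun _ => [])
        ((List.nodup_finRange ℓ).filter _))
    simpa using this
  have hconst' : Prog.wexp q f (fun _ => (1 : ℝ≥0∞)) (distribute s.I s.V) ≤ 1 := by
    have := Prog.wexp_le_of_sat (q := q) (g := fun _ => (1 : ℝ≥0∞)) (b := 1) (f := f) (c := True)
      (fun _ _ h => by rw [h.1, pow_zero, one_mul]) (distribute_sat s.I s.V 0)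
    simpa using this
  rw [addBlocks_eq, Prog.wexp_bind, ← Prog.wexp_const_mul]
  have hstep : ∀ W r, (r = 0 ∧ (∀ i j, i ≠ j → Disjoint (W i) (W j)) ∧
      ∀ j ∈ s.I, W j ⊆ s.V j ∧ (W j).card = (s.V j).card / s.I.card) →
      2 * Prog.wexp q f (fun s' => 2 ^ s'.pot f ε τmin)
        ((permute W ((List.finRange ℓ).filter fun j => j ∈ s.I) fun _ => []).bind fun v =>
        .ask (∑ j ∈ s.I, prefixBatch (s.A j) (v j)
            (min s.m₀ (s.I.inf' hI fun j => (W j).card))) fun ans =>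
          .ret (s.block ans ε hI v (min s.m₀ (s.I.inf' hI fun j => (W j).card)))) ≤
      q * P * (1 + ∑ j ∈ s.I, Prog.wexp q f
        (fun v => if s.GoodBlock f ε hI j (v j) then 0 else 1)
        (permute W ((List.finRange ℓ).filter fun j => j ∈ s.I) fun _ => [])) := by
    rintro W r ⟨-, hd, hW⟩
    rw [Prog.wexp_bind, ← Prog.wexp_const_mul]
    calc _ ≤ Prog.wexp q f (fun v => q * P * (1 + ∑ j ∈ s.I,
            if s.GoodBlock f ε hI j (v j) then 0 else 1))
            (permute W ((List.finRange ℓ).filter fun j => j ∈ s.I) fun _ => []) := by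
          refine Prog.wexp_mono ?_ (permute_sat (c := True) W 0
            ((List.finRange ℓ).filter fun j => j ∈ s.I) (fun _ => [])
            ((List.nodup_finRange ℓ).filter _))
          rintro v r' ⟨-, hv, -⟩
          simp only [Prog.wexp]
          rw [block_answers, blockSize_eq s hI fun j hj => (hW j hj).2, mul_left_comm, mul_assoc]
          refine mul_le_mul_right (key v ?_) q
          exact blockOrder_of_subset hd hW fun j hj => hv j (by simpa using hj)
      _ ≤ _ := by
          rw [Prog.wexp_const_mul, Prog.wexp_add, Prog.wexp_sum]
          gcongr
          exact hconst W
  refine (Prog.wexp_mono hstep (distribute_sat (c := True) s.I s.V 0)).trans ?_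
  rw [Prog.wexp_const_mul, Prog.wexp_add, Prog.wexp_sum, mul_assoc]
  gcongr
  calc _ ≤ ∑ j ∈ s.I, (4⁻¹ : ℝ≥0∞) :=
        Finset.sum_le_sum fun j hj => wexp_not_goodBlock_le hε hI hI2 hj
    _ ≤ 2 * 4⁻¹ := by
        rw [Finset.sum_const, nsmul_eq_mul]
        gcongr
        exact_mod_cast hI2
    _ = 2⁻¹ := by
        rw [show (4 : ℝ≥0∞) = 2 * 2 by norm_num, ENNReal.mul_inv (by simp) (by simp), ← mul_assoc,
          ENNReal.mul_inv_cancel (by simp) (by simp), one_mul]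

end

end PIG

/-! ### The number of rounds and queries -/

theorem Prog.wexp_le_of_sat_zero {U : Type u} [DecidableEq U] {α : Type v} {q b : ENNReal}
    {f : Finset U → ℝ} {φ : α → ℕ → Prop} {c : Prop} {g : α → ENNReal} {P : Prog U α}
    (hg : ∀ a r, φ a r → q ^ r * g a ≤ b) (h : Sat f φ c 0 P) : wexp q f g P ≤ b := by
  simpa using wexp_le_of_sat hg h

namespace PIG

section

open scoped ENNReal

variable {U : Type u} [Fintype U] [DecidableEq U] {f : Finset U → ℝ} {ε τmin : ℝ}

/-- One iteration: `Update` takes r = 1 + d rounds, where the d extra ones are paid for by 3d units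
of potential. The remaining factor (3/4) q² is at most 1 because (9/8)² < 4/3. -/
theorem wexp_step_le {q : ℝ≥0∞} (hq : q ≤ 9 / 8) {b : ℝ≥0∞} {p p' r : ℕ}
    (hb : 4 * b ≤ 3 * (q * 2 ^ p')) (hr : 1 ≤ r) (hp : p' + 3 * r ≤ p + 3) :
    q ^ r * b ≤ 2 ^ p := by
  obtain ⟨d, rfl⟩ := Nat.exists_eq_add_of_le hr
  have h1 : 3 * (q * q) ≤ 4 := by
    calc 3 * (q * q) ≤ 3 * (9 / 8 * (9 / 8)) := by gcongr
      _ ≤ 4 := by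
        rw [← ENNReal.toReal_le_toReal (by finiteness) (by finiteness)]
        norm_num
  have h2 : q ≤ 2 ^ 3 := by
    refine hq.trans ?_
    rw [← ENNReal.toReal_le_toReal (by finiteness) (by finiteness)]
    norm_num
  have h3 : 4 * (q ^ (1 + d) * b) ≤ 4 * 2 ^ p := by
    calc 4 * (q ^ (1 + d) * b) = q ^ (1 + d) * (4 * b) := by ring
      _ ≤ q ^ (1 + d) * (3 * (q * 2 ^ p')) := by gcongr
      _ = 3 * (q * q) * q ^ d * 2 ^ p' := by ring
      _ ≤ 4 * (2 ^ 3) ^ d * 2 ^ p' := by gcongr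
      _ = 4 * 2 ^ (3 * d + p') := by rw [← pow_mul, pow_add, mul_assoc]
      _ ≤ 4 * 2 ^ p := by
        gcongr
        · norm_num
        · omega
  exact (ENNReal.mul_le_mul_iff_right (by norm_num) (by norm_num)).1 h3

theorem one_le_pot {ℓ : ℕ} {s : State U ℓ} (hm : s.m₀ ≠ 0) : 1 ≤ s.pot f ε τmin :=
  le_add_left (Nat.size_pos.2 (Nat.pos_of_ne_zero hm))

theorem four_mul_le_of_two_mul_le {q b P : ℝ≥0∞} (hq : 1 ≤ q) (h : 2 * b ≤ P) :
    4 * b ≤ 3 * (q * P) := by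
  calc 4 * b = 2 * (2 * b) := by ring
    _ ≤ 3 * (1 * P) := by
      rw [one_mul]
      gcongr
      norm_num
    _ ≤ 3 * (q * P) := by gcongr

/-- The exponential moment of the number of rounds of the main loop. -/
theorem wexp_mainLoop_le [Nonempty U] {q : ℝ≥0∞} (hq1 : 1 ≤ q) (hq : q ≤ 9 / 8) (hf : IsSubmodular f)
    (hε : 0 < ε) (hε1 : ε < 1) (hτ : 0 < τmin) (N : ℕ) :
    ∀ (n : ℕ) (s : State U 2), Tidy f τmin s →
      Prog.wexp q f (fun _ => 1) (mainLoop ε τmin N n s) ≤ 2 ^ s.pot f ε τmin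
  | 0, _, _ => zero_le
  | n + 1, s, ht => by
      classical
      have hq2 : q ≤ 2 := by
        refine hq.trans ?_
        rw [← ENNReal.toReal_le_toReal (by finiteness) (by finiteness)]
        norm_num
      rw [mainLoop]
      by_cases hend : s.I = ∅ ∨ s.m₀ = 0
      · rw [if_pos hend]
        exact one_le_pow₀ (by norm_num)
      rw [if_neg hend, Prog.wexp_bind]
      push Not at hend
      refine Prog.wexp_le_of_sat_zero ?_ (update_sat (c := True) hε hε1 hτ.le N s.I s 0 ht.cand
        (Or.inl trivial))
      rintro s₁ r₁ ⟨hU, hr, -, hp⟩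
      have hready := ready_of_updated ht hend.2 hU
      have hpot := hp hτ
      refine wexp_step_le hq (p' := s₁.pot f ε τmin) ?_ (by omega) (by omega)
      set s₂ : State U 2 := { s₁ with I := s₁.I.filter fun j => ¬ s₁.τ j < τmin } with hs₂
      have hpot₂ : s₁.pot f ε τmin = s₂.pot f ε τmin := rfl
      rw [hpot₂]
      clear_value s₂
      dsimp only
      split_ifs with hI hsmall
      -- Adding single elements decreases the potential surely, so the factor 1/2 is available
      -- instead of 3/4.
      · refine four_mul_le_of_two_mul_le hq1 ?_
        rw [Prog.wexp_bind, ← Prog.wexp_const_mul]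
        refine Prog.wexp_le_of_sat_zero ?_ (addOneEach_sat (c := True) hf hε hε1 hτ N
          (List.finRange 2) s₂ 0 (List.nodup_finRange 2) hready.tidy
          (fun j _ hj => ⟨hready.V_eq j hj, hready.le_τ j hj⟩) (Or.inl trivial))
        rintro s₃ r₃ ⟨h1, h2, h0, -, h4⟩
        obtain ⟨i, hi, hi4⟩ := hsmall
        have h5 := h4 ⟨i, List.mem_finRange i, hi, by omega⟩
        have h6 : ({ s₃ with m₀ := s₃.m₀ - 1 } : State U 2).pot f ε τmin ≤ s₃.pot f ε τmin :=
          pot_anti hf hε (fun _ => subset_rfl) rfl (Nat.sub_le _ _)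
        calc _ ≤ q ^ r₃ * (2 * 2 ^ ({ s₃ with m₀ := s₃.m₀ - 1 } : State U 2).pot f ε τmin) := by
              gcongr
              exact wexp_mainLoop_le hq1 hq hf hε hε1 hτ N n _ ⟨h1.cand, h1.active⟩
          _ ≤ 2 ^ r₃ * (2 * 2 ^ s₃.pot f ε τmin) := by
              gcongr
              norm_num
          _ = 2 ^ (s₃.pot f ε τmin + r₃ + 1) := by ring
          _ ≤ _ := pow_le_pow_right₀ (by norm_num) (by omega)
      · push Not at hsmall
        have h1 := wexp_addBlocks_le (q := q) hf hε hε1 hready hI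
          (by simpa using Finset.card_le_univ s₂.I) fun j hj => by
            have := hsmall j hj
            omega
        rw [Prog.wexp_bind]
        calc _ ≤ 4 * Prog.wexp q f (fun s' => 2 ^ s'.pot f ε τmin) (addBlocks ε s₂ hI) := by
              refine mul_le_mul_right (Prog.wexp_mono (φ := fun s' _ => Tidy f τmin s')
                (fun s' _ h => wexp_mainLoop_le hq1 hq hf hε hε1 hτ N n s' h)
                (addBlocks_sat (c := True) s₂ hI 0 fun v hv => hready.tidy.block hf)) _
          _ = 2 * (2 * Prog.wexp q f (fun s' => 2 ^ s'.pot f ε τmin) (addBlocks ε s₂ hI)) := by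
              ring
          _ ≤ 2 * (q * (2 ^ s₂.pot f ε τmin * (1 + 2⁻¹))) := by gcongr
          _ = (2 + 2 * 2⁻¹) * (q * 2 ^ s₂.pot f ε τmin) := by ring
          _ = _ := by
              rw [ENNReal.mul_inv_cancel (by simp) (by simp)]
              norm_num
      · refine four_mul_le_of_two_mul_le hq1 ?_
        rw [Prog.wexp, mul_one]
        exact le_self_pow₀ (by norm_num) (Nat.one_le_iff_ne_zero.1 (one_le_pot hready.m_ne))

end

/-! ### The size of the batches -/

section

theorem two_mul_card_succ_le (U : Type u) [Fintype U] [Nonempty U] :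
    2 * (Fintype.card U + 1) ≤ 4 * Fintype.card U := by
  have : 0 < Fintype.card U := Fintype.card_pos
  omega

variable {U : Type u} [DecidableEq U] {ε τmin : ℝ}

theorem maxBatch_distributeLoop {B : ℕ} (r : ℕ) (V : Fin 2 → Finset U) :
    ∀ (js : List (Fin 2)) (W : Fin 2 → Finset U), Prog.MaxBatch B (distributeLoop r V js W)
  | [], _ => trivial
  | _ :: js, _ => fun _ => maxBatch_distributeLoop r V js _

theorem maxBatch_permute {B : ℕ} (W : Fin 2 → Finset U) :
    ∀ (js : List (Fin 2)) (v : Fin 2 → List U), Prog.MaxBatch B (permute W js v)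
  | [], _ => trivial
  | _ :: js, _ => fun _ => maxBatch_permute W js _

variable [Fintype U]

theorem card_sum_gainBatch_le (E : Finset (Fin 2)) (A W : Fin 2 → Finset U) :
    Multiset.card (∑ j ∈ E, gainBatch (A j) (W j)) ≤ 2 * (Fintype.card U + 1) := by
  rw [Multiset.card_sum]
  calc _ ≤ ∑ j ∈ E, (Fintype.card U + 1) := Finset.sum_le_sum fun j _ => by
        simpa [gainBatch] using Finset.card_le_univ (W j)
    _ ≤ _ := by
        rw [Finset.sum_const, smul_eq_mul]
        exact Nat.mul_le_mul_right _ (by simpa using Finset.card_le_univ E)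

variable [Nonempty U]

theorem maxBatch_updateLoop (J : Finset (Fin 2)) : ∀ (N : ℕ) (s : State U 2),
    Prog.MaxBatch (4 * Fintype.card U) (updateLoop ε τmin J N s)
  | 0, _ => trivial
  | N + 1, s => by
      rw [updateLoop]
      split_ifs
      · trivial
      · exact ⟨(card_sum_gainBatch_le _ _ _).trans (two_mul_card_succ_le U),
          fun ans => maxBatch_updateLoop J N _⟩

theorem maxBatch_update (N : ℕ) (J : Finset (Fin 2)) (s : State U 2) :
    Prog.MaxBatch (4 * Fintype.card U) (update ε τmin N J s) :=
  ⟨(card_sum_gainBatch_le _ _ _).trans (two_mul_card_succ_le U),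
    fun _ => maxBatch_updateLoop J N _⟩

theorem maxBatch_addOneEach (N : ℕ) : ∀ (js : List (Fin 2)) (s : State U 2),
    Prog.MaxBatch (4 * Fintype.card U) (addOneEach ε τmin N js s)
  | [], _ => trivial
  | j :: js, s => by
      rw [addOneEach]
      split_ifs
      · refine Prog.MaxBatch.bind (fun s' => ?_) (maxBatch_update N {j} s)
        split_ifs
        · exact maxBatch_addOneEach N js _
        · exact fun x => maxBatch_addOneEach N js _
      · refine Prog.MaxBatch.bind (fun s' => ?_) trivial
        split_ifs
        · exact maxBatch_addOneEach N js _
        · exact fun x => maxBatch_addOneEach N js _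
      · exact maxBatch_addOneEach N js s

theorem maxBatch_addBlocks (s : State U 2) (hI : s.I.Nonempty) :
    Prog.MaxBatch (4 * Fintype.card U) (addBlocks ε s hI) := by
  rw [addBlocks_eq]
  refine Prog.MaxBatch.bind (fun W => Prog.MaxBatch.bind (fun v => ?_)
    (maxBatch_permute _ _ _)) (maxBatch_distributeLoop _ _ _ _)
  refine ⟨?_, fun _ => trivial⟩
  refine le_trans ?_ (two_mul_card_succ_le U)
  rw [Multiset.card_sum]
  -- The prefix length is at most |W j|, hence at most n, so the bound also holds for answers that
  -- come from no oracle.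
  have h1 : min s.m₀ (s.I.inf' hI fun j => (W j).card) ≤ Fintype.card U := by
    obtain ⟨j, hj⟩ := id hI
    exact (min_le_right _ _).trans ((Finset.inf'_le _ hj).trans (Finset.card_le_univ _))
  calc _ ≤ ∑ j ∈ s.I, (Fintype.card U + 1) := Finset.sum_le_sum fun j _ => by
        simpa [prefixBatch] using h1
    _ ≤ _ := by
        rw [Finset.sum_const, smul_eq_mul]
        exact Nat.mul_le_mul_right _ (by simpa using Finset.card_le_univ s.I)

theorem maxBatch_mainLoop (N : ℕ) : ∀ (n : ℕ) (s : State U 2),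
    Prog.MaxBatch (4 * Fintype.card U) (mainLoop ε τmin N n s)
  | 0, _ => trivial
  | n + 1, s => by
      rw [mainLoop]
      split_ifs
      · trivial
      · refine Prog.MaxBatch.bind (fun s₁ => ?_) (maxBatch_update N s.I s)
        dsimp only
        split_ifs
        · exact Prog.MaxBatch.bind (fun s' => maxBatch_mainLoop N n _) (maxBatch_addOneEach N _ _)
        · exact Prog.MaxBatch.bind (fun s' => maxBatch_mainLoop N n _) (maxBatch_addBlocks _ _)
        · trivial

theorem maxBatch_parallelInterlaceGreedy (m N : ℕ) :
    Prog.MaxBatch (4 * Fintype.card U) (parallelInterlaceGreedy U m 2 τmin ε N) := by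
  refine ⟨?_, fun ans => Prog.MaxBatch.bind (fun s => ?_) (maxBatch_mainLoop N N _)⟩
  swap
  · exact trivial
  have := two_mul_card_succ_le U
  simp [gainBatch]
  omega

end

end PIG

/-! ### The initial state -/

namespace PIG

section

variable {U : Type u} [Fintype U] [DecidableEq U] [Nonempty U]

/-- The state in which the main loop starts. -/
noncomputable def initState (f : Finset U → ℝ) (k : ℕ) : State U 2 where
  I := Finset.univ
  m₀ := k
  A := fun _ => ∅
  A' := fun _ => ∅
  V := fun _ => Finset.univ
  τ := fun _ => Finset.univ.sup' Finset.univ_nonempty fun x => gain f ∅ x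

/-- The program after the first round. -/
noncomputable def afterFirstRound (f : Finset U → ℝ) (k : ℕ) (τmin ε : ℝ) (N : ℕ) :
    Prog U (Fin 2 → Finset U) :=
  (mainLoop ε τmin N N (initState f k)).bind fun s => .ret s.A'

theorem initState_answers (f : Finset U → ℝ) (k : ℕ) :
    initState (fun S => if S ∈ gainBatch ∅ (Finset.univ : Finset U) then f S else 0) k =
      initState f k := by
  have h : ∀ x : U, gain (fun S => if S ∈ gainBatch ∅ (Finset.univ : Finset U) then f S else 0)
      ∅ x = gain f ∅ x := by
    intro x
    have h1 : (∅ : Finset U) ∈ gainBatch ∅ (Finset.univ : Finset U) := by simp [gainBatch]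
    have h2 : insert x (∅ : Finset U) ∈ gainBatch ∅ (Finset.univ : Finset U) := by
      rw [gainBatch, Multiset.mem_cons, Multiset.mem_map]
      exact Or.inr ⟨x, Finset.mem_univ x, rfl⟩
    simp only [gain, if_pos h1, if_pos h2]
  simp only [initState, h]

variable {f : Finset U → ℝ} {O : Finset U} {k N : ℕ} {ε τmin : ℝ}

theorem sat_parallelInterlaceGreedy {φ : (Fin 2 → Finset U) → ℕ → Prop} {c : Prop}
    (h : Prog.Sat f φ c 1 (afterFirstRound f k τmin ε N)) :
    Prog.Sat f φ c 0 (parallelInterlaceGreedy U k 2 τmin ε N) := by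
  have := initState_answers f k
  unfold afterFirstRound at h
  rw [← this] at h
  exact h

theorem wexp_parallelInterlaceGreedy (q : ENNReal) :
    Prog.wexp q f (fun _ => 1) (parallelInterlaceGreedy U k 2 τmin ε N) =
      q * Prog.wexp q f (fun _ => 1) (mainLoop ε τmin N N (initState f k)) := by
  have h1 : Prog.wexp q f (fun _ => 1) (parallelInterlaceGreedy U k 2 τmin ε N) =
    q * Prog.wexp q f (fun _ => 1) ((mainLoop ε τmin N N (initState (fun S => if S ∈
      gainBatch ∅ (Finset.univ : Finset U) then f S else 0) k)).bind fun s => .ret s.A') := rfl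
  rw [h1, initState_answers, Prog.wexp_bind]
  rfl

theorem gain_le_initState (x : U) (j : Fin 2) : gain f ∅ x ≤ (initState f k).τ j :=
  Finset.le_sup' (fun x => gain f ∅ x) (Finset.mem_univ x)

theorem gain_empty (f : Finset U → ℝ) (x : U) : gain f ∅ x = f {x} - f ∅ := by
  simp [gain]

theorem loopInv_initState (hε : 0 < ε) (hε1 : ε < 1) (hτ : 0 ≤ τmin) :
    LoopInv f O k ε τmin (initState f k) where
  sound :=
    { disj := Finset.disjoint_empty_left _
      A'_sub := fun _ => subset_rfl
      val := fun _ => le_rfl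
      cand := fun _ _ => Finset.subset_univ _
      bound := by
        intro j x _
        have h1 := gain_le_initState (f := f) (k := k) x j
        have h2 : 0 ≤ max ((initState f k).τ j) τmin := hτ.trans (le_max_right _ _)
        calc gain f ∅ x ≤ max ((initState f k).τ j) τmin := h1.trans (le_max_left _ _)
          _ ≤ _ := le_mul_of_one_le_left h2 (one_le_inv_one_sub hε hε1)
      active := fun j _ => Finset.mem_univ j }
  ledger := Or.inl (Finset.biUnion_subset.2 fun _ _ => Finset.empty_subset _)
  card_le _ := by simp [initState]
  le_card _ _ := by simp [initState]

theorem tidy_initState : Tidy f τmin (initState f k) :=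
  ⟨fun _ _ => Finset.subset_univ _, fun j _ => Finset.mem_univ j⟩

theorem maxSingleton_nonneg (h0 : ∀ S, 0 ≤ f S) : 0 ≤ maxSingleton f := by
  obtain ⟨x⟩ := ‹Nonempty U›
  exact (h0 {x}).trans (Finset.le_sup' (fun x => f {x}) (Finset.mem_univ x))

theorem le_maxSingleton (x : U) : f {x} ≤ maxSingleton f :=
  Finset.le_sup' (fun x => f {x}) (Finset.mem_univ x)

theorem maxSingleton_le (hk : 1 ≤ k) (hO : IsOptimal f k O) : maxSingleton f ≤ f O :=
  Finset.sup'_le _ _ fun x _ => hO.2 {x} (by simpa using hk)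

theorem initState_τ_le (h0 : ∀ S, 0 ≤ f S) (j : Fin 2) : (initState f k).τ j ≤ maxSingleton f :=
  Finset.sup'_le Finset.univ_nonempty _ fun x _ => by
    rw [gain_empty]
    linarith [h0 ∅, le_maxSingleton (f := f) x]

/-- The approximation guarantee. -/
theorem guarantee_of_mem_support (h0 : ∀ S, 0 ≤ f S) (hf : IsSubmodular f) (hk : 1 ≤ k)
    (hε : 0 < ε) (hε1 : ε < 1) (hO : IsOptimal f k O)
    {o : Outcome (Fin 2 → Finset U)}
    (ho : o ∈ ((parallelInterlaceGreedy U k 2 (ε * maxSingleton f / k) ε N).run f).support)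
    {A' : Fin 2 → Finset U} (hA : o.result = some A') : Guarantee f O k ε A' := by
  have hk0 : (0 : ℝ) < k := by exact_mod_cast hk
  have hM := maxSingleton_nonneg h0
  have hτ : 0 ≤ ε * maxSingleton f / k := by positivity
  have hkτ : k * (ε * maxSingleton f / k) ≤ ε * f O := by
    rw [mul_div_cancel₀ _ hk0.ne']
    exact mul_le_mul_of_nonneg_left (maxSingleton_le hk hO) hε.le
  have h := sat_parallelInterlaceGreedy (f := f) (φ := fun A' _ => Guarantee f O k ε A')
    (Prog.Sat.bind (fun s r h => h) (mainLoop_sound hf h0 hε hε1 hτ hkτ hO.1 N N _ 1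
      (loopInv_initState hε hε1 hτ)))
  rcases h.of_mem_support_run o ho with ⟨a, ha, hφ⟩ | ⟨hn, -⟩
  · rw [hA, Option.some_inj] at ha
    rwa [ha]
  · rw [hA] at hn
    exact absurd hn (Option.some_ne_none _)

/-! ### Termination -/

/-- The main loop stops at once if all the thresholds are below `τmin`. -/
theorem mainLoop_sat_of_lt {s : State U 2} (h : ∀ j, s.τ j < τmin) (n N r : ℕ) :
    Prog.Sat f (fun _ _ => True) False r (mainLoop ε τmin (N + 1) (n + 1) s) := by
  classical
  rw [mainLoop]
  split_ifs
  · trivial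
  refine Prog.Sat.bind (φ := fun s' _ => ∀ j, s'.τ j < τmin) (fun s' r' hs' => ?_) ?_
  · dsimp only
    rw [dif_neg]
    · trivial
    · rintro ⟨j, hj⟩
      exact (Finset.mem_filter.1 hj).2 (hs' j)
  · unfold update
    simp only [Prog.Sat]
    rw [updateLoop]
    dsimp only
    rw [if_pos]
    · exact h
    · exact Finset.filter_eq_empty_iff.2 fun j _ hj => absurd hj.2 (not_le.2 (h j))

/-- Every marginal gain is at most the corresponding gain over ∅, which is not positive here. -/
theorem le_zero_of_maxSingleton (hf : IsSubmodular f) (h : f ∅ = 0) (hM : maxSingleton f = 0)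
    (S : Finset U) : f S ≤ 0 := by
  induction S using Finset.induction_on with
  | empty => exact h.le
  | insert x S hx ih =>
      have h1 := hf (Finset.empty_subset S) x hx
      have h2 := le_maxSingleton (f := f) x
      rw [insert_empty_eq] at h1
      linarith

theorem empty_pos (h0 : ∀ S, 0 ≤ f S) (hf : IsSubmodular f) (hne : ∃ S, f S ≠ 0)
    (hM : maxSingleton f = 0) : 0 < f ∅ := by
  refine (h0 ∅).lt_of_ne fun h => ?_
  obtain ⟨S, hS⟩ := hne
  exact hS (le_antisymm (le_zero_of_maxSingleton hf h.symm hM S) (h0 S))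

/-- With M = 0 and f ∅ > 0, two distinct elements would give f {x, y} ≤ f {x} + f {y} - f ∅ < 0. So
the degenerate case M = 0, in which τmin = 0 and the potential is useless, occurs only for n = 1. -/
theorem card_eq_one (h0 : ∀ S, 0 ≤ f S) (hf : IsSubmodular f) (hne : ∃ S, f S ≠ 0)
    (hM : maxSingleton f = 0) : Fintype.card U = 1 := by
  have hpos := empty_pos h0 hf hne hM
  refine le_antisymm (Fintype.card_le_one_iff.2 fun x y => ?_) Fintype.card_pos
  by_contra hxy
  have h1 := hf (Finset.empty_subset {y}) x (by simpa using hxy)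
  have h2 := le_maxSingleton (f := f) x
  have h3 := h0 (insert x {y})
  have h4 := le_maxSingleton (f := f) y
  have h5 := h0 {y}
  rw [insert_empty_eq] at h1
  linarith

theorem initState_τ_lt (h0 : ∀ S, 0 ≤ f S) (hf : IsSubmodular f) (hne : ∃ S, f S ≠ 0)
    (hM : maxSingleton f = 0) (j : Fin 2) : (initState f k).τ j < 0 := by
  have hpos := empty_pos h0 hf hne hM
  refine (Finset.sup'_lt_iff Finset.univ_nonempty).2 fun x _ => ?_
  rw [gain_empty]
  linarith [le_maxSingleton (f := f) x]

/-- A number of iterations that is never exceeded. -/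
noncomputable def fuel (f : Finset U → ℝ) (k : ℕ) (ε τmin : ℝ) : ℕ :=
  max (k + 1) ((initState f k).pot f ε τmin + 1)

/-- For M > 0 the potential argument applies. For M = 0 the initial thresholds are negative while
τmin = 0, so the algorithm stops in its first iteration. -/
theorem result_ne_none (h0 : ∀ S, 0 ≤ f S) (hf : IsSubmodular f) (hk : 1 ≤ k)
    (hε : 0 < ε) (hε1 : ε < 1) (hne : ∃ S, f S ≠ 0)
    (hN : fuel f k ε (ε * maxSingleton f / k) ≤ N) {o : Outcome (Fin 2 → Finset U)}
    (ho : o ∈ ((parallelInterlaceGreedy U k 2 (ε * maxSingleton f / k) ε N).run f).support) :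
    o.result ≠ none := by
  have hk0 : (0 : ℝ) < k := by exact_mod_cast hk
  have hN1 : k + 1 ≤ N := (le_max_left _ _).trans hN
  have hN2 := (le_max_right _ _).trans hN
  have key : Prog.Sat f (fun _ _ => True) False 1
      (mainLoop ε (ε * maxSingleton f / k) N N (initState f k)) := by
    rcases (maxSingleton_nonneg h0).eq_or_lt with hM | hM
    · obtain ⟨N', rfl⟩ : ∃ N', N = N' + 1 := ⟨N - 1, by omega⟩
      refine mainLoop_sat_of_lt (fun j => ?_) N' N' 1
      rw [← hM, mul_zero, zero_div]
      exact initState_τ_lt h0 hf hne hM.symm j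
    · exact mainLoop_terminates hf hε hε1 (by positivity) N N _ 1 tidy_initState hN2 hN1
  have h := sat_parallelInterlaceGreedy (f := f) (φ := fun _ _ => True)
    (Prog.Sat.bind (fun s r h => h) key)
  rcases h.of_mem_support_run o ho with ⟨a, ha, -⟩ | ⟨-, h'⟩
  · rw [ha]
    exact Option.some_ne_none _
  · exact h'.elim

end

end PIG

/-! ### Bounds for the initial potential -/

section

theorem one_le_log {n : ℕ} (hn : 2 ≤ n) : 1 ≤ 3 / 2 * Real.log n := by
  have h1 : Real.log 2 ≤ Real.log n := Real.log_le_log (by norm_num) (by exact_mod_cast hn)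
  linarith [Real.log_two_gt_d9]

theorem natSize_le {n : ℕ} (hn : 2 ≤ n) : (Nat.size n : ℝ) ≤ 3 * Real.log n := by
  have h1 := one_le_log hn
  obtain ⟨m, hm⟩ : ∃ m, Nat.size n = m + 1 :=
    Nat.exists_eq_succ_of_ne_zero (Nat.size_pos.2 (by omega)).ne'
  have h2 : 2 ^ m ≤ n := Nat.lt_size.1 (by omega)
  have h3 : m * Real.log 2 ≤ Real.log n := by
    rw [← Real.log_pow]
    exact Real.log_le_log (by positivity) (by exact_mod_cast h2)
  have h4 : (0 : ℝ) ≤ m := Nat.cast_nonneg m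
  rw [hm]
  push_cast
  nlinarith [Real.log_two_gt_d9]

/-- The thresholds range over a factor of at most k/ε, and log (1/ε) is crudely bounded by 1/ε;
after division by ε this gives ε⁻² log k. -/
theorem levels_le {ε M τ : ℝ} {k : ℕ} (hε : 0 < ε) (hε1 : ε < 1) (hM : 0 < M) (hk : 2 ≤ k)
    (hτ : ε * M / k ≤ τ) (hτM : τ ≤ M) :
    (levels ε (ε * M / k) τ : ℝ) ≤ 6 * (ε⁻¹ ^ 2 * Real.log k) := by
  have hk0 : (0 : ℝ) < k := by positivity
  have ha : 1 ≤ ε⁻¹ := (one_le_inv₀ hε).2 hε1.le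
  have hL := one_le_log hk
  have hτ0 : 0 < ε * M / k := by positivity
  have h1 : τ / (ε * M / k) ≤ k * ε⁻¹ := by
    rw [div_le_iff₀ hτ0]
    calc τ ≤ M := hτM
      _ = _ := by field_simp
  have h2 : Real.log (τ / (ε * M / k)) ≤ Real.log k + ε⁻¹ := by
    refine (Real.log_le_log (div_pos (hτ0.trans_le hτ) hτ0) h1).trans ?_
    rw [Real.log_mul hk0.ne' (by positivity)]
    linarith [Real.log_le_sub_one_of_pos (inv_pos.2 hε)]
  have h3 : 0 ≤ Real.log (τ / (ε * M / k)) := Real.log_nonneg ((one_le_div hτ0).2 hτ)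
  unfold levels
  have h4 := (Nat.ceil_lt_add_one (div_nonneg h3 hε.le)).le
  push_cast
  have h5 : Real.log (τ / (ε * M / k)) / ε ≤ (Real.log k + ε⁻¹) * ε⁻¹ := by
    rw [div_eq_mul_inv]
    gcongr
  set a := ε⁻¹
  set L := Real.log k
  have h6 : a ≤ a ^ 2 := by nlinarith
  have h7 : a * L ≤ a ^ 2 * L := by gcongr
  have h8 : a ^ 2 ≤ 3 / 2 * (a ^ 2 * L) := by nlinarith
  nlinarith

theorem logSize_le {ε : ℝ} {n : ℕ} (hε : 0 < ε) (hε1 : ε < 1) (hn : 2 ≤ n) :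
    (logSize ε n : ℝ) + 3 ≤ 72 * (ε⁻¹ * Real.log n) := by
  have ha : 1 ≤ ε⁻¹ := (one_le_inv₀ hε).2 hε1.le
  have hL := one_le_log hn
  have h1 : 0 ≤ 64 * Real.log n / ε := div_nonneg (by linarith) hε.le
  have h2 := (Nat.ceil_lt_add_one h1).le
  rw [logSize, if_neg (by omega)]
  push_cast
  have h3 : 64 * Real.log n / ε = 64 * (ε⁻¹ * Real.log n) := by
    rw [div_eq_mul_inv]
    ring
  nlinarith

end

namespace PIG

section

variable {U : Type u} [Fintype U] [DecidableEq U] [Nonempty U] {f : Finset U → ℝ} {k N : ℕ}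
  {ε : ℝ}

theorem indexPot_initState_le (h0 : ∀ S, 0 ≤ f S) (hε : 0 < ε) (hε1 : ε < 1) (hk : 2 ≤ k)
    (hn : 2 ≤ Fintype.card U) (hM : 0 < maxSingleton f) (j : Fin 2) :
    ((initState f k).indexPot f ε (ε * maxSingleton f / k) j : ℝ) ≤
      540 * (ε⁻¹ ^ 3 * Real.log (Fintype.card U) * Real.log k) := by
  have ha : 1 ≤ ε⁻¹ := (one_le_inv₀ hε).2 hε1.le
  have hL := one_le_log hk
  have hL' := one_le_log hn
  rw [State.indexPot]
  split_ifs with hτ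
  · have h1 := levels_le hε hε1 hM hk hτ (initState_τ_le h0 j)
    have h2 := logSize_le hε hε1 hn
    have h3 : (logSize ε ((initState f k).cand f j).card : ℝ) ≤ logSize ε (Fintype.card U) := by
      exact_mod_cast logSize_mono hε (Finset.card_le_univ _)
    push_cast
    set a := ε⁻¹
    set L := Real.log k
    set L' := Real.log (Fintype.card U)
    have hL0 : 0 < L := by linarith
    have hL0' : 0 < L' := by linarith
    have h4 : (logSize ε (Fintype.card U) + 3 : ℝ) *
        levels ε (ε * maxSingleton f / k) ((initState f k).τ j) ≤
        72 * (a * L') * (6 * (a ^ 2 * L)) := by gcongr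
    have h5 : a * L' ≤ 3 / 2 * (a ^ 3 * L' * L) := by
      have e1 : a ≤ a ^ 3 := le_self_pow₀ ha (by norm_num)
      calc a * L' = a * L' * 1 := by ring
        _ ≤ a ^ 3 * L' * (3 / 2 * L) := by gcongr
        _ = _ := by ring
    nlinarith
  · have hL0 : 0 < Real.log k := by linarith
    have hL0' : 0 < Real.log (Fintype.card U) := by linarith
    push_cast
    positivity

theorem pot_initState_le (h0 : ∀ S, 0 ≤ f S) (hε : 0 < ε) (hε1 : ε < 1) (hk : 2 ≤ k)
    (hn : 2 ≤ Fintype.card U) (hM : 0 < maxSingleton f) :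
    ((initState f k).pot f ε (ε * maxSingleton f / k) : ℝ) ≤
      1085 * (ε⁻¹ ^ 3 * Real.log (Fintype.card U) * Real.log k) := by
  have h1 := indexPot_initState_le h0 hε hε1 hk hn hM
  have h2 := natSize_le hk
  have ha : 1 ≤ ε⁻¹ := (one_le_inv₀ hε).2 hε1.le
  have hL := one_le_log hk
  have hL' := one_le_log hn
  have hm : (initState f k).m₀ = k := rfl
  rw [State.pot, Fin.sum_univ_two, hm]
  push_cast
  have h3 : Real.log k ≤ 3 / 2 * (ε⁻¹ ^ 3 * Real.log (Fintype.card U) * Real.log k) := by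
    have hL0 : 0 < Real.log k := by linarith
    calc Real.log k = 1 * 1 * Real.log k := by ring
      _ ≤ ε⁻¹ ^ 3 * (3 / 2 * Real.log (Fintype.card U)) * Real.log k := by
        gcongr
        exact one_le_pow₀ ha
      _ = _ := by ring
  linarith [h1 0, h1 1]

/-- The number of rounds that is exceeded with probability at most `1 / n`. -/
noncomputable def roundBound (f : Finset U → ℝ) (k : ℕ) (ε : ℝ) : ℕ :=
  1 + 6 * (initState f k).pot f ε (ε * maxSingleton f / k) + 6 * Nat.size (Fintype.card U)

theorem roundBound_le (h0 : ∀ S, 0 ≤ f S) (hε : 0 < ε) (hε1 : ε < 1) (hk : 2 ≤ k)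
    (hn : 2 ≤ Fintype.card U) (hM : 0 < maxSingleton f) :
    (roundBound f k ε : ℝ) ≤ 7500 * (ε⁻¹ ^ 3 * Real.log (Fintype.card U) * Real.log k) := by
  have h1 := pot_initState_le h0 hε hε1 hk hn hM
  have h2 := natSize_le hn
  have ha : 1 ≤ ε⁻¹ := (one_le_inv₀ hε).2 hε1.le
  have hL := one_le_log hk
  have hL' := one_le_log hn
  have hL0' : 0 < Real.log (Fintype.card U) := by linarith
  have h3 : Real.log (Fintype.card U) ≤
      3 / 2 * (ε⁻¹ ^ 3 * Real.log (Fintype.card U) * Real.log k) := by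
    calc Real.log (Fintype.card U) = 1 * Real.log (Fintype.card U) * 1 := by ring
      _ ≤ ε⁻¹ ^ 3 * Real.log (Fintype.card U) * (3 / 2 * Real.log k) := by
        gcongr
        exact one_le_pow₀ ha
      _ = _ := by ring
  rw [roundBound]
  push_cast
  linarith

/-- Since 2 ≤ (9/8)⁶, six rounds outweigh one unit of potential, and six more per binary digit of n
make the tail at most 1/n. The remaining round is the initial query of the singletons. -/
theorem wexp_le_roundBound (hf : IsSubmodular f) (hε : 0 < ε) (hε1 : ε < 1) (hk : 1 ≤ k)
    (hM : 0 < maxSingleton f) :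
    Prog.wexp (9 / 8) f (fun _ => 1)
      (parallelInterlaceGreedy U k 2 (ε * maxSingleton f / k) ε N) ≤
      (Fintype.card U : ENNReal)⁻¹ * (9 / 8) ^ roundBound f k ε := by
  have hk0 : (0 : ℝ) < k := by exact_mod_cast hk
  have hq1 : (1 : ENNReal) ≤ 9 / 8 := by
    rw [← ENNReal.toReal_le_toReal (by finiteness) (by finiteness)]
    norm_num
  have hq2 : (2 : ENNReal) ≤ (9 / 8) ^ 6 := by
    rw [← ENNReal.toReal_le_toReal (by finiteness) (by finiteness)]
    norm_num
  have hn0 : (Fintype.card U : ENNReal) ≠ 0 := by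
    exact_mod_cast Fintype.card_ne_zero
  rw [wexp_parallelInterlaceGreedy, mul_comm (_ : ENNReal)⁻¹, ← div_eq_mul_inv,
    ENNReal.le_div_iff_mul_le (Or.inl hn0) (Or.inl (ENNReal.natCast_ne_top _))]
  have h1 := wexp_mainLoop_le hq1 le_rfl hf hε hε1 (by positivity) N N _
    (tidy_initState (f := f) (k := k) (τmin := ε * maxSingleton f / k))
  have h2 : (Fintype.card U : ENNReal) ≤ 2 ^ Nat.size (Fintype.card U) := by
    exact_mod_cast (Nat.lt_size_self _).le
  calc _ ≤ (9 / 8 : ENNReal) * 2 ^ (initState f k).pot f ε (ε * maxSingleton f / k) *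
        2 ^ Nat.size (Fintype.card U) := by gcongr
    _ ≤ 9 / 8 * ((9 / 8) ^ 6) ^ (initState f k).pot f ε (ε * maxSingleton f / k) *
        ((9 / 8) ^ 6) ^ Nat.size (Fintype.card U) := by gcongr
    _ = _ := by rw [roundBound, pow_add, pow_add, pow_one, pow_mul, pow_mul]

theorem le_toOuterMeasure (h0 : ∀ S, 0 ≤ f S) (hf : IsSubmodular f) (hk : 2 ≤ k)
    (hε : 0 < ε) (hε1 : ε < 1) (hne : ∃ S, f S ≠ 0)
    (hN : fuel f k ε (ε * maxSingleton f / k) ≤ N) :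
    ENNReal.ofReal (1 - 1 / (Fintype.card U : ℝ)) ≤
      ((parallelInterlaceGreedy U k 2 (ε * maxSingleton f / k) ε N).run f).toOuterMeasure
        {o | (o.rounds : ℝ) ≤ 30000 * (ε⁻¹ ^ 4 * Real.log (Fintype.card U) * Real.log k) ∧
          (o.queries : ℝ) ≤ 30000 *
            (ε⁻¹ ^ 5 * Fintype.card U * Real.log (Fintype.card U) * Real.log k)} := by
  rcases Nat.lt_or_ge (Fintype.card U) 2 with hn | hn
  -- For n = 1 the required probability is 0.
  · have h1 : Fintype.card U = 1 := le_antisymm (by omega) Fintype.card_pos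
    rw [h1]
    simp
  have hM : 0 < maxSingleton f := by
    refine (maxSingleton_nonneg h0).lt_of_ne fun h => ?_
    have := card_eq_one h0 hf hne h.symm
    omega
  have hn0 : (0 : ℝ) < Fintype.card U := by positivity
  have hδ : ENNReal.ofReal (1 - 1 / (Fintype.card U : ℝ)) =
      1 - (Fintype.card U : ENNReal)⁻¹ := by
    rw [ENNReal.ofReal_sub _ (by positivity), ENNReal.ofReal_one, one_div,
      ENNReal.ofReal_inv_of_pos hn0, ENNReal.ofReal_natCast]
  rw [hδ]
  refine Prog.toOuterMeasure_rounds_le (q := 9 / 8) ?_ (by finiteness)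
    (fun o ho => result_ne_none h0 hf (by omega) hε hε1 hne hN ho) (roundBound f k ε)
    (wexp_le_roundBound hf hε hε1 (by omega) hM) fun o ho hr => ?_
  · rw [← ENNReal.toReal_le_toReal (by finiteness) (by finiteness)]
    norm_num
  have hb := roundBound_le h0 hε hε1 hk hn hM
  have hr' : (o.rounds : ℝ) ≤ roundBound f k ε := by exact_mod_cast hr.le
  have hq : (o.queries : ℝ) ≤ 4 * Fintype.card U * o.rounds := by
    exact_mod_cast (maxBatch_parallelInterlaceGreedy k N).queries_le o ho
  have ha : 1 ≤ ε⁻¹ := (one_le_inv₀ hε).2 hε1.le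
  have hL : 0 < Real.log k := by linarith [one_le_log hk]
  have hL' : 0 < Real.log (Fintype.card U) := by linarith [one_le_log hn]
  -- The potential yields the exponent 3; one power of ε⁻¹ is given away. Batches of size at most 4n
  -- then produce the constant 4 · 7500 = 30000 for the queries.
  have h1 : (o.rounds : ℝ) ≤ 7500 * (ε⁻¹ ^ 4 * Real.log (Fintype.card U) * Real.log k) := by
    refine hr'.trans (hb.trans ?_)
    gcongr
    norm_num
  refine ⟨h1.trans ?_, hq.trans ?_⟩
  · gcongr
    norm_num
  · calc (4 : ℝ) * Fintype.card U * o.rounds ≤ 4 * Fintype.card U *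
          (7500 * (ε⁻¹ ^ 4 * Real.log (Fintype.card U) * Real.log k)) := by gcongr
      _ = 30000 * (ε⁻¹ ^ 4 * Fintype.card U * Real.log (Fintype.card U) * Real.log k) := by ring
      _ ≤ _ := by
        gcongr
        norm_num

end

end PIG

/-! ### The theorem, assembled from the guarantee, termination and the tail bound -/

theorem mainTheorem1 :
    ∃ C : ℝ, 0 < C ∧
      ∀ (U : Type u) [Fintype U] [DecidableEq U] [Nonempty U]
        (f : Finset U → ℝ) (k : ℕ) (ε : ℝ) (O : Finset U),
        (∀ S, 0 ≤ f S) → IsSubmodular f → 1 ≤ k → 0 < ε → ε < 1 → IsOptimal f k O →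
        -- the guarantee for every result that can be returned
        (∀ N : ℕ,
          ∀ o ∈ ((parallelInterlaceGreedy U k 2 (ε * maxSingleton f / k) ε N).run f).support,
          ∀ A' : Fin 2 → Finset U, o.result = some A' →
            (A' 0).card ≤ k ∧ (A' 1).card ≤ k ∧
              (1 / 4 - ε) * f O ≤ max (f (A' 0)) (f (A' 1))) ∧
        -- termination and complexity
        ((∃ S, f S ≠ 0) →
          ∃ N₀ : ℕ, ∀ N ≥ N₀,
            (∀ o ∈ ((parallelInterlaceGreedy U k 2 (ε * maxSingleton f / k) ε N).run f).support,
              o.result ≠ none) ∧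
            (2 ≤ k →
              ENNReal.ofReal (1 - 1 / (Fintype.card U : ℝ)) ≤
                ((parallelInterlaceGreedy U k 2 (ε * maxSingleton f / k) ε N).run f).toOuterMeasure
                  {o | (o.rounds : ℝ) ≤
                        C * (ε⁻¹ ^ 4 * Real.log (Fintype.card U) * Real.log k) ∧
                      (o.queries : ℝ) ≤
                        C * (ε⁻¹ ^ 5 * Fintype.card U * Real.log (Fintype.card U) *
                          Real.log k)})) := by
  refine ⟨30000, by norm_num, fun U _ _ _ f k ε O h0 hf hk hε hε1 hO => ⟨fun N o ho A' hA =>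
    PIG.guarantee_of_mem_support h0 hf hk hε hε1 hO ho hA, fun hne =>
    ⟨PIG.fuel f k ε (ε * maxSingleton f / k), fun N hN => ⟨fun o ho =>
      PIG.result_ne_none h0 hf hk hε hε1 hne hN ho, fun hk2 =>
      PIG.le_toOuterMeasure h0 hf hk2 hε hε1 hne hN⟩⟩⟩⟩
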